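/- Let $\mathbb{D}$ be the open unit disk, and let $\Gamma$ be a non-elementary Fuchsian group, i.e. a discrete subgroup of the group $\mathrm{Aut}(\mathbb{D})\cong PSU(1,1)$ of Möbius transformations of the disk whose limit set in $\partial\mathbb{D}$ is infinite. Let $C(\partial\mathbb{D})\times\Gamma$ be the full crossed product $C^*$-algebra for the action $\alpha_\gamma(f)=f\circ\gamma^{-1}$, with canonical unitaries $[\gamma]$, $\gamma\in\Gamma$. For a Hilbert space $H$ let $\pi:\mathcal{B}(H)\to\mathcal{Q}(H)=\mathcal{B}(H)/\mathcal{K}(H)$ be the quotient map onto the Calkin algebra. On the Hardy space $H^2$ let $M_z$ be multiplication by $z$, let $C_\gamma f=f\circ\gamma$, let $U_\gamma=(C_\gamma C_\gamma^*)^{-1/2}C_\gamma$ be the unitary part of the polar decomposition of $C_\gamma$, and let $\mathcal{C}_\Gamma$ be the $C^*$-algebra generated by $\{C_\gamma:\gamma\in\Gamma\}$. On the Dirichlet space $\mathcal{D}$, the analytic functions $f=\sum a_nz^n$ on $\mathbb{D}$ with $\|f\|^2=|a_0|^2+\sum_{n\ge1}n|a_n|^2<\infty$, let $M_z$ be multiplication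 by $z$ and let $u_\gamma$ be the operator given by $(u_\gamma f)(z)=f(\gamma(z))-f(\gamma(0))$ on the functions vanishing at $0$ and by the identity on the constants. Then: 1. There is a unique unital $*$-homomorphism $\tau:C(\partial\mathbb{D})\times\Gamma\to\mathcal{Q}(H^2)$ (the Busby map of $\mathcal{C}_\Gamma$) such that $\tau(z)=\pi(M_z)$, $\tau([\gamma])=\pi(U_{\gamma^{-1}})$ for all $\gamma\in\Gamma$, and $\mathcal{C}_\Gamma=\pi^{-1}(\operatorname{ran}\tau)$. 2. The operators $u_\gamma$ are unitary on $\mathcal{D}$, and there is a unique unital $*$-homomorphism $\sigma_+:C(\partial\mathbb{D})\times\Gamma\to\mathcal{Q}(\mathcal{D})$ (the $\Gamma$-equivariant Toeplitz extension) such that $\sigma_+(z)=\pi(M_z)$ and $\sigma_+([\gamma])=\pi(u_{\gamma^{-1}})$ for all $\gamma\in\Gamma$. 3. $\tau$ and $\sigma_+$ are unitarily equivalent: there is a bounded operator $v:H^2\to\mathcal{D}$ such that $v^*v-1$ and $vv^*-1$ are compact and $\pi(v)\tau(a)\pi(v)^*=\sigma_+(a)$ for all $a\in C(\partial\mathbb{D})\times\Gamma$.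 -/

import Mathlib

open scoped ENNReal ComplexConjugate Topology
open Filter

noncomputable section

/-! ## Möbius automorphisms of the disk and Fuchsian groups -/

/-- The closed unit disk. -/
abbrev ClosedDisk : Type := Metric.closedBall (0 : ℂ) 1

/-- The centre of the disk. -/
def diskOrigin : ClosedDisk := ⟨0, by simp⟩

theorem mobius_denom_ne_zero {α β : ℂ} (h : ‖α‖ ^ 2 - ‖β‖ ^ 2 = 1) {z : ℂ} (hz : ‖z‖ ≤ 1) :
    conj β * z + conj α ≠ 0 := by
  intro h0
  have h1 : conj α = -(conj β * z) := by linear_combination h0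
  have h2 : ‖α‖ = ‖β‖ * ‖z‖ := by
    have := congrArg norm h1
    simpa using this
  have h3 : ‖α‖ ≤ ‖β‖ := by
    rw [h2]; exact mul_le_of_le_one_right (norm_nonneg _) hz
  nlinarith [norm_nonneg α, norm_nonneg β]

/-- The group `Aut(𝔻) ≅ PSU(1,1)` of Möbius transformations of the unit disk, i.e. the maps
`z ↦ (α z + β) / (conj β z + conj α)` with `|α|² - |β|² = 1`, acting on the closed disk. -/
def DiskAut : Subgroup (ClosedDisk ≃ₜ ClosedDisk) where
  carrier := {g | ∃ α β : ℂ, ‖α‖ ^ 2 - ‖β‖ ^ 2 = 1 ∧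
    ∀ z : ClosedDisk, (g z : ℂ) = (α * z + β) / (conj β * z + conj α)}
  one_mem' := ⟨1, 0, by simp, fun z => by simp⟩
  mul_mem' := by
    rintro g h ⟨a, b, hab, hg⟩ ⟨c, d, hcd, hh⟩
    have key : ‖a * c + b * conj d‖ ^ 2 - ‖a * d + b * conj c‖ ^ 2 = 1 := by
      have e : (‖a‖ ^ 2 - ‖b‖ ^ 2) * (‖c‖ ^ 2 - ‖d‖ ^ 2) = 1 := by rw [hab, hcd]; ring
      rw [← e]
      simp only [← Complex.normSq_eq_norm_sq, Complex.normSq_apply, Complex.add_re,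
        Complex.add_im, Complex.mul_re, Complex.mul_im, Complex.conj_re, Complex.conj_im]
      ring
    refine ⟨a * c + b * conj d, a * d + b * conj c, key, fun z => ?_⟩
    have hz : ‖(z : ℂ)‖ ≤ 1 := mem_closedBall_zero_iff.1 z.2
    have h1 := mobius_denom_ne_zero hcd hz
    have h2 := mobius_denom_ne_zero key hz
    have h3 : conj b * ((h z : ClosedDisk) : ℂ) + conj a ≠ 0 :=
      mobius_denom_ne_zero hab (mem_closedBall_zero_iff.1 (h z).2)
    change ((g (h z) : ClosedDisk) : ℂ) = _
    have hw := hh z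
    rw [eq_div_iff h1] at hw
    rw [hg, div_eq_div_iff h3 h2]
    simp only [map_add, map_mul, Complex.conj_conj]
    linear_combination (a * conj a - b * conj b) * hw
  inv_mem' := by
    rintro g ⟨a, b, hab, hg⟩
    have key : ‖conj a‖ ^ 2 - ‖-b‖ ^ 2 = 1 := by simpa using hab
    refine ⟨conj a, -b, key, fun z => ?_⟩
    have hz : ‖(z : ℂ)‖ ≤ 1 := mem_closedBall_zero_iff.1 z.2
    have h2 := mobius_denom_ne_zero key hz
    have hw : ‖((g⁻¹ z : ClosedDisk) : ℂ)‖ ≤ 1 := mem_closedBall_zero_iff.1 (g⁻¹ z).2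
    have h1 := mobius_denom_ne_zero hab hw
    have h4 : (z : ℂ) = (a * ((g⁻¹ z : ClosedDisk) : ℂ) + b) /
        (conj b * ((g⁻¹ z : ClosedDisk) : ℂ) + conj a) := by
      rw [← hg]
      congr 1
      exact (g.apply_symm_apply z).symm
    rw [eq_div_iff h1] at h4
    rw [eq_div_iff h2]
    simp only [map_neg, Complex.conj_conj]
    linear_combination -h4

theorem norm_diskAut_apply (g : DiskAut) {z : ClosedDisk} (hz : ‖(z : ℂ)‖ = 1) :
    ‖((g : ClosedDisk ≃ₜ ClosedDisk) z : ℂ)‖ = 1 := by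
  obtain ⟨g, a, b, hab, hg⟩ := g
  have h1 := mobius_denom_ne_zero hab hz.le
  change ‖(g z : ℂ)‖ = 1
  rw [hg, norm_div, div_eq_one_iff_eq (norm_ne_zero_iff.2 h1)]
  have hz2 : (z : ℂ) * conj (z : ℂ) = 1 := by
    rw [Complex.mul_conj, Complex.normSq_eq_norm_sq, hz]; simp
  have e : a * (z : ℂ) + b = z * conj (conj b * (z : ℂ) + conj a) := by
    simp only [map_add, map_mul, Complex.conj_conj]
    linear_combination (-b) * hz2
  rw [e, norm_mul, hz, one_mul, Complex.norm_conj]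

/-- The action of a Möbius transformation on the boundary circle `∂𝔻`. -/
def DiskAut.boundary (g : DiskAut) : C(Circle, Circle) where
  toFun ζ := ⟨((g : ClosedDisk ≃ₜ ClosedDisk) ⟨ζ, mem_closedBall_zero_iff.2 ζ.norm_coe.le⟩ : ℂ),
    mem_sphere_zero_iff_norm.2 (norm_diskAut_apply g ζ.norm_coe)⟩
  continuous_toFun := by
    refine Continuous.subtype_mk ?_ _
    refine continuous_subtype_val.comp ((g : ClosedDisk ≃ₜ ClosedDisk).continuous.comp ?_)
    exact Continuous.subtype_mk continuous_subtype_val _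

/-- The limit set of `Γ`: the accumulation points on the circle of the orbit of the centre. -/
def limitSet (Γ : Subgroup DiskAut) : Set ℂ :=
  {ζ | ‖ζ‖ = 1 ∧ AccPt ζ
    (𝓟 (Set.range fun γ : Γ => (((γ : DiskAut) : ClosedDisk ≃ₜ ClosedDisk) diskOrigin : ℂ)))}

/-- A Fuchsian group: a subgroup of `Aut(𝔻)` which is discrete for the topology of uniform
convergence on the closed disk. -/
def IsFuchsian (Γ : Subgroup DiskAut) : Prop :=
  DiscreteTopology (Set.range fun γ : Γ =>
    ((((γ : DiskAut) : ClosedDisk ≃ₜ ClosedDisk) : C(ClosedDisk, ClosedDisk))))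

/-- A group is non-elementary if its limit set is infinite. -/
def IsNonElementary (Γ : Subgroup DiskAut) : Prop := (limitSet Γ).Infinite

/-! ## Hilbert spaces of analytic functions on the disk -/

/-- Taylor coefficient sequences `a` with `∑ w n |a n|² < ∞`. -/
def weightedSeq (w : ℕ → ℕ+) : Submodule ℂ (ℕ → ℂ) where
  carrier := {a | Memℓp (fun n => (Real.sqrt (w n : ℕ) : ℂ) * a n) 2}
  zero_mem' := by
    have : (fun n => (Real.sqrt (w n : ℕ) : ℂ) * (0 : ℕ → ℂ) n) = 0 := by ext; simp
    simpa only [Set.mem_ofPred_eq, this] using zero_memℓp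
  add_mem' := by
    intro a b ha hb
    have := Memℓp.add ha hb
    refine (congrArg (fun f : ℕ → ℂ => Memℓp f 2) ?_).mp this
    ext n; simp [mul_add]
  smul_mem' := by
    intro c a ha
    have := Memℓp.const_smul ha c
    refine (congrArg (fun f : ℕ → ℂ => Memℓp f 2) ?_).mp this
    ext n; simp; ring

theorem mem_weightedSeq_iff {w : ℕ → ℕ+} {a : ℕ → ℂ} :
    a ∈ weightedSeq w ↔ Summable fun n => ((w n : ℕ) : ℝ) * ‖a n‖ ^ 2 := by
  change Memℓp _ 2 ↔ _
  rw [memℓp_gen_iff (by norm_num)]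
  refine iff_of_eq (congrArg _ (funext fun n => ?_))
  simp [mul_pow]

/-- The Hilbert space of analytic functions `f(z) = ∑ a_n z^n` on `𝔻` with
`‖f‖² = ∑ w_n |a_n|² < ∞`, for positive integer weights `w_n`; an element is stored as its sequence
of Taylor coefficients. -/
def DiskSpace (w : ℕ → ℕ+) : Type := weightedSeq w

namespace DiskSpace

variable {w : ℕ → ℕ+}

instance : AddCommGroup (DiskSpace w) := inferInstanceAs (AddCommGroup (weightedSeq w))

instance : Module ℂ (DiskSpace w) := inferInstanceAs (Module ℂ (weightedSeq w))

/-- The `n`-th Taylor coefficient. -/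
def coeff (f : DiskSpace w) (n : ℕ) : ℂ := f.1 n

/-- The function on the disk: `f(z) = ∑ a_n z^n`. -/
def eval (f : DiskSpace w) (z : ℂ) : ℂ := ∑' n, f.coeff n * z ^ n

/-- The identification `(a_n) ↦ (√w_n a_n)` with `ℓ²`. -/
def toL2 (w : ℕ → ℕ+) : DiskSpace w ≃ₗ[ℂ] lp (fun _ : ℕ => ℂ) 2 where
  toFun f := ⟨fun n => (Real.sqrt (w n : ℕ) : ℂ) * f.coeff n, f.2⟩
  map_add' f g := by ext n; exact mul_add _ _ _
  map_smul' c f := by ext n; exact mul_left_comm _ _ _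
  invFun b := ⟨fun n => (Real.sqrt (w n : ℕ) : ℂ)⁻¹ * b n, by
    have hb : Memℓp (b : ℕ → ℂ) 2 := b.2
    refine (congrArg (fun f : ℕ → ℂ => Memℓp f 2) ?_).mp hb
    ext n
    have : (Real.sqrt (w n : ℕ) : ℂ) ≠ 0 := by simp
    field_simp⟩
  left_inv f := by
    refine Subtype.ext (funext fun n => ?_)
    have : (Real.sqrt (w n : ℕ) : ℂ) ≠ 0 := by simp
    exact inv_mul_cancel_left₀ this _
  right_inv b := by
    ext n
    have : (Real.sqrt (w n : ℕ) : ℂ) ≠ 0 := by simp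
    exact mul_inv_cancel_left₀ this _

instance : NormedAddCommGroup (DiskSpace w) :=
  NormedAddCommGroup.induced (DiskSpace w) (lp (fun _ : ℕ => ℂ) 2) (toL2 w).toLinearMap
    (toL2 w).injective

instance : InnerProductSpace ℂ (DiskSpace w) where
  norm_smul_le c f := by
    change ‖toL2 w (c • f)‖ ≤ ‖c‖ * ‖toL2 w f‖
    rw [map_smul]; exact norm_smul_le _ _
  inner f g := inner ℂ (toL2 w f) (toL2 w g)
  norm_sq_eq_re_inner f := norm_sq_eq_re_inner (𝕜 := ℂ) (toL2 w f)
  conj_inner_symm f g := inner_conj_symm (𝕜 := ℂ) (toL2 w f) (toL2 w g)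
  add_left f g h := by rw [map_add]; exact inner_add_left _ _ _
  smul_left f g c := by rw [map_smul]; exact inner_smul_left _ _ _

/-- `toL2` as an isometric isomorphism. -/
def toL2Isometry (w : ℕ → ℕ+) : DiskSpace w ≃ₗᵢ[ℂ] lp (fun _ : ℕ => ℂ) 2 :=
  { toL2 w with norm_map' := fun _ => rfl }

instance : CompleteSpace (DiskSpace w) :=
  (completeSpace_congr (e := (toL2Isometry w).toEquiv)
    (toL2Isometry w).isometry.isUniformEmbedding).2 inferInstance

theorem norm_sq_eq_tsum (f : DiskSpace w) :
    ‖f‖ ^ 2 = ∑' n, ((w n : ℕ) : ℝ) * ‖f.coeff n‖ ^ 2 := by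
  have h := lp.norm_rpow_eq_tsum (p := 2) (by norm_num) (toL2 w f)
  have h' : ‖f‖ ^ 2 = ∑' n, ‖(Real.sqrt (w n : ℕ) : ℂ) * f.coeff n‖ ^ 2 := by
    simp only [ENNReal.toReal_ofNat, Real.rpow_ofNat] at h
    exact h
  rw [h']
  refine tsum_congr fun n => ?_
  simp [mul_pow]

end DiskSpace

/-- The Hardy space `H²`: `‖∑ a_n z^n‖² = ∑ |a_n|²`. -/
abbrev HardySpace : Type := DiskSpace fun _ => 1

/-- The Dirichlet space `𝒟`:
`‖∑ a_n z^n‖² = |a_0|² + ∑_{n ≥ 1} n |a_n|² = |f(0)|² + D(f)`, where `D(f) = ∫_𝔻 |f'|² dA` for the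
normalized area measure. (The weight `n.toPNat'` is `n` for `n ≥ 1` and `1` for `n = 0`.) -/
abbrev DirichletSpace : Type := DiskSpace fun n => n.toPNat'

namespace DiskSpace

variable {w : ℕ → ℕ+}

/-- `M` is the operator of multiplication by `z`. -/
def IsMulZ (M : DiskSpace w →L[ℂ] DiskSpace w) : Prop :=
  ∀ (f : DiskSpace w) (z : ℂ), ‖z‖ < 1 → (M f).eval z = z * f.eval z

/-- `C` is the composition operator `C_γ f = f ∘ γ`. -/
def IsComposition (γ : DiskAut) (C : DiskSpace w →L[ℂ] DiskSpace w) : Prop :=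
  ∀ (f : DiskSpace w) (z : ClosedDisk), ‖(z : ℂ)‖ < 1 →
    (C f).eval z = f.eval ((γ : ClosedDisk ≃ₜ ClosedDisk) z)

/-- `u` is the operator which acts as `f ↦ f ∘ γ - f(γ(0))` on functions vanishing at `0` and
trivially on the constants, i.e. `u f = f ∘ γ - f(γ(0)) + f(0)`. -/
def IsReducedComposition (γ : DiskAut) (u : DiskSpace w →L[ℂ] DiskSpace w) : Prop :=
  ∀ (f : DiskSpace w) (z : ClosedDisk), ‖(z : ℂ)‖ < 1 →
    (u f).eval z = f.eval ((γ : ClosedDisk ≃ₜ ClosedDisk) z)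
      - f.eval ((γ : ClosedDisk ≃ₜ ClosedDisk) diskOrigin) + f.eval 0

end DiskSpace

/-- `U = (C C*)^{-1/2} C` for an invertible operator `C`: the unitary part of the polar
decomposition `C = (C C*)^{1/2} U`. -/
def IsPolarUnitary {H : Type*} [NormedAddCommGroup H] [InnerProductSpace ℂ H] [CompleteSpace H]
    (C U : H →L[ℂ] H) : Prop :=
  U ∈ unitary (H →L[ℂ] H) ∧ C = CFC.sqrt (C * star C) * U

/-- The C⋆-algebra `𝒞_Γ` generated by the composition operators on `H²` with symbols in `Γ`. -/
def compositionAlgebra (Γ : Subgroup DiskAut) : StarSubalgebra ℂ (HardySpace →L[ℂ] HardySpace) :=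
  (StarAlgebra.adjoin ℂ {C | ∃ γ ∈ Γ, DiskSpace.IsComposition γ C}).topologicalClosure

/-! ## The Calkin algebra -/

section Calkin

variable (H : Type*) [NormedAddCommGroup H] [InnerProductSpace ℂ H] [CompleteSpace H]

/-- The ideal of compact operators. -/
def compactIdeal : Ideal (H →L[ℂ] H) where
  carrier := {T | IsCompactOperator T}
  add_mem' h h' := IsCompactOperator.add h h'
  zero_mem' := isCompactOperator_zero
  smul_mem' S _ h := IsCompactOperator.clm_comp h S

instance : (compactIdeal H).IsTwoSided := ⟨fun S h => IsCompactOperator.comp_clm h S⟩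

theorem isCompactOperator_star {T : H →L[ℂ] H} (hT : IsCompactOperator (T : H → H)) :
    IsCompactOperator (star T : H →L[ℂ] H) := by
  have hTT : IsCompactOperator (T * star T : H →L[ℂ] H) := IsCompactOperator.comp_clm hT (star T)
  have htb : TotallyBounded ((T * star T : H →L[ℂ] H) '' Metric.closedBall 0 1) :=
    ((IsCompactOperator.isCompact_closure_image_closedBall (f := (T * star T : H →L[ℂ] H).toLinearMap)
      hTT 1).totallyBounded).subset subset_closure
  refine (isCompactOperator_iff_isCompact_closure_image_closedBall
    (star T : H →L[ℂ] H).toLinearMap one_pos).2 ?_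
  refine (TotallyBounded.closure ?_).isCompact_of_isClosed isClosed_closure
  refine Metric.totallyBounded_iff.2 fun ε hε => ?_
  obtain ⟨t, hts, htf, htc⟩ := Metric.finite_approx_of_totallyBounded htb (ε ^ 2 / 2) (by positivity)
  choose! g hg using fun y (hy : y ∈ t) => hts hy
  refine ⟨(fun y => star T (g y)) '' t, htf.image _, ?_⟩
  rintro _ ⟨x, hx, rfl⟩
  obtain ⟨y, hy, hxy⟩ := Set.mem_iUnion₂.1 (htc ⟨x, hx, rfl⟩)
  refine Set.mem_iUnion₂.2 ⟨star T (g y), ⟨y, hy, rfl⟩, ?_⟩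
  obtain ⟨hgy, hgy'⟩ := hg y hy
  rw [mem_closedBall_zero_iff] at hx hgy
  rw [← hgy', mem_ball_iff_norm, ← map_sub] at hxy
  change star T x ∈ _
  rw [mem_ball_iff_norm, ← map_sub]
  set d := x - g y with hd
  have hd2 : ‖d‖ ≤ 2 := (norm_sub_le _ _).trans (by linarith)
  have h1 : ‖star T d‖ ^ 2 ≤ ‖(T * star T) d‖ * ‖d‖ := by
    have h2 := (star T : H →L[ℂ] H).apply_norm_sq_eq_inner_adjoint_left d
    rw [← ContinuousLinearMap.star_eq_adjoint, star_star] at h2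
    rw [h2]
    exact (RCLike.re_le_norm _).trans (norm_inner_le_norm _ _)
  have h4 : ‖star T d‖ ^ 2 < ε ^ 2 := by
    nlinarith [norm_nonneg ((T * star T) d), norm_nonneg d]
  exact lt_of_pow_lt_pow_left₀ 2 hε.le h4

/-- The Calkin algebra `𝒬(H) = ℬ(H) / 𝒦(H)`. -/
def Calkin : Type _ := (H →L[ℂ] H) ⧸ compactIdeal H

instance : Ring (Calkin H) := inferInstanceAs (Ring ((H →L[ℂ] H) ⧸ compactIdeal H))

instance : Algebra ℂ (Calkin H) := inferInstanceAs (Algebra ℂ ((H →L[ℂ] H) ⧸ compactIdeal H))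

instance : StarRing (Calkin H) where
  star := Quotient.map' star (by
    intro S T h
    have h' : S - T ∈ compactIdeal H := (Submodule.quotientRel_def _).1 h
    have h'' : star S - star T ∈ compactIdeal H := by
      rw [← star_sub]
      exact isCompactOperator_star H h'
    exact (Submodule.quotientRel_def _).2 h'')
  star_involutive := by
    rintro ⟨T⟩
    exact congrArg (Ideal.Quotient.mk (compactIdeal H)) (star_star T)
  star_mul := by
    rintro ⟨S⟩ ⟨T⟩
    exact congrArg (Ideal.Quotient.mk (compactIdeal H)) (star_mul S T)
  star_add := by
    rintro ⟨S⟩ ⟨T⟩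
    exact congrArg (Ideal.Quotient.mk (compactIdeal H)) (star_add S T)

variable {H}

/-- The quotient map `π : ℬ(H) → 𝒬(H)`. -/
def calkinMk : (H →L[ℂ] H) →⋆ₐ[ℂ] Calkin H :=
  { Ideal.Quotient.mkₐ ℂ (compactIdeal H) with map_star' := fun _ => rfl }

end Calkin

/-- Unitary equivalence of `τ₁ : A → 𝒬(H₁)` and `τ₂ : A → 𝒬(H₂)`: there is `v : H₁ → H₂` with `π(v)`
unitary and `π(v) τ₁(a) π(v)* = τ₂(a)` for all `a`. -/
def UnitarilyEquivalent {A H₁ H₂ : Type*} [Semiring A] [Algebra ℂ A] [Star A]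
    [NormedAddCommGroup H₁] [InnerProductSpace ℂ H₁] [CompleteSpace H₁]
    [NormedAddCommGroup H₂] [InnerProductSpace ℂ H₂] [CompleteSpace H₂]
    (τ₁ : A →⋆ₐ[ℂ] Calkin H₁) (τ₂ : A →⋆ₐ[ℂ] Calkin H₂) : Prop :=
  ∃ v : H₁ →L[ℂ] H₂,
    calkinMk (v.adjoint ∘L v) = 1 ∧ calkinMk (v ∘L v.adjoint) = 1 ∧
    ∀ (a : A) (T : H₁ →L[ℂ] H₁), calkinMk T = τ₁ a →
      calkinMk (v ∘L T ∘L v.adjoint) = τ₂ a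

/-! ## The full crossed product `C(∂𝔻) × Γ` -/

/-- A covariant representation of `(Γ, ∂𝔻)` on a (nonzero) Hilbert space. -/
structure CovariantRep (Γ : Subgroup DiskAut) : Type 1 where
  /-- The Hilbert space. -/
  H : Type
  [normed : NormedAddCommGroup H]
  [inner : InnerProductSpace ℂ H]
  [complete : CompleteSpace H]
  [nontrivial : Nontrivial H]
  /-- The representation of `C(∂𝔻)`. -/
  rep : C(Circle, ℂ) →⋆ₐ[ℂ] (H →L[ℂ] H)
  /-- The unitary representation of `Γ`. -/
  u : Γ →* unitary (H →L[ℂ] H)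
  covariant : ∀ (γ : Γ) (f : C(Circle, ℂ)),
    (u γ : H →L[ℂ] H) * rep f * star (u γ : H →L[ℂ] H) =
      rep (f.comp (DiskAut.boundary (γ : DiskAut)⁻¹))

attribute [instance] CovariantRep.normed CovariantRep.inner CovariantRep.complete
  CovariantRep.nontrivial

/-- The C⋆-algebra `∏ ℬ(H)` of bounded families, over all covariant representations. The norm of
`∑ f_γ [γ]` in it is the maximal C⋆-norm, i.e. the supremum of its norms in all representations. -/
abbrev RepProduct (Γ : Subgroup DiskAut) : Type 1 :=
  lp (fun i : CovariantRep Γ => (i.H →L[ℂ] i.H)) ∞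

/-- The image of a continuous function in the universal covariant representation. -/
def univFun (Γ : Subgroup DiskAut) (f : C(Circle, ℂ)) : RepProduct Γ :=
  ⟨fun i => i.rep f, ⟨‖f‖, by
    rintro _ ⟨i, rfl⟩
    exact NonUnitalStarAlgHom.norm_apply_le i.rep f⟩⟩

/-- The image of a group element in the universal covariant representation. -/
def univGroup (Γ : Subgroup DiskAut) (γ : Γ) : RepProduct Γ :=
  ⟨fun i => (i.u γ : i.H →L[ℂ] i.H), ⟨1, by
    rintro _ ⟨i, rfl⟩
    exact (CStarRing.norm_coe_unitary (i.u γ)).le⟩⟩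

/-- The full crossed product `C(∂𝔻) × Γ`: the closure of the finite sums `∑ f_γ [γ]` in the maximal
C⋆-norm, realized as the C⋆-algebra generated by the universal covariant representation. -/
def crossedProduct (Γ : Subgroup DiskAut) : StarSubalgebra ℂ (RepProduct Γ) :=
  (StarAlgebra.adjoin ℂ (Set.range (univFun Γ) ∪ Set.range (univGroup Γ))).topologicalClosure

/-- The canonical copy of `C(∂𝔻)` in the crossed product. -/
def crossedProduct.ofFun (Γ : Subgroup DiskAut) (f : C(Circle, ℂ)) : crossedProduct Γ :=
  ⟨univFun Γ f, StarSubalgebra.le_topologicalClosure _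
    (StarAlgebra.subset_adjoin ℂ _ (Or.inl ⟨f, rfl⟩))⟩

/-- The canonical unitary `[γ]` in the crossed product. -/
def crossedProduct.ofGroup (Γ : Subgroup DiskAut) (γ : Γ) : crossedProduct Γ :=
  ⟨univGroup Γ γ, StarSubalgebra.le_topologicalClosure _
    (StarAlgebra.subset_adjoin ℂ _ (Or.inr ⟨γ, rfl⟩))⟩

/-- The coordinate function `z` on the circle. -/
def circleZ : C(Circle, ℂ) := ⟨fun ζ => (ζ : ℂ), continuous_subtype_val⟩

/-! ## The two Busby maps -/

/-- `τ` is the Busby map of the extension `𝒞_Γ` of `C(∂𝔻) × Γ`: the algebra `𝒞_Γ` is the inverse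
image under `π` of the range of `τ`, and `τ(z) = π(M_z)`, `τ([γ⁻¹]) = π(U_γ)` on the generators,
where `M_z` is the unilateral shift and `U_γ = (C_γ C_γ*)^{-1/2} C_γ`. -/
def IsBusbyMap (Γ : Subgroup DiskAut) (τ : crossedProduct Γ →⋆ₐ[ℂ] Calkin HardySpace) : Prop :=
  (∀ T : HardySpace →L[ℂ] HardySpace,
    T ∈ compositionAlgebra Γ ↔ calkinMk T ∈ Set.range τ) ∧
  (∃ S : HardySpace →L[ℂ] HardySpace,
    DiskSpace.IsMulZ S ∧ τ (crossedProduct.ofFun Γ circleZ) = calkinMk S) ∧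
  ∀ γ : Γ, ∃ C U : HardySpace →L[ℂ] HardySpace,
    DiskSpace.IsComposition γ C ∧ IsPolarUnitary C U ∧
      τ (crossedProduct.ofGroup Γ γ⁻¹) = calkinMk U

/-- `σ` is the `Γ`-equivariant Toeplitz extension `σ₊` on the Dirichlet space: `σ(z) = π(M_z)` and
`σ([γ⁻¹]) = π(u_γ)`, where `u_γ` is the unitary `f ↦ f ∘ γ - f(γ(0))` on the functions vanishing at
`0`, extended trivially to the constants. -/
def IsToeplitzDirichletMap (Γ : Subgroup DiskAut)
    (σ : crossedProduct Γ →⋆ₐ[ℂ] Calkin DirichletSpace) : Prop :=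
  (∃ M : DirichletSpace →L[ℂ] DirichletSpace,
    DiskSpace.IsMulZ M ∧ σ (crossedProduct.ofFun Γ circleZ) = calkinMk M) ∧
  ∀ γ : Γ, ∃ u : DirichletSpace →L[ℂ] DirichletSpace,
    DiskSpace.IsReducedComposition γ u ∧ u ∈ unitary (DirichletSpace →L[ℂ] DirichletSpace) ∧
      σ (crossedProduct.ofGroup Γ γ⁻¹) = calkinMk u

end

/-!
The operators `u_γ` and the unitary parts `U_γ` of the composition operators become equal modulo
compact operators, once the Hardy and the Dirichlet space are identified through their orthonormal
bases of monomials. Both homomorphisms are therefore one and the same, and `σ₊` is the conjugate of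
`τ` by the unitary `HardySpace.toDirichlet`.

To compare the two, let `γ(z) = (α z + β) / (conj β z + conj α)`, let `J = conj β z + conj α` be the
denominator, also as a multiplication operator, and let `E = J^{-1/2}`. On the Hardy space `C_γ = J V`
with `V` unitary (`SU11.hardyUnitary`), since `V*` permutes the reproducing kernels. The diagonal
operator `R` with entries the coefficients of `(1 - x)^{-1/2}` has the kernel `(1 - z conj w)^{-1/2}`,
and the transformation law of this kernel gives `V R V* = E R E*` (`SU11.hardyUnitary_mul_halfOp`). By
the asymptotics of these coefficients, the diagonal operator which embeds the Dirichlet space into the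
Hardy space is `R D` with `D` a compact perturbation of a nonzero scalar
(`HardySpace.exists_weightOp_eq`). The operator `u_γ`, which is unitary
(`SU11.exists_dirichletUnitary`), differs from composition with `γ` by constants. Cancelling the
injective operator `R`, one obtains for its transplant `X_γ` to the Hardy space that `E X_γ` and `E* V`
agree modulo compact operators (`DiskAut.essRep_rootInvOp_mul_transplant`), and since multiplication
operators with continuous symbols commute modulo compact operators, `C_γ = J V` becomes `|J| X_γ`. So
`X_γ` is the unitary part of `C_γ` modulo compact operators (`DiskAut.essRep_of_isPolarUnitary`). Here
`γ ↦ X_γ` reverses products, as composition operators do, which makes the pair of the Toeplitz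
operators and the `X_γ` covariant modulo compact operators
(`DiskAut.essRep_transplant_mul_circleRep`).

The crossed product has its norm from covariant representations on Hilbert spaces, while the pair above
lives in the Calkin algebra. The latter is represented faithfully on the GNS spaces of the states
`lim ⟪ξ_n, T ξ_n⟫` for weakly null sequences of unit vectors `ξ_n`
(`HilbertBasis.essRep_eq_zero_iff`); this yields the homomorphism on the crossed product
(`crossedProduct.exists_hom`). It is determined by its values on the generators
(`crossedProduct.calkin_hom_ext`).

It remains to see that `𝒞_Γ` is the inverse image of the range. Up to a positive scalar factor,
`C_γ C_γ* - |α|²` is a combination of the shift, its adjoint and the projection onto the nonconstant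
monomials, with coefficients quadratic in a point of the orbit of `0`. The orbit accumulates at
infinitely many points of the circle, where no nontrivial quadratic relation can hold
(`eq_zero_of_orbit_relation`), so that each of these three operators belongs to `𝒞_Γ`, and with them
all compact operators (`isCompactOperator_mem_compositionAlgebra`). The image of `𝒞_Γ` modulo
compact operators is then generated by the covariant pair; ranges of homomorphisms of C⋆-algebras are
closed (`StarAlgHom.isClosed_range`), so it is the whole range.
-/

set_option linter.unusedSectionVars false

noncomputable section

/-! ### Homomorphisms of C⋆-algebras -/

section CStar

variable {A B : Type*} [CStarAlgebra A] [CStarAlgebra B]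

theorem StarAlgHom.continuous_of_cstarAlgebra (φ : A →⋆ₐ[ℂ] B) : Continuous φ :=
  AddMonoidHomClass.continuous_of_bound φ 1 fun a => by
    simpa using NonUnitalStarAlgHom.norm_apply_le φ a

/-- Elements of the range of a `*`-homomorphism have preimages of no larger norm: cut a given
preimage `a` down by a function of `a⋆ a` which is `1` on `[0, r²]`. -/
theorem StarAlgHom.exists_norm_le (φ : A →⋆ₐ[ℂ] B) (a : A) {r : ℝ} (hr : 0 < r) (ha : ‖φ a‖ ≤ r) :
    ∃ a', φ a' = φ a ∧ ‖a'‖ ≤ r := by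
  let g : ℝ → ℝ := fun t => r / max r (Real.sqrt t)
  have hmax : ∀ t, 0 < max r (Real.sqrt t) := fun t => lt_max_of_lt_left hr
  have hg : Continuous g := continuous_const.div
    (continuous_const.max Real.continuous_sqrt) fun t => (hmax t).ne'
  refine ⟨a * cfc g (star a * a), ?_, ?_⟩
  · have h1 : φ (cfc g (star a * a)) = cfc g (φ (star a * a)) :=
      StarAlgHom.map_cfc φ g (star a * a) hg.continuousOn φ.continuous_of_cstarAlgebra
        (IsSelfAdjoint.star_mul_self a) ((IsSelfAdjoint.star_mul_self a).map φ)
    have h2 : cfc g (φ (star a * a)) = cfc (1 : ℝ → ℝ) (φ (star a * a)) := by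
      refine cfc_congr fun t ht => ?_
      have h3 : t ≤ r ^ 2 := by
        cases subsingleton_or_nontrivial B
        · simp [spectrum.of_subsingleton] at ht
        refine (le_abs_self t).trans ((spectrum.norm_le_norm_of_mem ht).trans ?_)
        rw [map_mul, map_star, CStarRing.norm_star_mul_self, ← pow_two]
        gcongr
      have h4 : Real.sqrt t ≤ r := by rw [← Real.sqrt_sq hr.le]; exact Real.sqrt_le_sqrt h3
      simp [g, max_eq_left h4, hr.ne']
    rw [map_mul, h1, h2, cfc_one ℝ (φ (star a * a)) ((IsSelfAdjoint.star_mul_self a).map φ),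
      mul_one]
  · have hc : IsSelfAdjoint (cfc g (star a * a)) := cfc_predicate g _
    have h1 : star (a * cfc g (star a * a)) * (a * cfc g (star a * a)) =
        cfc (fun t => g t * t * g t) (star a * a) := by
      rw [cfc_mul (fun t => g t * t) g _ (by fun_prop) (by fun_prop),
        cfc_mul g (fun t => t) _ (by fun_prop) (by fun_prop), cfc_id' ℝ (star a * a), star_mul,
        hc.star_eq]
      simp only [mul_assoc]
    have h2 : ‖star (a * cfc g (star a * a)) * (a * cfc g (star a * a))‖ ≤ r ^ 2 := by
      rw [h1]
      refine norm_cfc_le (by positivity) fun t ht => ?_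
      have ht0 : 0 ≤ t := spectrum_star_mul_self_nonneg t ht
      have h3 : t ≤ max r (Real.sqrt t) ^ 2 := by
        calc t = Real.sqrt t ^ 2 := (Real.sq_sqrt ht0).symm
          _ ≤ _ := by gcongr; exact le_max_right _ _
      have h4 : g t * t * g t = r ^ 2 * (t / max r (Real.sqrt t) ^ 2) := by
        simp only [g]; field_simp
      rw [h4, Real.norm_of_nonneg (by positivity)]
      exact mul_le_of_le_one_right (by positivity)
        ((div_le_one (by have := hmax t; positivity)).2 h3)
    rw [CStarRing.norm_star_mul_self, ← pow_two] at h2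
    exact (pow_le_pow_iff_left₀ (norm_nonneg _) hr.le two_ne_zero).1 h2

/-- The range is closed by the open mapping argument for quotient maps: by `exists_norm_le` preimages
can be chosen with control of the norm. -/
theorem StarAlgHom.isClosed_range (φ : A →⋆ₐ[ℂ] B) : IsClosed (Set.range φ) := by
  let f : NormedAddGroupHom A B := AddMonoidHom.mkNormedAddGroupHom (φ : A →+ B) 1 fun a => by
    simpa using NonUnitalStarAlgHom.norm_apply_le φ a
  have hf : f.SurjectiveOnWith f.range 1 := by
    rintro _ ⟨a, rfl⟩
    rcases eq_or_lt_of_le (norm_nonneg (f a)) with h | h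
    · exact ⟨0, by rw [map_zero]; exact (norm_eq_zero.1 h.symm).symm, by simp⟩
    · obtain ⟨a', h1, h2⟩ := φ.exists_norm_le a h le_rfl
      exact ⟨a', h1, by simpa using h2⟩
  have := controlled_closure_of_complete (f := f) one_pos one_pos hf
  refine isClosed_of_closure_subset fun b hb => ?_
  obtain ⟨a, ha, -⟩ := this b hb
  exact ⟨a, ha⟩

/-- Two positive elements of a C⋆-algebra with the same square agree. Positivity is expressed as being
of the form `x⋆ x`, which needs no order on the algebra and is preserved by homomorphisms. -/
theorem eq_of_sq_eq_sq_of_eq_star_mul_self {p x y : A} (hp : p = star x * x) {q : A}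
    (hq : q = star y * y) (h : p * p = q * q) : p = q := by
  let := CStarAlgebra.spectralOrder A
  have := CStarAlgebra.spectralOrderedRing A
  exact (CFC.mul_self_eq_mul_self_iff p q (hp ▸ star_mul_self_nonneg x)
    (hq ▸ star_mul_self_nonneg y)).1 h

end CStar

/-! ### Continuous functions on the circle -/

theorem starAdjoin_circleZ_dense :
    (StarAlgebra.adjoin ℂ {circleZ}).topologicalClosure = ⊤ := by
  apply ContinuousMap.starSubalgebra_topologicalClosure_eq_top_of_separatesPoints
  intro x y hxy
  refine ⟨circleZ, ⟨circleZ, StarAlgebra.self_mem_adjoin_singleton ℂ _, rfl⟩, fun h => hxy ?_⟩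
  exact Circle.coe_injective h

theorem starAlgHom_circle_ext {B : Type*} [CStarAlgebra B] {φ ψ : C(Circle, ℂ) →⋆ₐ[ℂ] B}
    (h : φ circleZ = ψ circleZ) : φ = ψ := by
  have hle : (StarAlgebra.adjoin ℂ {circleZ}).topologicalClosure ≤ StarAlgHom.equalizer φ ψ := by
    refine StarSubalgebra.topologicalClosure_minimal (StarAlgebra.adjoin_le ?_) ?_
    · rintro _ rfl; exact h
    · exact isClosed_eq φ.continuous_of_cstarAlgebra ψ.continuous_of_cstarAlgebra
  rw [starAdjoin_circleZ_dense] at hle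
  ext1 f
  exact hle (show f ∈ ⊤ from trivial)

/-- The continuous functional calculus of a unitary, as a homomorphism from `C(∂𝔻)`. -/
theorem exists_circleHom {B : Type*} [CStarAlgebra B] {s : B} (hs : s ∈ unitary B) :
    ∃ ρ : C(Circle, ℂ) →⋆ₐ[ℂ] B, ρ circleZ = s := by
  have : IsStarNormal s := ⟨by rw [commute_iff_eq, hs.1, hs.2]⟩
  have hspec : ∀ x : spectrum ℂ s, ‖(x : ℂ)‖ = 1 := fun x => by
    simpa using spectrum.subset_circle_of_unitary hs x.2
  let ι : C(spectrum ℂ s, Circle) :=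
    ⟨fun x => ⟨x, mem_sphere_zero_iff_norm.2 (hspec x)⟩,
      Continuous.subtype_mk continuous_subtype_val _⟩
  refine ⟨(cfcHom (R := ℂ) (p := IsStarNormal) (a := s) inferInstance).comp
    (ContinuousMap.compStarAlgHom' ℂ ℂ ι), ?_⟩
  exact cfcHom_id (R := ℂ) (p := IsStarNormal) (a := s) inferInstance

/-! ### The binomial series `(1 - x)^{-1/2}` -/

/-- The coefficients of `(1 - x)^{-1/2} = ∑ invSqrtCoeff n * x ^ n`. -/
def invSqrtCoeff (n : ℕ) : ℝ := Nat.centralBinom n / 4 ^ n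

theorem invSqrtCoeff_zero : invSqrtCoeff 0 = 1 := by simp [invSqrtCoeff]

theorem invSqrtCoeff_pos (n : ℕ) : 0 < invSqrtCoeff n :=
  div_pos (Nat.cast_pos.2 (Nat.centralBinom_pos n)) (by positivity)

theorem invSqrtCoeff_succ (n : ℕ) :
    (2 * n + 2) * invSqrtCoeff (n + 1) = (2 * n + 1) * invSqrtCoeff n := by
  have h : ((n : ℝ) + 1) * Nat.centralBinom (n + 1) = 2 * (2 * n + 1) * Nat.centralBinom n := by
    exact_mod_cast Nat.succ_mul_centralBinom_succ n
  simp only [invSqrtCoeff, pow_succ]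
  field_simp
  linear_combination 2 * h

theorem invSqrtCoeff_le_one (n : ℕ) : invSqrtCoeff n ≤ 1 := by
  induction n with
  | zero => simp [invSqrtCoeff_zero]
  | succ n ih =>
    have := invSqrtCoeff_succ n
    have := invSqrtCoeff_pos n
    nlinarith

/-- The power series `R = (1 - X)^{-1/2}` satisfies `2 (1 - X) R' = R`, so that
`((1 - X) R²)' = 0`. -/
theorem invSqrtCoeff_antidiagonal (n : ℕ) :
    ∑ kl ∈ Finset.HasAntidiagonal.antidiagonal n, invSqrtCoeff kl.1 * invSqrtCoeff kl.2 = 1 := by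
  let F : PowerSeries ℝ := PowerSeries.mk invSqrtCoeff
  have hD : 2 * ((1 - PowerSeries.X) * PowerSeries.derivative ℝ F) = F := by
    ext n
    have h2 : (2 : PowerSeries ℝ) = PowerSeries.C (2 : ℝ) :=
      (map_ofNat PowerSeries.C 2).symm
    rw [h2, PowerSeries.coeff_C_mul, sub_mul, one_mul, map_sub, PowerSeries.coeff_derivative]
    have := invSqrtCoeff_succ n
    cases n with
    | zero => simp [F] at this ⊢; linarith
    | succ n =>
      rw [PowerSeries.coeff_succ_X_mul, PowerSeries.coeff_derivative]
      simp only [F, PowerSeries.coeff_mk]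
      push_cast at this ⊢
      linarith
  have h1 : (1 - PowerSeries.X) * F ^ 2 = 1 := by
    apply PowerSeries.derivative.ext
    · simp only [Derivation.leibniz, map_sub, PowerSeries.derivative_X, pow_two, smul_eq_mul]
      simp only [Derivation.map_one_eq_zero]
      linear_combination F * hD
    · simp [F, invSqrtCoeff_zero]
  have h2 : F ^ 2 = PowerSeries.mk 1 := by
    calc F ^ 2 = (PowerSeries.mk 1 * (1 - PowerSeries.X)) * F ^ 2 := by
          rw [PowerSeries.mk_one_mul_one_sub_eq_one, one_mul]
      _ = PowerSeries.mk 1 := by rw [mul_assoc, h1, mul_one]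
  have h3 := congrArg (PowerSeries.coeff n) h2
  simpa [pow_two, PowerSeries.coeff_mul, F] using h3

section InvSqrt

variable {A : Type*} [NormedRing A] [NormedAlgebra ℂ A] [CompleteSpace A]

/-- `(1 - x)^{-1/2}`, for an element `x` of a Banach algebra of spectral radius less than `1`; the
lemmas ask for summable norms of the powers of `x`, without which the sum has no meaning. -/
def invSqrt (x : A) : A := ∑' n, (invSqrtCoeff n : ℂ) • x ^ n

theorem summable_norm_invSqrt {x : A} (hx : Summable fun n => ‖x ^ n‖) :
    Summable fun n => ‖(invSqrtCoeff n : ℂ) • x ^ n‖ := by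
  refine hx.of_nonneg_of_le (fun n => norm_nonneg _) fun n => ?_
  rw [norm_smul, Complex.norm_real, Real.norm_of_nonneg (invSqrtCoeff_pos n).le]
  exact mul_le_of_le_one_left (norm_nonneg _) (invSqrtCoeff_le_one n)

theorem hasSum_invSqrt {x : A} (hx : Summable fun n => ‖x ^ n‖) :
    HasSum (fun n => (invSqrtCoeff n : ℂ) • x ^ n) (invSqrt x) :=
  (summable_norm_invSqrt hx).of_norm.hasSum

theorem one_sub_mul_invSqrt_mul_invSqrt {x : A} (hx : Summable fun n => ‖x ^ n‖) :
    (1 - x) * (invSqrt x * invSqrt x) = 1 := by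
  have h1 : invSqrt x * invSqrt x = ∑' n, x ^ n := by
    rw [invSqrt, tsum_mul_tsum_eq_tsum_sum_antidiagonal_of_summable_norm
      (summable_norm_invSqrt hx) (summable_norm_invSqrt hx)]
    refine tsum_congr fun n => ?_
    have : ∀ kl ∈ Finset.HasAntidiagonal.antidiagonal n, ((invSqrtCoeff kl.1 : ℂ) • x ^ kl.1) *
        ((invSqrtCoeff kl.2 : ℂ) • x ^ kl.2) =
          ((invSqrtCoeff kl.1 * invSqrtCoeff kl.2 : ℝ) : ℂ) • x ^ n := by
      intro kl hkl
      rw [smul_mul_smul_comm, ← pow_add, Finset.HasAntidiagonal.mem_antidiagonal.1 hkl,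
        Complex.ofReal_mul]
    rw [Finset.sum_congr rfl this, ← Finset.sum_smul, ← Complex.ofReal_sum,
      invSqrtCoeff_antidiagonal, Complex.ofReal_one, one_smul]
  have hs := hx.of_norm
  have h2 : ∑' n, x ^ n = 1 + x * ∑' n, x ^ n := by
    conv_lhs => rw [hs.tsum_eq_zero_add]
    rw [pow_zero, ← hs.tsum_mul_left]
    simp only [pow_succ']
  rw [h1, sub_mul, one_mul]
  exact sub_eq_of_eq_add h2

theorem Commute.invSqrt_right {x y : A} (hx : Summable fun n => ‖x ^ n‖) (h : Commute y x) :
    Commute y (invSqrt x) := by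
  have hs := (summable_norm_invSqrt hx).of_norm
  rw [commute_iff_eq, invSqrt, ← hs.tsum_mul_left, ← hs.tsum_mul_right]
  exact tsum_congr fun n => ((h.pow_right n).smul_right _).eq

theorem map_invSqrt {B : Type*} [NormedRing B] [NormedAlgebra ℂ B] [CompleteSpace B] {F : Type*}
    [FunLike F A B] [AlgHomClass F ℂ A B] (φ : F) (hφ : Continuous φ) {x : A}
    (hx : Summable fun n => ‖x ^ n‖) : φ (invSqrt x) = invSqrt (φ x) := by
  have := ((hasSum_invSqrt hx).map φ hφ).tsum_eq
  rw [← this, invSqrt]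
  exact tsum_congr fun n => by rw [Function.comp_apply, map_smul, map_pow]

theorem star_invSqrt [StarRing A] [StarModule ℂ A] [ContinuousStar A] {x : A} :
    star (invSqrt x) = invSqrt (star x) := by
  rw [invSqrt, tsum_star, invSqrt]
  exact tsum_congr fun n => by simp

theorem summable_norm_pow_of_norm_lt_one {x : A} (hx : ‖x‖ < 1) :
    Summable fun n => ‖x ^ n‖ := by
  rw [← summable_nat_add_iff 1]
  refine ((summable_geometric_of_lt_one (norm_nonneg x) hx).mul_left ‖x‖).of_nonneg_of_le
    (fun n => norm_nonneg _) fun n => ?_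
  rw [← pow_succ']
  exact norm_pow_le' x (Nat.succ_pos n)

end InvSqrt

/-! ### Products of operator algebras -/

section OpProduct

variable {ι : Type*} (K : ι → Type*) [∀ i, NormedAddCommGroup (K i)]
  [∀ i, InnerProductSpace ℂ (K i)] [∀ i, CompleteSpace (K i)] [∀ i, Nontrivial (K i)]

/-- The C⋆-algebra of bounded families of operators `T i ∈ ℬ(K i)`. -/
def OpProduct : Type _ := lp (fun i => K i →L[ℂ] K i) ∞

instance : CStarAlgebra (OpProduct K) :=
  let X := lp (fun i => K i →L[ℂ] K i) ∞
  { (lp.inftyNormedRing : NormedRing X), (inferInstance : CStarRing X),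
    (inferInstance : CompleteSpace X), (lp.inftyStarRing : StarRing X),
    (lp.inftyNormedAlgebra : NormedAlgebra ℂ X), (inferInstance : StarModule ℂ X) with }

variable {K}

/-- The projection to a factor. -/
def OpProduct.proj (i : ι) : OpProduct K →⋆ₐ[ℂ] (K i →L[ℂ] K i) where
  toFun a := a.1 i
  map_one' := rfl
  map_mul' _ _ := rfl
  map_zero' := rfl
  map_add' _ _ := rfl
  commutes' _ := rfl
  map_star' _ := rfl

theorem OpProduct.ext {a b : OpProduct K} (h : ∀ i, OpProduct.proj i a = OpProduct.proj i b) :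
    a = b := Subtype.ext (funext h)

/-- The homomorphism into the product with given components. -/
def OpProduct.ofFamily {B : Type*} [CStarAlgebra B] (φ : ∀ i, B →⋆ₐ[ℂ] (K i →L[ℂ] K i)) :
    B →⋆ₐ[ℂ] OpProduct K where
  toFun b := ⟨fun i => φ i b, ⟨‖b‖, by
    rintro _ ⟨i, rfl⟩
    exact NonUnitalStarAlgHom.norm_apply_le (φ i) b⟩⟩
  map_one' := OpProduct.ext fun i => map_one (φ i)
  map_mul' a b := OpProduct.ext fun i => map_mul (φ i) a b
  map_zero' := OpProduct.ext fun i => map_zero (φ i)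
  map_add' a b := OpProduct.ext fun i => map_add (φ i) a b
  commutes' r := OpProduct.ext fun i => by
    refine (AlgHomClass.commutes (φ i) r).trans ?_
    exact (AlgHomClass.commutes (OpProduct.proj i) r).symm
  map_star' a := OpProduct.ext fun i => map_star (φ i) a

end OpProduct

/-! ### Compact operators and weakly null sequences -/

section WeaklyNull

open InnerProductSpace

variable (H : Type*) [NormedAddCommGroup H] [InnerProductSpace ℂ H] [CompleteSpace H]

/-- A sequence of unit vectors of a Hilbert space which converges weakly to `0`. -/
structure WeaklyNullSeq where
  /-- The vectors. -/
  seq : ℕ → H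
  norm_eq : ∀ n, ‖seq n‖ = 1
  tendsto_inner : ∀ x, Tendsto (fun n => inner ℂ x (seq n)) atTop (𝓝 0)

variable {H}

/-- The image of a weakly null sequence under a compact operator tends to `0`, here along any
ultrafilter at infinity: a limit point in the compact closure of the image of the ball is orthogonal
to everything. -/
theorem WeaklyNullSeq.tendsto_of_isCompactOperator (ξ : WeaklyNullSeq H) {T : H →L[ℂ] H}
    (hT : IsCompactOperator T) (l : Ultrafilter ℕ) (hl : (l : Filter ℕ) ≤ atTop) :
    Tendsto (fun n => T (ξ.seq n)) l (𝓝 0) := by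
  have hK : IsCompact (closure (T '' Metric.closedBall 0 1)) :=
    IsCompactOperator.isCompact_closure_image_closedBall (f := T.toLinearMap) hT 1
  obtain ⟨y, -, hy⟩ := hK.ultrafilter_le_nhds (l.map fun n => T (ξ.seq n)) (by
    refine le_principal_iff.2 (mem_map.2 (Eventually.of_forall fun n => ?_))
    exact subset_closure ⟨ξ.seq n, by simp [ξ.norm_eq n], rfl⟩)
  have hy' : Tendsto (fun n => T (ξ.seq n)) l (𝓝 y) := hy
  have h0 : inner ℂ y y = 0 := by
    have h1 : Tendsto (fun n => inner ℂ y (T (ξ.seq n))) l (𝓝 (inner ℂ y y)) :=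
      tendsto_const_nhds.inner hy'
    have h2 : Tendsto (fun n => inner ℂ y (T (ξ.seq n))) l (𝓝 0) := by
      refine ((ξ.tendsto_inner (T.adjoint y)).mono_left hl).congr fun n => ?_
      rw [ContinuousLinearMap.adjoint_inner_left]
    exact tendsto_nhds_unique h1 h2
  rwa [inner_self_eq_zero.1 h0] at hy'

/-- The orthogonal projection onto the span of the first `n` vectors of a Hilbert basis. -/
def HilbertBasis.truncation (b : HilbertBasis ℕ ℂ H) (n : ℕ) : H →L[ℂ] H :=
  ∑ k ∈ Finset.range n, rankOne ℂ (b k) (b k)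

theorem isCompactOperator_rankOne (x y : H) : IsCompactOperator (rankOne ℂ x y : H →L[ℂ] H) := by
  rw [rankOne_def']
  exact IsCompactOperator.clm_comp
    (isCompactOperator_of_locallyCompactSpace_dom (innerSL ℂ y))
    (ContinuousLinearMap.toSpanSingleton ℂ x)

theorem HilbertBasis.isCompactOperator_truncation (b : HilbertBasis ℕ ℂ H) (n : ℕ) :
    IsCompactOperator (b.truncation n) :=
  (compactIdeal H).sum_mem fun k _ => isCompactOperator_rankOne (b k) (b k)

theorem HilbertBasis.truncation_apply (b : HilbertBasis ℕ ℂ H) (n : ℕ) (x : H) :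
    b.truncation n x = ∑ k ∈ Finset.range n, (inner ℂ (b k) x) • b k := by
  simp [truncation]

theorem HilbertBasis.tendsto_truncation (b : HilbertBasis ℕ ℂ H) (x : H) :
    Tendsto (fun n => b.truncation n x) atTop (𝓝 x) := by
  have := (b.hasSum_repr x).tendsto_sum_nat
  simpa only [b.truncation_apply, b.repr_apply_apply] using this

theorem HilbertBasis.inner_truncation_comm (b : HilbertBasis ℕ ℂ H) (n : ℕ) (x y : H) :
    inner ℂ (b.truncation n x) y = inner ℂ x (b.truncation n y) := by
  simp only [b.truncation_apply, sum_inner, inner_sum, inner_smul_left, inner_smul_right,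
    inner_conj_symm]
  exact Finset.sum_congr rfl fun k _ => mul_comm _ _

theorem HilbertBasis.norm_sub_truncation_le (b : HilbertBasis ℕ ℂ H) (n : ℕ) (x : H) :
    ‖x - b.truncation n x‖ ≤ ‖x‖ := by
  have h1 : inner ℂ (b.truncation n x) (x - b.truncation n x) = 0 := by
    rw [inner_sub_right, sub_eq_zero, b.truncation_apply, sum_inner, sum_inner]
    refine Finset.sum_congr rfl fun k hk => ?_
    rw [inner_smul_left, inner_smul_left, inner_sum]
    simp only [inner_smul_right, orthonormal_iff_ite.1 b.orthonormal]
    simp [Finset.mem_range.1 hk]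
  have h2 := norm_add_sq_eq_norm_sq_add_norm_sq_of_inner_eq_zero _ _ h1
  rw [add_sub_cancel] at h2
  exact abs_le_of_sq_le_sq' (by nlinarith [mul_self_nonneg ‖b.truncation n x‖]) (norm_nonneg _) |>.2

/-- If the tails `T (1 - P_n)` do not tend to `0`, then `T` is bounded below on some weakly null
sequence of unit vectors. -/
theorem HilbertBasis.exists_weaklyNullSeq (b : HilbertBasis ℕ ℂ H) {T : H →L[ℂ] H}
    (hT : ¬ Tendsto (fun n => T * (1 - b.truncation n)) atTop (𝓝 0)) :
    ∃ (ξ : WeaklyNullSeq H) (δ : ℝ), 0 < δ ∧ ∀ n, δ ≤ ‖T (ξ.seq n)‖ := by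
  rw [NormedAddGroup.tendsto_nhds_zero] at hT
  push Not at hT
  obtain ⟨δ, hδ, hf⟩ := hT
  have hex : ∀ n, ∃ y : H, ‖y‖ = 1 ∧ (∀ x, ‖inner ℂ x y‖ ≤ ‖x - b.truncation n x‖) ∧
      (δ ≤ ‖T * (1 - b.truncation n)‖ → δ / 2 ≤ ‖T y‖) := by
    intro n
    have hidem : ∀ x, b.truncation n (x - b.truncation n x) = 0 := by
      intro x
      rw [b.truncation_apply]
      refine Finset.sum_eq_zero fun k hk => ?_
      rw [inner_sub_right, b.truncation_apply, inner_sum]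
      simp only [inner_smul_right, orthonormal_iff_ite.1 b.orthonormal]
      simp [Finset.mem_range.1 hk]
    have hin : ∀ y, b.truncation n y = 0 → ‖y‖ = 1 →
        ∀ x, ‖inner ℂ x y‖ ≤ ‖x - b.truncation n x‖ := by
      intro y hy hy1 x
      have : inner ℂ x y = inner ℂ (x - b.truncation n x) y := by
        rw [inner_sub_left, b.inner_truncation_comm, hy, inner_zero_right, sub_zero]
      rw [this]
      refine (norm_inner_le_norm _ _).trans_eq ?_
      rw [hy1, mul_one]
    by_cases hn : δ ≤ ‖T * (1 - b.truncation n)‖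
    · obtain ⟨x, hx⟩ : ∃ x, δ / 2 * ‖x‖ < ‖(T * (1 - b.truncation n)) x‖ := by
        by_contra! hcon
        have := ContinuousLinearMap.opNorm_le_bound _ (by positivity) hcon
        linarith
      set y := x - b.truncation n x with hy
      have hTy : (T * (1 - b.truncation n)) x = T y := by simp [hy]
      rw [hTy] at hx
      have hy0 : y ≠ 0 := by
        rintro h0
        rw [h0, map_zero, norm_zero] at hx
        exact absurd hx (not_lt.2 (by positivity))
      have hyn : 0 < ‖y‖ := norm_pos_iff.2 hy0
      have h1 : ‖((‖y‖⁻¹ : ℝ) : ℂ) • y‖ = 1 := by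
        rw [norm_smul]; simp [hyn.ne']
      refine ⟨((‖y‖⁻¹ : ℝ) : ℂ) • y, h1, hin _ ?_ h1, fun _ => ?_⟩
      · rw [map_smul, hidem, smul_zero]
      · rw [map_smul, norm_smul, Complex.norm_real, norm_inv, norm_norm]
        rw [← div_eq_inv_mul, le_div_iff₀ hyn]
        have : ‖y‖ ≤ ‖x‖ := b.norm_sub_truncation_le n x
        nlinarith
    · have h1 : ‖b n‖ = 1 := b.orthonormal.1 n
      refine ⟨b n, h1, hin _ ?_ h1, fun h => absurd h hn⟩
      rw [b.truncation_apply]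
      refine Finset.sum_eq_zero fun k hk => ?_
      rw [b.orthonormal.2 (Finset.mem_range.1 hk).ne, zero_smul]
  choose y hy1 hy2 hy3 using hex
  obtain ⟨φ, hφ, hφ'⟩ := extraction_of_frequently_atTop hf
  refine ⟨⟨y ∘ φ, fun n => hy1 _, fun x => ?_⟩, δ / 2, by positivity, fun n => hy3 _ (hφ' n)⟩
  have h1 : Tendsto (fun n => x - b.truncation n x) atTop (𝓝 0) := by
    simpa using (tendsto_const_nhds (x := x)).sub (b.tendsto_truncation x)
  have h2 : Tendsto (fun n => inner ℂ x (y n)) atTop (𝓝 0) :=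
    squeeze_zero_norm (hy2 · x) (by simpa using h1.norm)
  exact h2.comp hφ.tendsto_atTop

theorem WeaklyNullSeq.not_isCompactOperator (ξ : WeaklyNullSeq H) {T : H →L[ℂ] H} {δ : ℝ}
    (hδ : 0 < δ) (h : ∀ n, δ ≤ ‖T (ξ.seq n)‖) : ¬ IsCompactOperator T := by
  intro hT
  have h1 := (ξ.tendsto_of_isCompactOperator hT (hyperfilter ℕ) Nat.hyperfilter_le_atTop).norm
  have h2 := ge_of_tendsto' h1 h
  rw [norm_zero] at h2
  exact absurd h2 (not_le.2 hδ)

theorem HilbertBasis.tendsto_mul_one_sub_truncation (b : HilbertBasis ℕ ℂ H) {T : H →L[ℂ] H}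
    (hT : IsCompactOperator T) : Tendsto (fun n => T * (1 - b.truncation n)) atTop (𝓝 0) := by
  by_contra hcon
  obtain ⟨ξ, δ, hδ, hf⟩ := b.exists_weaklyNullSeq hcon
  exact ξ.not_isCompactOperator hδ hf hT

theorem isCompactOperator_of_tendsto_mul (T : H →L[ℂ] H) {P : ℕ → H →L[ℂ] H}
    (hP : ∀ n, IsCompactOperator (P n)) (h : Tendsto (fun n => T * (1 - P n)) atTop (𝓝 0)) :
    IsCompactOperator T := by
  have h1 : Tendsto (fun n => T * P n) atTop (𝓝 T) := by
    have := (tendsto_const_nhds (x := T)).sub h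
    simpa [mul_sub] using this
  exact isClosed_setOfPred_isCompactOperator.mem_of_tendsto h1
    (Eventually.of_forall fun n => (compactIdeal H).mul_mem_left T (hP n))

/-! ### A representation of the Calkin algebra -/

/-- The numbers `⟪ξ_n, T ξ_n⟫` are bounded, so they converge along an ultrafilter. -/
theorem WeaklyNullSeq.exists_state (ξ : WeaklyNullSeq H) (T : H →L[ℂ] H) :
    ∃ c : ℂ, Tendsto (fun n => inner ℂ (ξ.seq n) (T (ξ.seq n))) (hyperfilter ℕ) (𝓝 c) := by
  obtain ⟨c, -, hc⟩ := (isCompact_closedBall (0 : ℂ) ‖T‖).ultrafilter_le_nhds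
    ((hyperfilter ℕ).map fun n => inner ℂ (ξ.seq n) (T (ξ.seq n))) (by
      refine le_principal_iff.2 (mem_map.2 (Eventually.of_forall fun n => ?_))
      refine mem_closedBall_zero_iff.2 ((norm_inner_le_norm _ _).trans ?_)
      rw [ξ.norm_eq, one_mul]
      exact (T.le_opNorm _).trans_eq (by rw [ξ.norm_eq, mul_one]))
  exact ⟨c, hc⟩

open scoped ComplexOrder in
/-- The state `T ↦ lim ⟪ξ_n, T ξ_n⟫` of `ℬ(H)`, where the limit is along a nonprincipal
ultrafilter. -/
def WeaklyNullSeq.state (ξ : WeaklyNullSeq H) : (H →L[ℂ] H) →ₚ[ℂ] ℂ :=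
  PositiveLinearMap.mk₀
    { toFun := fun T => (ξ.exists_state T).choose
      map_add' := fun S T => by
        refine tendsto_nhds_unique (ξ.exists_state (S + T)).choose_spec ?_
        simpa [inner_add_right] using
          (ξ.exists_state S).choose_spec.add (ξ.exists_state T).choose_spec
      map_smul' := fun c T => by
        refine tendsto_nhds_unique (ξ.exists_state (c • T)).choose_spec ?_
        simpa [inner_smul_right] using (ξ.exists_state T).choose_spec.const_mul c }
    (fun T hT => by
      refine ge_of_tendsto' (ξ.exists_state T).choose_spec fun n => ?_
      exact ((ContinuousLinearMap.nonneg_iff_isPositive T).1 hT).inner_nonneg_right _)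

theorem WeaklyNullSeq.tendsto_state (ξ : WeaklyNullSeq H) (T : H →L[ℂ] H) :
    Tendsto (fun n => inner ℂ (ξ.seq n) (T (ξ.seq n))) (hyperfilter ℕ) (𝓝 (ξ.state T)) :=
  (ξ.exists_state T).choose_spec

theorem WeaklyNullSeq.state_one (ξ : WeaklyNullSeq H) : ξ.state 1 = 1 := by
  refine tendsto_nhds_unique (ξ.tendsto_state 1) ?_
  simp [inner_self_eq_norm_sq_to_K, ξ.norm_eq]

theorem WeaklyNullSeq.state_eq_zero (ξ : WeaklyNullSeq H) {T : H →L[ℂ] H}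
    (hT : IsCompactOperator T) : ξ.state T = 0 := by
  refine tendsto_nhds_unique (ξ.tendsto_state T) ?_
  refine squeeze_zero_norm (fun n => ?_)
    (by simpa using (ξ.tendsto_of_isCompactOperator hT _ Nat.hyperfilter_le_atTop).norm)
  simpa [ξ.norm_eq] using norm_inner_le_norm (𝕜 := ℂ) (ξ.seq n) (T (ξ.seq n))

instance (ξ : WeaklyNullSeq H) : Nontrivial ξ.state.GNS := by
  refine ⟨⟨((ξ.state.toPreGNS 1 : ξ.state.PreGNS) : ξ.state.GNS), 0, fun h => ?_⟩⟩
  have h1 : ‖((ξ.state.toPreGNS 1 : ξ.state.PreGNS) : ξ.state.GNS)‖ = 1 := by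
    rw [UniformSpace.Completion.norm_coe, ξ.state.preGNS_norm_def]
    simp [ξ.state_one]
  rw [h, norm_zero] at h1
  exact zero_ne_one h1

/-- The state vanishes on the ideal of compact operators, hence so does its GNS representation. -/
theorem WeaklyNullSeq.gns_eq_zero (ξ : WeaklyNullSeq H) {T : H →L[ℂ] H}
    (hT : IsCompactOperator T) : ξ.state.gnsStarAlgHom T = 0 := by
  ext x
  induction x using UniformSpace.Completion.induction_on with
  | hp => exact isClosed_eq (ContinuousLinearMap.continuous _) continuous_const
  | ih x =>
    have h1 : IsCompactOperator (star (T * ξ.state.ofPreGNS x) * (T * ξ.state.ofPreGNS x) :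
        H →L[ℂ] H) :=
      (compactIdeal H).mul_mem_left _ (hT.comp_clm (ξ.state.ofPreGNS x))
    have h2 : ‖ξ.state.leftMulMapPreGNS T x‖ = 0 := by
      rw [ξ.state.preGNS_norm_def]
      simp only [PositiveLinearMap.leftMulMapPreGNS_apply, PositiveLinearMap.ofPreGNS_toPreGNS]
      erw [ξ.state_eq_zero h1]
      simp
    change ξ.state.gnsNonUnitalStarAlgHom T x = 0
    rw [PositiveLinearMap.gnsNonUnitalStarAlgHom_apply_coe, ← norm_eq_zero,
      UniformSpace.Completion.norm_coe, h2]

/-- The cyclic vector of the GNS representation is not annihilated by `T`, since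
`lim ⟪ξ_n, T* T ξ_n⟫ ≥ δ²`. -/
theorem WeaklyNullSeq.gns_ne_zero (ξ : WeaklyNullSeq H) {T : H →L[ℂ] H} {δ : ℝ}
    (hδ : 0 < δ) (h : ∀ n, δ ≤ ‖T (ξ.seq n)‖) : ξ.state.gnsStarAlgHom T ≠ 0 := by
  intro h0
  have h1 : ξ.state.gnsNonUnitalStarAlgHom T ((ξ.state.toPreGNS 1 : ξ.state.PreGNS)) = 0 := by
    change ξ.state.gnsStarAlgHom T _ = 0
    rw [h0]; rfl
  rw [PositiveLinearMap.gnsNonUnitalStarAlgHom_apply_coe, ← norm_eq_zero,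
    UniformSpace.Completion.norm_coe] at h1
  have h2 := ξ.state.preGNS_norm_sq (ξ.state.leftMulMapPreGNS T (ξ.state.toPreGNS 1))
  rw [h1] at h2
  simp only [PositiveLinearMap.leftMulMapPreGNS_apply, PositiveLinearMap.ofPreGNS_toPreGNS,
    mul_one] at h2
  have h3 := (ξ.tendsto_state (star T * T)).norm
  rw [← h2] at h3
  have h4 : ∀ n, δ ^ 2 ≤ ‖inner ℂ (ξ.seq n) ((star T * T) (ξ.seq n))‖ := fun n => by
    have : inner ℂ (ξ.seq n) ((star T * T) (ξ.seq n)) = inner ℂ (T (ξ.seq n)) (T (ξ.seq n)) :=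
      ContinuousLinearMap.adjoint_inner_right T _ _
    rw [this, inner_self_eq_norm_sq_to_K]
    simpa using pow_le_pow_left₀ hδ.le (h n) 2
  have h5 := ge_of_tendsto' h3 h4
  simp at h5
  nlinarith

variable (H) in
/-- The product of the algebras of bounded operators on the GNS spaces of the states defined by the
weakly null sequences: the target of a faithful representation of the Calkin algebra. -/
abbrev CalkinRep : Type _ := OpProduct fun ξ : WeaklyNullSeq H => ξ.state.GNS

variable (H) in
/-- The representation of `ℬ(H)` on the GNS spaces of the states which weakly null sequences
define. Its kernel is the ideal of compact operators. -/
def essRep : (H →L[ℂ] H) →⋆ₐ[ℂ] CalkinRep H :=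
  OpProduct.ofFamily fun ξ => ξ.state.gnsStarAlgHom

theorem essRep_eq_zero {T : H →L[ℂ] H} (hT : IsCompactOperator T) : essRep H T = 0 :=
  OpProduct.ext fun ξ => ξ.gns_eq_zero hT

/-- The representation `essRep` is faithful modulo compact operators: a noncompact operator is bounded
below on a weakly null sequence, whose GNS representation detects it. -/
theorem HilbertBasis.essRep_eq_zero_iff (b : HilbertBasis ℕ ℂ H) {T : H →L[ℂ] H} :
    essRep H T = 0 ↔ IsCompactOperator T := by
  refine ⟨fun h => ?_, essRep_eq_zero⟩
  refine isCompactOperator_of_tendsto_mul T b.isCompactOperator_truncation ?_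
  by_contra hcon
  obtain ⟨ξ, δ, hδ, hf⟩ := b.exists_weaklyNullSeq hcon
  exact ξ.gns_ne_zero hδ hf (congrArg (OpProduct.proj ξ) h)

theorem calkinMk_eq_iff {S T : H →L[ℂ] H} : calkinMk S = calkinMk T ↔ IsCompactOperator (S - T) :=
  Ideal.Quotient.eq (I := compactIdeal H)

theorem calkinMk_surjective : Function.Surjective (calkinMk (H := H)) :=
  Ideal.Quotient.mk_surjective

/-- A homomorphism on `ℬ(H)` which vanishes on the compact operators descends to the Calkin
algebra. -/
def Calkin.lift {B : Type*} [Ring B] [Algebra ℂ B] [StarRing B] (φ : (H →L[ℂ] H) →⋆ₐ[ℂ] B)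
    (hφ : ∀ T : H →L[ℂ] H, IsCompactOperator T → φ T = 0) : Calkin H →⋆ₐ[ℂ] B :=
  { Ideal.Quotient.liftₐ (compactIdeal H) (φ : (H →L[ℂ] H) →ₐ[ℂ] B) hφ with
    map_star' := by
      intro x
      obtain ⟨T, rfl⟩ := calkinMk_surjective x
      exact map_star φ T }

variable (H) in
/-- The representation of the Calkin algebra induced by `essRep`. -/
def calkinRep : Calkin H →⋆ₐ[ℂ] CalkinRep H := Calkin.lift (essRep H) fun _ => essRep_eq_zero

theorem calkinRep_mk (T : H →L[ℂ] H) : calkinRep H (calkinMk T) = essRep H T := rfl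

theorem HilbertBasis.calkinRep_injective (b : HilbertBasis ℕ ℂ H) :
    Function.Injective (calkinRep H) := by
  refine (injective_iff_map_eq_zero _).2 fun x hx => ?_
  obtain ⟨T, rfl⟩ := calkinMk_surjective x
  rw [← map_zero (calkinMk (H := H)), calkinMk_eq_iff, sub_zero]
  exact b.essRep_eq_zero_iff.1 hx

theorem HilbertBasis.essRep_eq_iff (b : HilbertBasis ℕ ℂ H) {S T : H →L[ℂ] H} :
    essRep H S = essRep H T ↔ calkinMk S = calkinMk T := by
  rw [← calkinRep_mk, ← calkinRep_mk, b.calkinRep_injective.eq_iff]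

end WeaklyNull

/-! ### Weighted spaces of power series -/

namespace DiskSpace

variable {w : ℕ → ℕ+}

theorem ext {f g : DiskSpace w} (h : ∀ n, f.coeff n = g.coeff n) : f = g :=
  Subtype.ext (funext h)

@[simp] theorem coeff_add (f g : DiskSpace w) (n : ℕ) : (f + g).coeff n = f.coeff n + g.coeff n :=
  rfl

@[simp] theorem coeff_sub (f g : DiskSpace w) (n : ℕ) : (f - g).coeff n = f.coeff n - g.coeff n :=
  rfl

@[simp] theorem coeff_smul (c : ℂ) (f : DiskSpace w) (n : ℕ) : (c • f).coeff n = c * f.coeff n :=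
  rfl

@[simp] theorem coeff_zero (n : ℕ) : (0 : DiskSpace w).coeff n = 0 := rfl

/-- The element of the space with given Taylor coefficients. -/
def mk (w : ℕ → ℕ+) (a : ℕ → ℂ) (ha : Summable fun n => ((w n : ℕ) : ℝ) * ‖a n‖ ^ 2) :
    DiskSpace w := ⟨a, mem_weightedSeq_iff.2 ha⟩

@[simp] theorem coeff_mk (w : ℕ → ℕ+) (a : ℕ → ℂ)
    (ha : Summable fun n => ((w n : ℕ) : ℝ) * ‖a n‖ ^ 2) (n : ℕ) : (mk w a ha).coeff n = a n := rfl

theorem summable_coeff (f : DiskSpace w) :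
    Summable fun n => ((w n : ℕ) : ℝ) * ‖f.coeff n‖ ^ 2 := mem_weightedSeq_iff.1 f.2

theorem one_le_weight (n : ℕ) : (1 : ℝ) ≤ ((w n : ℕ) : ℝ) := by exact_mod_cast (w n).2

theorem norm_coeff_le (f : DiskSpace w) (n : ℕ) : ‖f.coeff n‖ ≤ ‖f‖ := by
  refine (pow_le_pow_iff_left₀ (norm_nonneg _) (norm_nonneg _) two_ne_zero).1 ?_
  rw [norm_sq_eq_tsum]
  refine le_trans ?_ (f.summable_coeff.le_tsum n fun _ _ => by positivity)
  exact le_mul_of_one_le_left (by positivity) (one_le_weight n)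

theorem hasSum_inner (f g : DiskSpace w) :
    HasSum (fun n => ((w n : ℕ) : ℂ) * (conj (f.coeff n) * g.coeff n)) (inner ℂ f g) := by
  have h := lp.hasSum_inner (𝕜 := ℂ) (toL2 w f) (toL2 w g)
  refine (congrArg (HasSum · (inner ℂ f g)) (funext fun n => ?_)).mp h
  change inner ℂ ((Real.sqrt (w n : ℕ) : ℂ) * f.coeff n) ((Real.sqrt (w n : ℕ) : ℂ) * g.coeff n) = _
  rw [RCLike.inner_apply, map_mul, Complex.conj_ofReal]
  have : (Real.sqrt (w n : ℕ) : ℂ) * (Real.sqrt (w n : ℕ) : ℂ) = ((w n : ℕ) : ℂ) := by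
    rw [← Complex.ofReal_mul, Real.mul_self_sqrt (Nat.cast_nonneg _)]; simp
  rw [← this]; ring

/-- The orthonormal basis of normalized monomials. -/
def basis (w : ℕ → ℕ+) : HilbertBasis ℕ ℂ (DiskSpace w) := HilbertBasis.ofRepr (toL2Isometry w)

theorem inner_basis (n : ℕ) (f : DiskSpace w) :
    inner ℂ (basis w n) f = (Real.sqrt (w n : ℕ) : ℂ) * f.coeff n := by
  rw [← HilbertBasis.repr_apply_apply]; rfl

theorem summable_norm_eval (f : DiskSpace w) {z : ℂ} (hz : ‖z‖ < 1) :
    Summable fun n => ‖f.coeff n * z ^ n‖ := by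
  refine ((summable_geometric_of_lt_one (norm_nonneg z) hz).mul_left ‖f‖).of_nonneg_of_le
    (fun n => norm_nonneg _) fun n => ?_
  rw [norm_mul, norm_pow]
  gcongr
  exact f.norm_coeff_le n

theorem hasSum_eval (f : DiskSpace w) {z : ℂ} (hz : ‖z‖ < 1) :
    HasSum (fun n => f.coeff n * z ^ n) (f.eval z) := (f.summable_norm_eval hz).of_norm.hasSum

theorem eval_add (f g : DiskSpace w) {z : ℂ} (hz : ‖z‖ < 1) :
    (f + g).eval z = f.eval z + g.eval z := by
  refine (hasSum_eval _ hz).unique ?_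
  simpa [add_mul] using (hasSum_eval f hz).add (hasSum_eval g hz)

theorem eval_smul (c : ℂ) (f : DiskSpace w) (z : ℂ) : (c • f).eval z = c * f.eval z := by
  simp only [eval, coeff_smul, mul_assoc, tsum_mul_left]

theorem eval_zero_right (f : DiskSpace w) : f.eval 0 = f.coeff 0 := by
  rw [eval, tsum_eq_single 0 fun n hn => by simp [hn]]; simp

/-- The coefficients are determined by the values on the disk, also across different weights. -/
theorem coeff_eq_of_eval_eq {w₁ w₂ : ℕ → ℕ+} {f : DiskSpace w₁} {g : DiskSpace w₂}
    (h : ∀ z : ℂ, ‖z‖ < 1 → f.eval z = g.eval z) (n : ℕ) : f.coeff n = g.coeff n := by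
  have hball : ∀ᶠ z in 𝓝 (0 : ℂ), ‖z‖ < 1 := by
    filter_upwards [Metric.ball_mem_nhds (0 : ℂ) one_pos] with z hz using by simpa using hz
  have key : HasFPowerSeriesAt (0 : ℂ → ℂ)
      (FormalMultilinearSeries.ofScalars ℂ fun n => f.coeff n - g.coeff n) 0 := by
    rw [hasFPowerSeriesAt_iff]
    filter_upwards [hball] with z hz
    have := (hasSum_eval f hz).sub (hasSum_eval g hz)
    rw [h z hz, sub_self] at this
    simpa [FormalMultilinearSeries.coeff_ofScalars, mul_comm, sub_mul, mul_sub] using this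
  have h0 := congrArg (fun p => FormalMultilinearSeries.coeff p n) key.eq_zero
  simp only [FormalMultilinearSeries.coeff_ofScalars] at h0
  rw [← sub_eq_zero, h0]
  rfl

theorem eval_injective {f g : DiskSpace w} (h : ∀ z : ℂ, ‖z‖ < 1 → f.eval z = g.eval z) : f = g :=
  ext (coeff_eq_of_eval_eq h)

theorem hasDerivAt_eval (f : DiskSpace w) {z : ℂ} (hz : ‖z‖ < 1) :
    HasDerivAt f.eval (∑' n : ℕ, f.coeff n * (n * z ^ (n - 1))) z := by
  obtain ⟨r, hzr, hr⟩ := exists_between hz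
  have hr0 : 0 ≤ r := (norm_nonneg z).trans hzr.le
  have hu : Summable fun n : ℕ => ‖f‖ * (n * r ^ (n - 1)) := by
    refine Summable.mul_left _ ?_
    rw [← summable_nat_add_iff 1]
    have h1 : Summable fun n : ℕ => (n : ℝ) ^ 1 * r ^ n :=
      summable_pow_mul_geometric_of_norm_lt_one 1 (by rwa [Real.norm_of_nonneg hr0])
    have h2 : Summable fun n : ℕ => r ^ n := summable_geometric_of_lt_one hr0 hr
    refine (h1.add h2).congr fun n => ?_
    simp; ring
  refine hasDerivAt_tsum_of_isPreconnected (t := Metric.ball (0 : ℂ) r) (y₀ := z) hu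
    Metric.isOpen_ball (convex_ball _ _).isPreconnected
    (fun n y _ => (hasDerivAt_pow n y).const_mul (f.coeff n)) (fun n y hy => ?_)
    (by simpa using hzr) (f.hasSum_eval hz).summable (by simpa using hzr)
  have hy' : ‖y‖ ≤ r := by simpa using (Metric.mem_ball.1 hy).le
  rw [norm_mul, norm_mul, norm_pow, Complex.norm_natCast]
  gcongr
  exact f.norm_coeff_le n

theorem clm_ext {H : Type*} [NormedAddCommGroup H] [NormedSpace ℂ H] {A B : H →L[ℂ] DiskSpace w}
    (h : ∀ f n, (A f).coeff n = (B f).coeff n) : A = B :=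
  ContinuousLinearMap.ext fun f => ext (h f)

end DiskSpace

/-! ### Diagonal operators and the shift on the Hardy space -/

namespace HardySpace

open DiskSpace InnerProductSpace

theorem norm_sq (f : HardySpace) : ‖f‖ ^ 2 = ∑' n, ‖f.coeff n‖ ^ 2 := by
  rw [norm_sq_eq_tsum]; simp

theorem summable_sq (f : HardySpace) : Summable fun n => ‖f.coeff n‖ ^ 2 := by
  simpa using f.summable_coeff

theorem inner_basis_eq (n : ℕ) (f : HardySpace) :
    inner ℂ (basis (fun _ => 1) n) f = f.coeff n := by
  rw [inner_basis]; simp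

theorem coeff_basis (n k : ℕ) :
    (basis (fun _ => 1) n : HardySpace).coeff k = if n = k then 1 else 0 := by
  rw [← inner_basis_eq, orthonormal_iff_ite.1 (basis fun _ => 1).orthonormal]
  exact if_congr eq_comm rfl rfl

/-- The diagonal operator `∑ a_n z^n ↦ ∑ d_n a_n z^n` with bounded entries. -/
def diagonal (d : ℕ → ℝ) (hd : ∃ C, ∀ n, |d n| ≤ C) : HardySpace →L[ℂ] HardySpace :=
  LinearMap.mkContinuousOfExistsBound
    { toFun := fun f => DiskSpace.mk _ (fun n => (d n : ℂ) * f.coeff n) (by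
        obtain ⟨C, hC⟩ := hd
        refine (f.summable_sq.mul_left (C ^ 2)).of_nonneg_of_le (fun n => by positivity) fun n => ?_
        rw [norm_mul, mul_pow, Complex.norm_real, Real.norm_eq_abs]
        simp only [PNat.one_coe, Nat.cast_one, one_mul]
        gcongr
        exact hC n)
      map_add' := fun f g => DiskSpace.ext fun n => by simp [mul_add]
      map_smul' := fun c f => DiskSpace.ext fun n => by simp [mul_left_comm] }
    (by
      obtain ⟨C, hC⟩ := hd
      have hC0 : 0 ≤ C := (abs_nonneg _).trans (hC 0)
      refine ⟨C, fun f => ?_⟩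
      refine (pow_le_pow_iff_left₀ (norm_nonneg _) (by positivity) two_ne_zero).1 ?_
      rw [mul_pow, norm_sq, norm_sq, ← tsum_mul_left]
      refine Summable.tsum_le_tsum (fun n => ?_) (summable_sq _) (f.summable_sq.mul_left _)
      simp only [LinearMap.coe_mk, AddHom.coe_mk, coeff_mk]
      rw [norm_mul, mul_pow, Complex.norm_real, Real.norm_eq_abs]
      gcongr
      exact hC n)

@[simp] theorem coeff_diagonal (d : ℕ → ℝ) (hd : ∃ C, ∀ n, |d n| ≤ C) (f : HardySpace) (n : ℕ) :
    (diagonal d hd f).coeff n = d n * f.coeff n := rfl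

theorem norm_diagonal_le {d : ℕ → ℝ} (hd : ∃ C, ∀ n, |d n| ≤ C) {C : ℝ} (hC : ∀ n, |d n| ≤ C) :
    ‖diagonal d hd‖ ≤ C := by
  have hC0 : 0 ≤ C := (abs_nonneg _).trans (hC 0)
  refine ContinuousLinearMap.opNorm_le_bound _ hC0 fun f => ?_
  refine (pow_le_pow_iff_left₀ (norm_nonneg _) (by positivity) two_ne_zero).1 ?_
  rw [mul_pow, norm_sq, norm_sq, ← tsum_mul_left]
  refine Summable.tsum_le_tsum (fun n => ?_) (summable_sq _) (f.summable_sq.mul_left _)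
  rw [coeff_diagonal, norm_mul, mul_pow, Complex.norm_real, Real.norm_eq_abs]
  gcongr
  exact hC n

theorem truncation_coeff (N n : ℕ) (f : HardySpace) :
    ((basis (fun _ => 1)).truncation N f).coeff n = if n < N then f.coeff n else 0 := by
  rw [← inner_basis_eq, ← HilbertBasis.inner_truncation_comm, HilbertBasis.truncation_apply]
  split_ifs with h
  · rw [Finset.sum_eq_single n]
    · rw [orthonormal_iff_ite.1 (basis fun _ => 1).orthonormal, if_pos rfl, one_smul,
        inner_basis_eq]
    · intro k _ hk
      rw [(basis fun _ => 1).orthonormal.2 hk, zero_smul]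
    · intro h'; exact absurd (Finset.mem_range.2 h) h'
  · rw [Finset.sum_eq_zero, inner_zero_left]
    intro k hk
    rw [(basis fun _ => 1).orthonormal.2, zero_smul]
    rintro rfl
    exact h (Finset.mem_range.1 hk)

/-- A diagonal operator whose entries tend to `0` is compact. -/
theorem isCompactOperator_diagonal {d : ℕ → ℝ} (hd : ∃ C, ∀ n, |d n| ≤ C)
    (h : Tendsto d atTop (𝓝 0)) : IsCompactOperator (diagonal d hd) := by
  refine isCompactOperator_of_tendsto_mul _ (basis fun _ => 1).isCompactOperator_truncation ?_
  rw [NormedAddGroup.tendsto_nhds_zero]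
  intro ε hε
  have h1 : ∀ᶠ n in atTop, |d n| < ε / 2 := by
    have := (NormedAddGroup.tendsto_nhds_zero.1 h) (ε / 2) (by positivity)
    simpa using this
  obtain ⟨N, hN⟩ := eventually_atTop.1 h1
  filter_upwards [eventually_ge_atTop N] with M hM
  refine lt_of_le_of_lt (ContinuousLinearMap.opNorm_le_bound _ (by positivity : 0 ≤ ε / 2)
    fun f => ?_) (half_lt_self hε)
  refine (pow_le_pow_iff_left₀ (norm_nonneg _) (by positivity) two_ne_zero).1 ?_
  rw [mul_pow, norm_sq, norm_sq, ← tsum_mul_left]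
  refine Summable.tsum_le_tsum (fun n => ?_) (summable_sq _) (f.summable_sq.mul_left _)
  have : ((diagonal d hd * (1 - (basis fun _ => 1).truncation M)) f).coeff n =
      d n * (f.coeff n - if n < M then f.coeff n else 0) := by
    rw [← truncation_coeff]; rfl
  rw [this]
  split_ifs with hn
  · simp; positivity
  · rw [sub_zero, norm_mul, mul_pow, Complex.norm_real, Real.norm_eq_abs]
    gcongr
    exact (hN n (by omega)).le

/-- The isometry `∑ a_n z^n ↦ ∑ a_n z^(n+1)`. -/
def shiftIsometry : HardySpace →ₗᵢ[ℂ] HardySpace where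
  toFun f := DiskSpace.mk _ (fun n => Nat.casesOn n 0 f.coeff) (by
    rw [← summable_nat_add_iff 1]
    simpa using f.summable_sq)
  map_add' f g := DiskSpace.ext fun n => by cases n <;> simp
  map_smul' c f := DiskSpace.ext fun n => by cases n <;> simp
  norm_map' f := by
    rw [← sq_eq_sq₀ (norm_nonneg _) (norm_nonneg _), norm_sq, norm_sq,
      (summable_sq _).tsum_eq_zero_add]
    simp

/-- The unilateral shift, i.e. multiplication by `z`. -/
def shift : HardySpace →L[ℂ] HardySpace := shiftIsometry.toContinuousLinearMap

@[simp] theorem coeff_shift_zero (f : HardySpace) : (shift f).coeff 0 = 0 := rfl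

@[simp] theorem coeff_shift_succ (f : HardySpace) (n : ℕ) :
    (shift f).coeff (n + 1) = f.coeff n := rfl

theorem norm_shift_le : ‖shift‖ ≤ 1 := shiftIsometry.norm_toContinuousLinearMap_le

theorem shift_basis (n : ℕ) : shift (basis (fun _ => 1) n) = basis (fun _ => 1) (n + 1) :=
  DiskSpace.ext fun k => by
    cases k with
    | zero => simp [coeff_basis]
    | succ k => simp [coeff_basis]

@[simp] theorem coeff_star_shift (f : HardySpace) (n : ℕ) :
    (star shift f).coeff n = f.coeff (n + 1) := by
  rw [← inner_basis_eq, ContinuousLinearMap.star_eq_adjoint,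
    ContinuousLinearMap.adjoint_inner_right, shift_basis, inner_basis_eq]

theorem star_shift_mul_shift : star shift * shift = 1 := clm_ext fun f n => by simp

/-- The projection onto the constants. -/
def constProj : HardySpace →L[ℂ] HardySpace :=
  rankOne ℂ (basis (fun _ => 1) 0) (basis (fun _ => 1) 0)

theorem coeff_constProj (f : HardySpace) (n : ℕ) :
    (constProj f).coeff n = if n = 0 then f.coeff 0 else 0 := by
  rw [constProj, rankOne_apply, coeff_smul, coeff_basis, inner_basis_eq]
  cases n <;> simp

theorem isCompactOperator_constProj : IsCompactOperator constProj := isCompactOperator_rankOne _ _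

theorem shift_mul_star_shift : shift * star shift = 1 - constProj :=
  clm_ext fun f n => by
    cases n with
    | zero => simp [coeff_constProj]
    | succ n => simp [coeff_constProj]

theorem isMulZ_shift : IsMulZ shift := by
  intro f z hz
  have h := (hasSum_nat_add_iff' 1).2 ((shift f).hasSum_eval hz)
  simp only [coeff_shift_succ, Finset.range_one, Finset.sum_singleton, coeff_shift_zero, zero_mul,
    sub_zero] at h
  refine h.unique ?_
  simpa [pow_succ', mul_left_comm] using (f.hasSum_eval hz).mul_left z

end HardySpace

theorem DiskSpace.IsMulZ.unique {w : ℕ → ℕ+} {M M' : DiskSpace w →L[ℂ] DiskSpace w}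
    (h : IsMulZ M) (h' : IsMulZ M') : M = M' :=
  ContinuousLinearMap.ext fun f => eval_injective fun z hz => by rw [h f z hz, h' f z hz]

/-! ### Unitaries determined by their values on a total family -/

/-- Two total families with the same Gram matrix are related by a unitary operator. -/
theorem exists_unitary_of_inner_eq {H ι : Type*} [NormedAddCommGroup H] [InnerProductSpace ℂ H]
    [CompleteSpace H] {x y : ι → H} (hx : ∀ f, (∀ i, inner ℂ (x i) f = 0) → f = 0)
    (hy : ∀ f, (∀ i, inner ℂ (y i) f = 0) → f = 0)
    (h : ∀ i j, inner ℂ (x i) (x j) = inner ℂ (y i) (y j)) :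
    ∃ W ∈ unitary (H →L[ℂ] H), ∀ i, W (x i) = y i := by
  have hdense : ∀ {x : ι → H}, (∀ f, (∀ i, inner ℂ (x i) f = 0) → f = 0) →
      DenseRange (Finsupp.linearCombination ℂ x) := by
    intro x hx
    change Dense (Set.range (Finsupp.linearCombination ℂ x))
    rw [← LinearMap.coe_range, Finsupp.range_linearCombination,
      Submodule.dense_iff_topologicalClosure_eq_top, Submodule.topologicalClosure_eq_top_iff,
      Submodule.eq_bot_iff]
    intro f hf
    exact hx f fun i => (Submodule.mem_orthogonal _ _).1 hf _ (Submodule.subset_span ⟨i, rfl⟩)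
  have hinner : ∀ (x : ι → H) (c : ι →₀ ℂ), inner ℂ (Finsupp.linearCombination ℂ x c)
      (Finsupp.linearCombination ℂ x c) =
        ∑ j ∈ c.support, c j * ∑ i ∈ c.support, conj (c i) * inner ℂ (x i) (x j) := by
    intro x c
    simp only [Finsupp.linearCombination_apply, Finsupp.sum, sum_inner, inner_sum,
      inner_smul_left, inner_smul_right]
  have hnorm : ∀ c : ι →₀ ℂ, ‖Finsupp.linearCombination ℂ y (LinearEquiv.refl ℂ _ c)‖ =
      ‖Finsupp.linearCombination ℂ x c‖ := by
    intro c
    have h1 : inner ℂ (Finsupp.linearCombination ℂ y c) (Finsupp.linearCombination ℂ y c) =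
        inner ℂ (Finsupp.linearCombination ℂ x c) (Finsupp.linearCombination ℂ x c) := by
      rw [hinner, hinner]; simp only [h]
    rw [LinearEquiv.refl_apply, ← sq_eq_sq₀ (norm_nonneg _) (norm_nonneg _)]
    rw [inner_self_eq_norm_sq_to_K, inner_self_eq_norm_sq_to_K] at h1
    exact_mod_cast h1
  let U : H ≃ₗᵢ[ℂ] H := (LinearEquiv.refl ℂ (ι →₀ ℂ)).extendOfIsometry
    (Finsupp.linearCombination ℂ x) (Finsupp.linearCombination ℂ y) (hdense hx) (hdense hy) hnorm
  refine ⟨(Unitary.linearIsometryEquiv.symm U : unitary (H →L[ℂ] H)), Subtype.property _,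
    fun i => ?_⟩
  have := (LinearEquiv.refl ℂ (ι →₀ ℂ)).extendOfIsometry_eq (Finsupp.linearCombination ℂ x)
    (Finsupp.linearCombination ℂ y) (hdense hx) (hdense hy) hnorm (Finsupp.single i 1)
  simpa using this

/-! ### Möbius transformations in matrix form -/

/-- The group `SU(1,1)`: matrices with rows `(α, β)` and `(conj β, conj α)`, of determinant `1`. -/
structure SU11 where
  /-- The upper left entry. -/
  α : ℂ
  /-- The upper right entry. -/
  β : ℂ
  det : ‖α‖ ^ 2 - ‖β‖ ^ 2 = 1

namespace SU11

variable (g : SU11)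

/-- The denominator `conj β z + conj α` of the Möbius transformation. -/
def den (z : ℂ) : ℂ := conj g.β * z + conj g.α

/-- The Möbius transformation `z ↦ (α z + β) / (conj β z + conj α)`. -/
def act (z : ℂ) : ℂ := (g.α * z + g.β) / g.den z

/-- The inverse matrix. -/
def inv : SU11 := ⟨conj g.α, -g.β, by simpa using g.det⟩

theorem den_ne_zero {z : ℂ} (hz : ‖z‖ ≤ 1) : g.den z ≠ 0 := mobius_denom_ne_zero g.det hz

theorem det_eq : g.α * conj g.α - g.β * conj g.β = 1 := by
  rw [Complex.mul_conj, Complex.mul_conj, Complex.normSq_eq_norm_sq, Complex.normSq_eq_norm_sq]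
  exact_mod_cast g.det

theorem one_sub_conj_act_mul_act {z w : ℂ} (hz : ‖z‖ ≤ 1) (hw : ‖w‖ ≤ 1) :
    (1 - conj (g.act w) * g.act z) * (conj (g.den w) * g.den z) = 1 - conj w * z := by
  have h1 := g.den_ne_zero hz
  have h2 : conj (g.den w) ≠ 0 := (map_ne_zero _).2 (g.den_ne_zero hw)
  rw [act, act, map_div₀]
  have h3 : (1 - conj (g.α * w + g.β) / conj (g.den w) * ((g.α * z + g.β) / g.den z)) *
      (conj (g.den w) * g.den z) =
        conj (g.den w) * g.den z - conj (g.α * w + g.β) * (g.α * z + g.β) := by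
    field_simp
  rw [h3]
  simp only [den, map_add, map_mul, Complex.conj_conj]
  linear_combination (1 - conj w * z) * g.det_eq

theorem norm_act_lt_one {z : ℂ} (hz : ‖z‖ < 1) : ‖g.act z‖ < 1 := by
  have h := g.one_sub_conj_act_mul_act hz.le hz.le
  have e : ∀ x : ℂ, conj x * x = ((‖x‖ ^ 2 : ℝ) : ℂ) := fun x => by
    rw [← Complex.normSq_eq_norm_sq, ← Complex.normSq_eq_conj_mul_self]
  rw [e, e, e] at h
  have h' : (1 - ‖g.act z‖ ^ 2) * ‖g.den z‖ ^ 2 = 1 - ‖z‖ ^ 2 := by exact_mod_cast h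
  have hd : 0 < ‖g.den z‖ ^ 2 := by have := norm_pos_iff.2 (g.den_ne_zero hz.le); positivity
  have hz2 : ‖z‖ ^ 2 < 1 := by nlinarith [norm_nonneg z]
  by_contra! hcon
  have : 1 ≤ ‖g.act z‖ ^ 2 := one_le_pow₀ hcon
  nlinarith

theorem act_inv_act {z : ℂ} (hz : ‖z‖ < 1) : g.act (g.inv.act z) = z := by
  have h1 := g.inv.den_ne_zero hz.le
  have h2 := g.den_ne_zero (g.inv.norm_act_lt_one hz).le
  rw [act, div_eq_iff h2]
  have h3 : g.inv.act z * g.inv.den z = conj g.α * z - g.β := by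
    rw [act, div_mul_cancel₀ _ h1]; simp [inv]; ring
  apply mul_right_cancel₀ h1
  simp only [den, inv, map_neg, Complex.conj_conj] at h3 ⊢
  linear_combination (g.α - conj g.β * z) * h3

theorem α_ne_zero : g.α ≠ 0 := by
  intro h
  have := g.det
  rw [h, norm_zero] at this
  nlinarith [sq_nonneg ‖g.β‖]

/-- The number `q` for which the denominator is `conj α (1 - q z)`. -/
def ratio : ℂ := -(conj g.β / conj g.α)

theorem norm_ratio_lt_one : ‖g.ratio‖ < 1 := by
  rw [ratio, norm_neg, norm_div, Complex.norm_conj, Complex.norm_conj,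
    div_lt_one (norm_pos_iff.2 g.α_ne_zero)]
  have := g.det
  nlinarith [norm_nonneg g.α, norm_nonneg g.β]

theorem den_eq (z : ℂ) : g.den z = conj g.α * (1 - g.ratio * z) := by
  have : conj g.α ≠ 0 := (map_ne_zero _).2 g.α_ne_zero
  rw [den, ratio]; field_simp; ring

/-- A square root of `1 / conj α`. -/
def rootConst : ℂ := ((conj g.α)⁻¹) ^ (1 / 2 : ℂ)

theorem rootConst_sq : g.rootConst * g.rootConst = (conj g.α)⁻¹ := by
  rw [← pow_two, rootConst]
  simp

/-- The holomorphic function `(conj β z + conj α)^{-1/2}` on the disk. -/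
def rootInv (z : ℂ) : ℂ := g.rootConst * invSqrt (g.ratio * z)

end SU11

theorem summable_norm_pow_complex {z : ℂ} (hz : ‖z‖ < 1) : Summable fun n => ‖z ^ n‖ :=
  summable_norm_pow_of_norm_lt_one hz

theorem SU11.den_mul_rootInv_sq (g : SU11) {z : ℂ} (hz : ‖z‖ ≤ 1) :
    g.den z * (g.rootInv z * g.rootInv z) = 1 := by
  have hq : ‖g.ratio * z‖ < 1 := by
    rw [norm_mul]
    exact (mul_le_of_le_one_right (norm_nonneg _) hz).trans_lt g.norm_ratio_lt_one
  have h := one_sub_mul_invSqrt_mul_invSqrt (summable_norm_pow_complex hq)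
  have h2 := g.rootConst_sq
  have h3 : conj g.α ≠ 0 := (map_ne_zero _).2 g.α_ne_zero
  rw [g.den_eq, rootInv]
  calc _ = (g.rootConst * g.rootConst * conj g.α) * ((1 - g.ratio * z) *
        (invSqrt (g.ratio * z) * invSqrt (g.ratio * z))) := by ring
    _ = 1 := by rw [h, h2, inv_mul_cancel₀ h3, one_mul]

/-! ### Reproducing kernels of the Hardy space -/

namespace HardySpace

open DiskSpace InnerProductSpace

/-- The reproducing kernel `∑ (conj w)^n z^n` of the Hardy space at a point `w` of the disk. -/
def kernel (w : {w : ℂ // ‖w‖ < 1}) : HardySpace :=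
  DiskSpace.mk _ (fun n => conj (w : ℂ) ^ n) (by
    have : Summable fun n => (‖(w : ℂ)‖ ^ 2) ^ n :=
      summable_geometric_of_lt_one (by positivity) (by nlinarith [w.2, norm_nonneg (w : ℂ)])
    refine this.congr fun n => ?_
    simp [← pow_mul, mul_comm])

@[simp] theorem coeff_kernel (w : {w : ℂ // ‖w‖ < 1}) (n : ℕ) :
    (kernel w).coeff n = conj (w : ℂ) ^ n := rfl

theorem inner_kernel (w : {w : ℂ // ‖w‖ < 1}) (f : HardySpace) :
    inner ℂ (kernel w) f = f.eval w := by
  refine (hasSum_inner _ _).unique ?_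
  simpa [mul_comm] using f.hasSum_eval w.2

theorem eq_zero_of_inner_kernel {f : HardySpace} (h : ∀ w, inner ℂ (kernel w) f = 0) : f = 0 :=
  eval_injective (w := fun _ => 1) fun z hz => by
    rw [← inner_kernel ⟨z, hz⟩, h, ← inner_kernel ⟨z, hz⟩, inner_zero_right]

theorem clm_ext_eval {H : Type*} [NormedAddCommGroup H] [NormedSpace ℂ H] {A B : H →L[ℂ] HardySpace}
    (h : ∀ f (z : ℂ), ‖z‖ < 1 → (A f).eval z = (B f).eval z) : A = B :=
  ContinuousLinearMap.ext fun f => eval_injective (h f)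

/-- Two operators agree if all their matrix entries between reproducing kernels do. -/
theorem clm_ext_kernel {A B : HardySpace →L[ℂ] HardySpace}
    (h : ∀ z w, inner ℂ (kernel z) (A (kernel w)) = inner ℂ (kernel z) (B (kernel w))) : A = B := by
  have h1 : ∀ w, A (kernel w) = B (kernel w) := fun w => eval_injective fun z hz => by
    rw [← inner_kernel ⟨z, hz⟩, ← inner_kernel ⟨z, hz⟩, h]
  refine star_injective (ContinuousLinearMap.ext fun f => ?_)
  rw [← sub_eq_zero]
  refine eq_zero_of_inner_kernel fun w => ?_
  rw [inner_sub_right, ContinuousLinearMap.star_eq_adjoint, ContinuousLinearMap.star_eq_adjoint,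
    ContinuousLinearMap.adjoint_inner_right, ContinuousLinearMap.adjoint_inner_right, h1, sub_self]

theorem eval_kernel (w : {w : ℂ // ‖w‖ < 1}) {z : ℂ} (hz : ‖z‖ < 1) :
    (kernel w).eval z * (1 - conj (w : ℂ) * z) = 1 := by
  have h : ‖conj (w : ℂ) * z‖ < 1 := by
    rw [norm_mul, Complex.norm_conj]
    exact mul_lt_one_of_nonneg_of_lt_one_left (norm_nonneg _) w.2 hz.le
  have h1 : (kernel w).eval z = (1 - conj (w : ℂ) * z)⁻¹ := by
    refine ((kernel w).hasSum_eval hz).unique ?_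
    simpa [mul_pow] using hasSum_geometric_of_norm_lt_one h
  rw [h1, inv_mul_cancel₀]
  intro h0
  rw [← sub_eq_zero.1 h0, norm_one] at h
  exact lt_irrefl _ h

/-- The image of a point of the disk. -/
def _root_.SU11.actDisk (g : SU11) (w : {w : ℂ // ‖w‖ < 1}) : {w : ℂ // ‖w‖ < 1} :=
  ⟨g.act w, g.norm_act_lt_one w.2⟩

/-- The operators `f ↦ (conj β z + conj α)^{-1} f ∘ γ` are unitary on the Hardy space: their
adjoints permute the reproducing kernels, up to scalars for which inner products are preserved. -/
theorem _root_.SU11.exists_hardyUnitary (g : SU11) :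
    ∃ V ∈ unitary (HardySpace →L[ℂ] HardySpace),
      ∀ w, star V (kernel w) = (conj (g.den w))⁻¹ • kernel (g.actDisk w) := by
  have hd : ∀ w : {w : ℂ // ‖w‖ < 1}, conj (g.den w) ≠ 0 := fun w =>
    (map_ne_zero _).2 (g.den_ne_zero w.2.le)
  obtain ⟨W, hW, hWk⟩ := exists_unitary_of_inner_eq (x := kernel)
    (y := fun w => (conj (g.den w))⁻¹ • kernel (g.actDisk w))
    (fun f => eq_zero_of_inner_kernel) (fun f hf => by
      refine eq_zero_of_inner_kernel fun w => ?_
      have := hf (g.inv.actDisk w)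
      rw [inner_smul_left, mul_eq_zero] at this
      rcases this with h | h
      · exact absurd h ((map_ne_zero _).2 (inv_ne_zero (hd _)))
      · have e : g.actDisk (g.inv.actDisk w) = w := Subtype.ext (g.act_inv_act w.2)
        rwa [e] at h)
    (fun z w => by
      rw [inner_smul_left, inner_smul_right, inner_kernel, inner_kernel]
      have h1 := eval_kernel w z.2
      have h2 := eval_kernel (g.actDisk w) (g.actDisk z).2
      have h3 := g.one_sub_conj_act_mul_act z.2.le w.2.le
      have h4 : (1 - conj (w : ℂ) * z) ≠ 0 := right_ne_zero_of_mul_eq_one h1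
      have h5 : (1 - conj (g.act w) * g.act z) ≠ 0 := right_ne_zero_of_mul_eq_one h2
      have h6 := hd w
      have h7 := g.den_ne_zero z.2.le
      change (kernel (g.actDisk w)).eval (g.actDisk z) * (1 - conj (g.act w) * g.act z) = 1 at h2
      rw [eq_div_of_mul_eq h4 h1, eq_div_of_mul_eq h5 h2, ← h3, map_inv₀, Complex.conj_conj]
      field_simp)
  exact ⟨star W, Unitary.star_mem hW, fun w => by rw [star_star, hWk]⟩

end HardySpace

namespace SU11

open HardySpace DiskSpace

variable (g : SU11)

/-- The unitary `f ↦ (conj β z + conj α)^{-1} f ∘ γ` of the Hardy space. -/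
def hardyUnitary : HardySpace →L[ℂ] HardySpace := g.exists_hardyUnitary.choose

theorem hardyUnitary_mem : g.hardyUnitary ∈ unitary (HardySpace →L[ℂ] HardySpace) :=
  g.exists_hardyUnitary.choose_spec.1

theorem star_hardyUnitary_kernel (w : {w : ℂ // ‖w‖ < 1}) :
    star g.hardyUnitary (kernel w) = (conj (g.den w))⁻¹ • kernel (g.actDisk w) :=
  g.exists_hardyUnitary.choose_spec.2 w

theorem den_mul_eval_hardyUnitary (f : HardySpace) {z : ℂ} (hz : ‖z‖ < 1) :
    g.den z * (g.hardyUnitary f).eval z = f.eval (g.act z) := by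
  have h1 : inner ℂ (star g.hardyUnitary (kernel ⟨z, hz⟩)) f = (g.hardyUnitary f).eval z := by
    rw [ContinuousLinearMap.star_eq_adjoint, ContinuousLinearMap.adjoint_inner_left, inner_kernel]
  rw [star_hardyUnitary_kernel, inner_smul_left, inner_kernel, map_inv₀, Complex.conj_conj] at h1
  rw [← h1, mul_inv_cancel_left₀ (g.den_ne_zero hz.le)]
  rfl

/-- Multiplication by the denominator `conj β z + conj α`. -/
def denOp : HardySpace →L[ℂ] HardySpace := conj g.β • shift + conj g.α • 1

theorem eval_denOp (f : HardySpace) {z : ℂ} (hz : ‖z‖ < 1) :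
    (g.denOp f).eval z = g.den z * f.eval z := by
  change (conj g.β • shift f + conj g.α • f).eval z = _
  rw [eval_add _ _ hz, eval_smul, eval_smul, isMulZ_shift f z hz, den]
  ring

/-- The composition operator `f ↦ f ∘ γ`. -/
def compOp : HardySpace →L[ℂ] HardySpace := g.denOp * g.hardyUnitary

theorem eval_compOp (f : HardySpace) {z : ℂ} (hz : ‖z‖ < 1) :
    (g.compOp f).eval z = f.eval (g.act z) := by
  rw [compOp, mul_apply_eq_comp, eval_denOp _ _ hz, den_mul_eval_hardyUnitary _ _ hz]

/-- Composition operators intertwine `z` with `γ(z) = (α z + β) / (conj β z + conj α)`. -/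
theorem compOp_mul_shift :
    g.compOp * shift = (g.α • shift + g.β • 1) * g.hardyUnitary := by
  refine clm_ext_eval fun f z hz => ?_
  rw [mul_apply_eq_comp, eval_compOp _ _ hz, isMulZ_shift _ _ (g.norm_act_lt_one hz)]
  change _ = (g.α • shift (g.hardyUnitary f) + g.β • g.hardyUnitary f).eval z
  rw [eval_add _ _ hz, eval_smul, eval_smul, isMulZ_shift _ _ hz,
    ← den_mul_eval_hardyUnitary _ _ hz, act]
  have := g.den_ne_zero hz.le
  field_simp

/-- Multiplication by `(conj β z + conj α)^{-1/2}`. -/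
def rootInvOp : HardySpace →L[ℂ] HardySpace := g.rootConst • invSqrt (g.ratio • shift)

theorem summable_ratio_smul_shift : Summable fun n => ‖(g.ratio • shift) ^ n‖ := by
  refine summable_norm_pow_of_norm_lt_one ?_
  rw [norm_smul]
  exact (mul_le_of_le_one_right (norm_nonneg _) norm_shift_le).trans_lt g.norm_ratio_lt_one

end SU11

/-- The denominator and the inverse of its square root, in any Banach algebra. -/
theorem SU11.den_smul_mul_invSqrt (g : SU11) {A : Type*} [NormedRing A] [NormedAlgebra ℂ A]
    [CompleteSpace A] {s : A} (hs : Summable fun n => ‖(g.ratio • s) ^ n‖) :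
    (conj g.β • s + conj g.α • 1) *
      ((g.rootConst • invSqrt (g.ratio • s)) * (g.rootConst • invSqrt (g.ratio • s))) = 1 := by
  have h3 : conj g.α ≠ 0 := (map_ne_zero _).2 g.α_ne_zero
  have h1 : conj g.β • s + conj g.α • 1 = conj g.α • (1 - g.ratio • s) := by
    rw [smul_sub, smul_smul, ratio, mul_neg, mul_div_cancel₀ _ h3, neg_smul, sub_neg_eq_add,
      add_comm]
  rw [h1, smul_mul_smul_comm, g.rootConst_sq, smul_mul_smul_comm, mul_inv_cancel₀ h3,
    one_sub_mul_invSqrt_mul_invSqrt hs, one_smul]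

namespace SU11

open HardySpace DiskSpace

variable (g : SU11)

theorem denOp_mul_rootInvOp_sq : g.denOp * (g.rootInvOp * g.rootInvOp) = 1 :=
  g.den_smul_mul_invSqrt g.summable_ratio_smul_shift

end SU11

/-! ### The operator with kernel `(1 - z conj w)^{-1/2}` -/

/-- The action of `(1 - T)^{-1/2}` on an eigenvector of `T`. -/
theorem invSqrt_apply_of_apply_eq_smul {H : Type*} [NormedAddCommGroup H] [NormedSpace ℂ H]
    [CompleteSpace H] {T : H →L[ℂ] H} (hT : Summable fun n => ‖T ^ n‖) {x : H} {c : ℂ}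
    (hc : ‖c‖ < 1) (h : T x = c • x) : invSqrt T x = invSqrt c • x := by
  have hpow : ∀ n, (T ^ n) x = c ^ n • x := by
    intro n
    induction n with
    | zero => simp
    | succ n ih => rw [pow_succ, mul_apply_eq_comp, h, map_smul, ih, smul_smul, pow_succ']
  have h1 : HasSum (fun n => ((invSqrtCoeff n : ℂ) • T ^ n) x) (invSqrt T x) :=
    (hasSum_invSqrt hT).map ((ContinuousLinearMap.apply ℂ H x : (H →L[ℂ] H) →L[ℂ] H) :
      (H →L[ℂ] H) →+ H) (ContinuousLinearMap.apply ℂ H x : (H →L[ℂ] H) →L[ℂ] H).continuous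
  have h2 : HasSum (fun n => ((invSqrtCoeff n : ℂ) • c ^ n) • x) (invSqrt c • x) :=
    (hasSum_invSqrt (summable_norm_pow_complex hc)).smul_const x
  refine h1.unique ?_
  convert h2 using 2 with n
  change (invSqrtCoeff n : ℂ) • (T ^ n) x = _
  rw [hpow, smul_assoc]

namespace HardySpace

open DiskSpace

theorem star_shift_kernel (w : {w : ℂ // ‖w‖ < 1}) :
    star shift (kernel w) = conj (w : ℂ) • kernel w :=
  DiskSpace.ext fun n => by simp [pow_succ']

/-- The diagonal operator on the Hardy space with the kernel `(1 - z conj w)^{-1/2}`. -/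
def halfOp : HardySpace →L[ℂ] HardySpace :=
  diagonal invSqrtCoeff ⟨1, fun n => by
    rw [abs_of_pos (invSqrtCoeff_pos n)]; exact invSqrtCoeff_le_one n⟩

theorem eval_halfOp_kernel (w : {w : ℂ // ‖w‖ < 1}) (z : ℂ) :
    (halfOp (kernel w)).eval z = invSqrt (conj (w : ℂ) * z) :=
  tsum_congr fun n => by simp [halfOp, mul_pow, mul_assoc]

theorem continuousOn_invSqrt : ContinuousOn (invSqrt : ℂ → ℂ) (Metric.ball 0 1) := by
  intro x hx
  obtain ⟨r, hxr, hr⟩ := exists_between (mem_ball_zero_iff.1 hx)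
  have hr0 : 0 < r := (norm_nonneg x).trans_lt hxr
  have h1 : ‖x / r‖ < 1 := by
    rw [norm_div, Complex.norm_real, Real.norm_of_nonneg hr0.le, div_lt_one hr0]; exact hxr
  obtain ⟨w, hw⟩ : ∃ w : {w : ℂ // ‖w‖ < 1}, (w : ℂ) = r := ⟨⟨r, by
    rwa [Complex.norm_real, Real.norm_of_nonneg hr0.le]⟩, rfl⟩
  have h0 : ContinuousAt (halfOp (kernel w)).eval (x / r) :=
    ((halfOp (kernel w)).hasDerivAt_eval h1).continuousAt
  have h2 : ContinuousAt (fun y : ℂ => (halfOp (kernel w)).eval (y / r)) x :=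
    h0.tendsto.comp (Continuous.tendsto (f := fun y : ℂ => y / r) (by fun_prop) x)
  refine (h2.congr (Eventually.of_forall fun y => ?_)).continuousWithinAt
  change (halfOp (kernel w)).eval (y / r) = invSqrt y
  rw [eval_halfOp_kernel]
  have : (r : ℂ) ≠ 0 := by exact_mod_cast hr0.ne'
  congr 1
  rw [hw, Complex.conj_ofReal]
  field_simp

theorem exists_pos_invSqrt_eq {x : ℝ} (h0 : 0 ≤ x) (h1 : x < 1) :
    ∃ c : ℝ, 0 < c ∧ invSqrt (x : ℂ) = c := by
  have hx : ‖(x : ℂ)‖ < 1 := by rwa [Complex.norm_real, Real.norm_of_nonneg h0]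
  have h := hasSum_invSqrt (summable_norm_pow_complex hx)
  have h2 : ∀ n, (invSqrtCoeff n : ℂ) • (x : ℂ) ^ n = ((invSqrtCoeff n * x ^ n : ℝ) : ℂ) := by
    intro n; push_cast; rfl
  simp only [h2] at h
  have h3 := Complex.hasSum_re h
  simp only [Complex.ofReal_re] at h3
  refine ⟨(invSqrt (x : ℂ)).re, ?_, ?_⟩
  · refine lt_of_lt_of_le ?_ (le_hasSum h3 0 fun n _ => ?_)
    · simp [invSqrtCoeff_zero]
    · exact mul_nonneg (invSqrtCoeff_pos n).le (pow_nonneg h0 n)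
  · exact (h.unique (Complex.hasSum_ofReal.2 h3))

end HardySpace

namespace SU11

open HardySpace DiskSpace

variable (g : SU11)

theorem continuousOn_rootInv : ContinuousOn g.rootInv (Metric.ball 0 1) := by
  refine continuousOn_const.mul (continuousOn_invSqrt.comp (by fun_prop) fun z hz => ?_)
  rw [mem_ball_zero_iff] at hz ⊢
  rw [norm_mul]
  exact mul_lt_one_of_nonneg_of_lt_one_left (norm_nonneg _) g.norm_ratio_lt_one hz.le

theorem continuousOn_act : ContinuousOn g.act (Metric.ball 0 1) := by
  have : Continuous g.den := by unfold den; fun_prop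
  exact (Continuous.continuousOn (by fun_prop)).div this.continuousOn fun z hz =>
    g.den_ne_zero (mem_ball_zero_iff.1 hz).le

theorem norm_conj_mul_lt_one {z w : ℂ} (hz : ‖z‖ < 1) (hw : ‖w‖ < 1) : ‖conj w * z‖ < 1 := by
  rw [norm_mul, Complex.norm_conj]
  exact mul_lt_one_of_nonneg_of_lt_one_left (norm_nonneg _) hw hz.le

/-- The transformation law of the kernel `(1 - z conj w)^{-1/2}`. Both sides have the same square,
do not vanish, and are positive for `z = w`, so that the choices of the square roots match. -/
theorem invSqrt_conj_act_mul_act {z w : ℂ} (hz : ‖z‖ < 1) (hw : ‖w‖ < 1) :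
    (g.den z)⁻¹ * (conj (g.den w))⁻¹ * invSqrt (conj (g.act w) * g.act z) =
      g.rootInv z * conj (g.rootInv w) * invSqrt (conj w * z) := by
  have hsq : ∀ {x : ℂ}, ‖x‖ < 1 → (1 - x) * (invSqrt x * invSqrt x) = 1 := fun hx =>
    one_sub_mul_invSqrt_mul_invSqrt (summable_norm_pow_complex hx)
  have hmaps : ∀ {w : ℂ}, ‖w‖ < 1 → ContinuousOn (fun z => invSqrt (conj w * z))
      (Metric.ball 0 1) := fun {w} hw => continuousOn_invSqrt.comp (by fun_prop) fun z hz => by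
    rw [mem_ball_zero_iff] at hz ⊢
    exact norm_conj_mul_lt_one hz hw
  have hden : Continuous g.den := by unfold den; fun_prop
  refine IsPreconnected.eq_of_sq_eq (S := Metric.ball (0 : ℂ) 1) (y := w)
    (f := fun z => (g.den z)⁻¹ * (conj (g.den w))⁻¹ * invSqrt (conj (g.act w) * g.act z))
    (g := fun z => g.rootInv z * conj (g.rootInv w) * invSqrt (conj w * z))
    (convex_ball _ _).isPreconnected ?_ ?_ ?_ ?_ (mem_ball_zero_iff.2 hw) ?_
    (mem_ball_zero_iff.2 hz)
  · refine ((hden.continuousOn.inv₀ fun z hz => ?_).mul continuousOn_const).mul ?_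
    · exact g.den_ne_zero (mem_ball_zero_iff.1 hz).le
    · exact (hmaps (g.norm_act_lt_one hw)).comp g.continuousOn_act fun z hz =>
        mem_ball_zero_iff.2 (g.norm_act_lt_one (mem_ball_zero_iff.1 hz))
  · exact (g.continuousOn_rootInv.mul continuousOn_const).mul (hmaps hw)
  · intro z hz
    have hz := mem_ball_zero_iff.1 hz
    have h1 := hsq (norm_conj_mul_lt_one hz hw)
    have h2 := hsq (norm_conj_mul_lt_one (g.norm_act_lt_one hz) (g.norm_act_lt_one hw))
    have h3 := g.one_sub_conj_act_mul_act hz.le hw.le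
    have h4 := g.den_mul_rootInv_sq hz.le
    have h5 := congrArg conj (g.den_mul_rootInv_sq hw.le)
    simp only [map_mul, map_one] at h5
    have h6 := g.den_ne_zero hz.le
    have h7 : conj (g.den w) ≠ 0 := (map_ne_zero _).2 (g.den_ne_zero hw.le)
    have h8 : 1 - conj w * z ≠ 0 := left_ne_zero_of_mul_eq_one h1
    have h9 : 1 - conj (g.act w) * g.act z ≠ 0 := left_ne_zero_of_mul_eq_one h2
    simp only [Pi.pow_apply, mul_pow]
    rw [pow_two (invSqrt _), pow_two (invSqrt _), pow_two (g.rootInv z),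
      pow_two (conj (g.rootInv w)), eq_inv_of_mul_eq_one_right h1,
      eq_inv_of_mul_eq_one_right h2, eq_inv_of_mul_eq_one_right h4,
      eq_inv_of_mul_eq_one_right h5, ← h3]
    field_simp
  · intro z hz
    have hz := mem_ball_zero_iff.1 hz
    have h1 := hsq (norm_conj_mul_lt_one hz hw)
    have h4 := g.den_mul_rootInv_sq hz.le
    have h5 := g.den_mul_rootInv_sq hw.le
    refine mul_ne_zero (mul_ne_zero ?_ ((map_ne_zero _).2 ?_)) ?_
    · exact left_ne_zero_of_mul (right_ne_zero_of_mul_eq_one h4)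
    · exact left_ne_zero_of_mul (right_ne_zero_of_mul_eq_one h5)
    · exact left_ne_zero_of_mul (right_ne_zero_of_mul_eq_one h1)
  · -- At `z = w` both sides are positive real numbers.
    have e : ∀ x : ℂ, conj x * x = ((‖x‖ ^ 2 : ℝ) : ℂ) := fun x => by
      rw [← Complex.normSq_eq_norm_sq, ← Complex.normSq_eq_conj_mul_self]
    have hlt : ∀ {x : ℂ}, ‖x‖ < 1 → ‖x‖ ^ 2 < 1 := fun {x} hx => by
      nlinarith [norm_nonneg x]
    obtain ⟨a, ha, ha'⟩ := exists_pos_invSqrt_eq (by positivity) (hlt (g.norm_act_lt_one hw))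
    obtain ⟨b, hb, hb'⟩ := exists_pos_invSqrt_eq (by positivity) (hlt hw)
    have h1 := hsq (norm_conj_mul_lt_one hw hw)
    have h2 := hsq (norm_conj_mul_lt_one (g.norm_act_lt_one hw) (g.norm_act_lt_one hw))
    have h3 := g.one_sub_conj_act_mul_act hw.le hw.le
    have h4 := congrArg norm (g.den_mul_rootInv_sq hw.le)
    rw [e, ha'] at h2
    rw [e, hb'] at h1
    rw [e, e, e] at h3
    have hd : 0 < ‖g.den w‖ := norm_pos_iff.2 (g.den_ne_zero hw.le)
    have he : 0 < ‖g.rootInv w‖ := by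
      rw [norm_pos_iff]
      exact left_ne_zero_of_mul (right_ne_zero_of_mul_eq_one (g.den_mul_rootInv_sq hw.le))
    simp only [norm_mul, norm_one] at h4
    have h1' : (1 - ‖w‖ ^ 2) * (b * b) = 1 := by exact_mod_cast h1
    have h2' : (1 - ‖g.act w‖ ^ 2) * (a * a) = 1 := by exact_mod_cast h2
    have h3' : (1 - ‖g.act w‖ ^ 2) * ‖g.den w‖ ^ 2 = 1 - ‖w‖ ^ 2 := by exact_mod_cast h3
    have hD : (g.den w)⁻¹ * (conj (g.den w))⁻¹ = (((‖g.den w‖ ^ 2)⁻¹ : ℝ) : ℂ) := by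
      rw [← mul_inv, mul_comm, e, Complex.ofReal_inv]
    have hE : g.rootInv w * conj (g.rootInv w) = ((‖g.rootInv w‖ ^ 2 : ℝ) : ℂ) := by
      rw [mul_comm, e]
    change (g.den w)⁻¹ * (conj (g.den w))⁻¹ * invSqrt (conj (g.act w) * g.act w) =
      g.rootInv w * conj (g.rootInv w) * invSqrt (conj w * w)
    rw [hD, hE, e, e, ha', hb', ← Complex.ofReal_mul, ← Complex.ofReal_mul]
    congr 1
    have h6 : ‖g.rootInv w‖ ^ 2 = ‖g.den w‖⁻¹ := by
      rw [pow_two]; exact eq_inv_of_mul_eq_one_right h4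
    have h7 : a * a = (b * ‖g.den w‖) * (b * ‖g.den w‖) := by
      have h8 : (1 - ‖g.act w‖ ^ 2) ≠ 0 := left_ne_zero_of_mul_eq_one h2'
      apply mul_left_cancel₀ h8
      calc _ = (1 - ‖w‖ ^ 2) * (b * b) := h2'.trans h1'.symm
        _ = _ := by rw [← h3']; ring
    have h8 : a = b * ‖g.den w‖ :=
      (mul_self_inj ha.le (by positivity)).1 h7
    rw [h6, h8]
    field_simp

theorem star_rootInvOp_kernel (w : {w : ℂ // ‖w‖ < 1}) :
    star g.rootInvOp (kernel w) = conj (g.rootInv w) • kernel w := by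
  have hs : Summable fun n => ‖(star (g.ratio • shift) : HardySpace →L[ℂ] HardySpace) ^ n‖ := by
    refine g.summable_ratio_smul_shift.congr fun n => ?_
    rw [← star_pow]
    exact (norm_star _).symm
  have h1 : (star (g.ratio • shift) : HardySpace →L[ℂ] HardySpace) (kernel w) =
      (conj (g.ratio * w)) • kernel w := by
    rw [star_smul, smul_apply, star_shift_kernel, smul_smul, map_mul]; rfl
  have hq : ‖conj (g.ratio * w)‖ < 1 := by
    rw [Complex.norm_conj, norm_mul]
    exact mul_lt_one_of_nonneg_of_lt_one_left (norm_nonneg _) g.norm_ratio_lt_one w.2.le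
  rw [rootInvOp, star_smul, star_invSqrt, smul_apply,
    invSqrt_apply_of_apply_eq_smul hs hq h1, smul_smul]
  congr 1
  refine Eq.trans ?_ (map_mul conj g.rootConst _).symm
  exact congrArg (conj g.rootConst * ·) (star_invSqrt (x := g.ratio * (w : ℂ))).symm

/-- Conjugation by `hardyUnitary` multiplies the operator with kernel `(1 - z conj w)^{-1/2}` from
both sides by square roots of the denominator. -/
theorem hardyUnitary_mul_halfOp :
    g.hardyUnitary * halfOp * star g.hardyUnitary = g.rootInvOp * halfOp * star g.rootInvOp := by
  refine clm_ext_kernel fun z w => ?_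
  have key : ∀ A : HardySpace →L[ℂ] HardySpace,
      inner ℂ (kernel z) ((A * halfOp * star A) (kernel w)) =
        inner ℂ (star A (kernel z)) (halfOp (star A (kernel w))) := fun A => by
    rw [mul_apply_eq_comp, mul_apply_eq_comp, ContinuousLinearMap.star_eq_adjoint,
      ContinuousLinearMap.adjoint_inner_left]
  rw [key, key, star_hardyUnitary_kernel, star_hardyUnitary_kernel, star_rootInvOp_kernel,
    star_rootInvOp_kernel]
  have e1 : ∀ (c d : ℂ) (x y : HardySpace), inner ℂ (c • x) (halfOp (d • y)) =
      conj c * (d * inner ℂ x (halfOp y)) := fun c d x y => by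
    rw [map_smul, inner_smul_left, inner_smul_right]
  rw [e1, e1, inner_kernel, inner_kernel, eval_halfOp_kernel, eval_halfOp_kernel, map_inv₀,
    Complex.conj_conj, Complex.conj_conj, ← mul_assoc, ← mul_assoc]
  exact g.invSqrt_conj_act_mul_act z.2 w.2

end SU11

/-! ### Composition operators on the Dirichlet space -/

namespace DirichletSpace

open DiskSpace

theorem weight_zero : ((Nat.toPNat' 0 : ℕ+) : ℕ) = 1 := rfl

theorem weight_succ (n : ℕ) : ((Nat.toPNat' (n + 1) : ℕ+) : ℕ) = n + 1 := rfl

theorem summable_weight_mul_geometric {x : ℝ} (h0 : 0 ≤ x) (h1 : x < 1) :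
    Summable fun n : ℕ => ((n : ℝ) + 1) * x ^ n := by
  have h2 : Summable fun n : ℕ => (n : ℝ) ^ 1 * x ^ n :=
    summable_pow_mul_geometric_of_norm_lt_one 1 (by rwa [Real.norm_of_nonneg h0])
  refine (h2.add (summable_geometric_of_lt_one h0 h1)).congr fun n => ?_
  ring

/-- The function which represents the evaluation `f ↦ f'(w)` of the derivative. -/
def derivKernel (w : {w : ℂ // ‖w‖ < 1}) : DirichletSpace :=
  DiskSpace.mk _ (fun n => Nat.casesOn n 0 fun m => conj (w : ℂ) ^ m) (by
    rw [← summable_nat_add_iff 1]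
    have hw : ‖(w : ℂ)‖ ^ 2 < 1 := by nlinarith [w.2, norm_nonneg (w : ℂ)]
    refine (summable_weight_mul_geometric (by positivity) hw).congr fun n => ?_
    simp [← pow_mul, mul_comm])

theorem inner_derivKernel (w : {w : ℂ // ‖w‖ < 1}) (f : DirichletSpace) :
    inner ℂ (derivKernel w) f = ∑' n : ℕ, f.coeff n * (n * (w : ℂ) ^ (n - 1)) := by
  rw [← (hasSum_inner _ _).tsum_eq]
  refine tsum_congr fun n => ?_
  cases n with
  | zero => simp [derivKernel]
  | succ n => simp [derivKernel]; ring

theorem hasDerivAt_eval_inner (f : DirichletSpace) (w : {w : ℂ // ‖w‖ < 1}) :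
    HasDerivAt f.eval (inner ℂ (derivKernel w) f) w := by
  rw [inner_derivKernel]
  exact f.hasDerivAt_eval w.2

theorem inner_basis_zero (f : DirichletSpace) :
    inner ℂ (basis (fun n => n.toPNat') 0) f = f.eval 0 := by
  rw [inner_basis, weight_zero, eval_zero_right]; simp

theorem inner_derivKernel_derivKernel (z w : {w : ℂ // ‖w‖ < 1}) :
    inner ℂ (derivKernel z) (derivKernel w) * (1 - conj (w : ℂ) * z) ^ 2 = 1 := by
  have hx := SU11.norm_conj_mul_lt_one z.2 w.2
  set x := conj (w : ℂ) * z with hxdef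
  have hne : (1 : ℂ) - x ≠ 0 := by
    intro h0
    rw [← sub_eq_zero.1 h0, norm_one] at hx
    exact lt_irrefl _ hx
  have h1 : inner ℂ (derivKernel z) (derivKernel w) = x / (1 - x) ^ 2 + (1 - x)⁻¹ := by
    refine (hasSum_inner _ _).unique ?_
    rw [← hasSum_nat_add_iff' 1]
    have h2 := (hasSum_coe_mul_geometric_of_norm_lt_one hx).add (hasSum_geometric_of_norm_lt_one hx)
    rw [Finset.range_one, Finset.sum_singleton]
    have h3 : ∀ n : ℕ, (((n + 1).toPNat' : ℕ) : ℂ) * (conj ((derivKernel z).coeff (n + 1)) *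
        (derivKernel w).coeff (n + 1)) = n * x ^ n + x ^ n := fun n => by
      simp [derivKernel, hxdef, mul_pow]; ring
    have h4 : (((0 : ℕ).toPNat' : ℕ) : ℂ) * (conj ((derivKernel z).coeff 0) *
        (derivKernel w).coeff 0) = 0 := by simp [derivKernel]
    rw [h4, sub_zero]
    exact (congrArg (HasSum · (x / (1 - x) ^ 2 + (1 - x)⁻¹)) (funext h3)).mpr h2
  rw [h1]
  field_simp
  ring

theorem inner_basis_zero_derivKernel (w : {w : ℂ // ‖w‖ < 1}) :
    inner ℂ (basis (fun n => n.toPNat') 0) (derivKernel w) = 0 := by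
  rw [inner_basis_zero, eval_zero_right]; rfl

theorem eqOn_disk_of_hasDerivAt {f g : ℂ → ℂ}
    (h : ∀ z, ‖z‖ < 1 → ∃ d, HasDerivAt f d z ∧ HasDerivAt g d z) (h0 : f 0 = g 0) {z : ℂ}
    (hz : ‖z‖ < 1) : f z = g z := by
  refine Metric.isOpen_ball.eqOn_of_deriv_eq (s := Metric.ball (0 : ℂ) 1)
    (convex_ball _ _).isPreconnected (fun z hz => ?_) (fun z hz => ?_) (fun z hz => ?_)
    (Metric.mem_ball_self one_pos) h0 (mem_ball_zero_iff.2 hz)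
  all_goals obtain ⟨d, h1, h2⟩ := h z (mem_ball_zero_iff.1 hz)
  · exact h1.differentiableAt.differentiableWithinAt
  · exact h2.differentiableAt.differentiableWithinAt
  · rw [h1.deriv, h2.deriv]

end DirichletSpace

theorem SU11.hasDerivAt_act (g : SU11) {z : ℂ} (hz : ‖z‖ ≤ 1) :
    HasDerivAt g.act ((g.den z ^ 2)⁻¹) z := by
  have hd := g.den_ne_zero hz
  have h1 : HasDerivAt (fun z => g.α * z + g.β) g.α z := by
    exact (((hasDerivAt_id z).const_mul g.α).add_const g.β).congr_deriv (mul_one _)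
  have h2 : HasDerivAt g.den (conj g.β) z :=
    (((hasDerivAt_id z).const_mul (conj g.β)).add_const (conj g.α)).congr_deriv (mul_one _)
  refine (h1.div h2 hd).congr_deriv (Eq.symm ?_)
  rw [eq_div_iff (pow_ne_zero 2 hd), inv_mul_cancel₀ (pow_ne_zero 2 hd), den]
  linear_combination -g.det_eq

open DirichletSpace DiskSpace in
/-- The reduced composition operators are unitary on the Dirichlet space: their adjoints fix the
constants and permute the kernels of the derivative, up to scalars for which inner products are
preserved. -/
theorem SU11.exists_dirichletUnitary (g : SU11) :
    ∃ u ∈ unitary (DirichletSpace →L[ℂ] DirichletSpace), ∀ (f : DirichletSpace) (z : ℂ), ‖z‖ < 1 →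
      (u f).eval z = f.eval (g.act z) - f.eval (g.act 0) + f.eval 0 := by
  have hd : ∀ w : {w : ℂ // ‖w‖ < 1}, conj (g.den w) ≠ 0 := fun w =>
    (map_ne_zero _).2 (g.den_ne_zero w.2.le)
  have htot : ∀ f : DirichletSpace, inner ℂ (basis (fun n => n.toPNat') 0) f = 0 →
      (∀ w, inner ℂ (derivKernel w) f = 0) → f = 0 := fun f h0 h1 => by
    refine eval_injective fun z hz => ?_
    rw [inner_basis_zero] at h0
    have := eqOn_disk_of_hasDerivAt (f := f.eval) (g := fun _ => 0)
      (fun z hz => ⟨0, by simpa only [h1] using hasDerivAt_eval_inner f ⟨z, hz⟩,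
        hasDerivAt_const z _⟩) h0 hz
    rw [this, eval]
    simp
  obtain ⟨W, hW, hWk⟩ := exists_unitary_of_inner_eq (ι := Option {w : ℂ // ‖w‖ < 1})
    (x := fun i => i.elim (basis (fun n => n.toPNat') 0) derivKernel)
    (y := fun i => i.elim (basis (fun n => n.toPNat') 0)
      fun w => (conj (g.den w) ^ 2)⁻¹ • derivKernel (g.actDisk w))
    (fun f hf => htot f (hf none) fun w => hf (some w)) (fun f hf => by
      refine htot f (hf none) fun w => ?_
      have := hf (some (g.inv.actDisk w))
      simp only [Option.elim, inner_smul_left, mul_eq_zero] at this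
      rcases this with h | h
      · exact absurd h ((map_ne_zero _).2 (inv_ne_zero (pow_ne_zero 2 (hd _))))
      · have e : g.actDisk (g.inv.actDisk w) = w := Subtype.ext (g.act_inv_act w.2)
        rwa [e] at h)
    (by
      have h0 := fun w : {w : ℂ // ‖w‖ < 1} => inner_basis_zero_derivKernel w
      have h0' := fun w : {w : ℂ // ‖w‖ < 1} => inner_eq_zero_symm.1 (h0 w)
      rintro (_ | z) (_ | w)
      · rfl
      · simp only [Option.elim, inner_smul_right, h0, mul_zero]
      · simp only [Option.elim, inner_smul_left, h0', mul_zero]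
      · simp only [Option.elim, inner_smul_left, inner_smul_right]
        have h1 := inner_derivKernel_derivKernel z w
        have h2 := inner_derivKernel_derivKernel (g.actDisk z) (g.actDisk w)
        have h3 := g.one_sub_conj_act_mul_act z.2.le w.2.le
        have h4 := right_ne_zero_of_mul_eq_one h1
        have h5 := right_ne_zero_of_mul_eq_one h2
        have h6 := hd w
        have h7 := g.den_ne_zero z.2.le
        have h8 := hd z
        rw [eq_div_of_mul_eq h4 h1, eq_div_of_mul_eq h5 h2, ← h3]
        change _ = _ * (_ * (1 / (1 - conj (g.act w) * g.act z) ^ 2))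
        change (1 - conj (g.act w) * g.act z) ^ 2 ≠ 0 at h5
        simp only [map_inv₀, map_pow, Complex.conj_conj]
        rw [mul_pow, mul_pow]
        field_simp)
  have hadj : ∀ x f : DirichletSpace, inner ℂ x (star W f) = inner ℂ (W x) f := fun x f => by
    rw [ContinuousLinearMap.star_eq_adjoint, ContinuousLinearMap.adjoint_inner_right]
  refine ⟨star W, Unitary.star_mem hW, fun f z hz => ?_⟩
  have h0 : (star W f).eval 0 = f.eval 0 := by
    rw [← inner_basis_zero, hadj, ← inner_basis_zero f]
    exact congrArg (inner ℂ · f) (hWk none)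
  refine eqOn_disk_of_hasDerivAt (g := fun z => f.eval (g.act z) - f.eval (g.act 0) + f.eval 0)
    (fun z hz => ⟨_, hasDerivAt_eval_inner _ ⟨z, hz⟩, ?_⟩) (by simp [h0]) hz
  have h1 : inner ℂ (derivKernel ⟨z, hz⟩) (star W f) =
      inner ℂ (derivKernel (g.actDisk ⟨z, hz⟩)) f * (g.den z ^ 2)⁻¹ := by
    rw [hadj]
    refine (congrArg (inner ℂ · f) (hWk (some ⟨z, hz⟩))).trans ?_
    simp only [Option.elim, inner_smul_left, map_inv₀, map_pow, Complex.conj_conj]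
    rw [mul_comm]
  rw [h1]
  exact (((hasDerivAt_eval_inner f (g.actDisk ⟨z, hz⟩)).comp z
    (g.hasDerivAt_act hz.le)).sub_const _).add_const _

/-! ### Asymptotics of the coefficients of `(1 - x)^{-1/2}` -/

theorem invSqrtCoeff_succ_eq (n : ℕ) :
    invSqrtCoeff (n + 1) = (2 * n + 1) / (2 * n + 2) * invSqrtCoeff n := by
  have := invSqrtCoeff_succ n
  field_simp
  linarith

theorem invSqrtCoeff_sq_le (n : ℕ) : (2 * n + 1) * invSqrtCoeff n ^ 2 ≤ 1 := by
  induction n with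
  | zero => simp [invSqrtCoeff_zero]
  | succ n ih =>
    refine le_trans ?_ ih
    rw [invSqrtCoeff_succ_eq, mul_pow, ← mul_assoc]
    gcongr
    rw [div_pow, mul_div_assoc', div_le_iff₀ (by positivity)]
    push_cast
    nlinarith [(n.cast_nonneg : (0 : ℝ) ≤ n)]

/-- Although `invSqrtCoeff` decreases, it does so slowly enough for the quotients
`invSqrtCoeff n / invSqrtCoeff (n + m)` to be bounded uniformly in `n`. -/
theorem monotone_succ_mul_invSqrtCoeff : Monotone fun n : ℕ => ((n : ℝ) + 1) * invSqrtCoeff n := by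
  refine monotone_nat_of_le_succ fun n => ?_
  rw [invSqrtCoeff_succ_eq, ← mul_assoc]
  have := (invSqrtCoeff_pos n).le
  gcongr
  rw [mul_div_assoc', le_div_iff₀ (by positivity)]
  push_cast
  nlinarith [(n.cast_nonneg : (0 : ℝ) ≤ n)]

theorem invSqrtCoeff_div_le (m n : ℕ) : |invSqrtCoeff n / invSqrtCoeff (n + m)| ≤ m + 1 := by
  have h1 := invSqrtCoeff_pos n
  have h2 := invSqrtCoeff_pos (n + m)
  have h := monotone_succ_mul_invSqrtCoeff (Nat.le_add_right n m)
  have hn := (n.cast_nonneg : (0 : ℝ) ≤ n)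
  have hm := (m.cast_nonneg : (0 : ℝ) ≤ m)
  simp only at h
  push_cast at h
  rw [abs_of_pos (div_pos h1 h2), div_le_iff₀ h2]
  have h3 : ((n : ℝ) + m + 1) ≤ (m + 1) * (n + 1) := by nlinarith
  have h4 := mul_le_mul_of_nonneg_right h3 h2.le
  have : ((n : ℝ) + 1) * invSqrtCoeff n ≤ (n + 1) * ((m + 1) * invSqrtCoeff (n + m)) := by linarith
  exact le_of_mul_le_mul_left this (by positivity)

theorem tendsto_invSqrtCoeff_div :
    Tendsto (fun n => invSqrtCoeff n / invSqrtCoeff (n + 1)) atTop (𝓝 1) := by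
  have h : Tendsto (fun n : ℕ => 1 + 1 / (2 : ℝ) * ((n : ℝ) + 1 / 2)⁻¹) atTop
      (𝓝 (1 + 1 / 2 * 0)) := by
    refine tendsto_const_nhds.add (Tendsto.const_mul _ ?_)
    exact (tendsto_atTop_add_const_right _ _ tendsto_natCast_atTop_atTop).inv_tendsto_atTop
  rw [mul_zero, add_zero] at h
  refine h.congr fun n => ?_
  have h1 := invSqrtCoeff_pos n
  rw [invSqrtCoeff_succ_eq]
  field_simp
  ring

/-- The weights of the Dirichlet space are asymptotic to a multiple of `1 / invSqrtCoeff n ^ 2`. The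
value of the limit does not matter, only that it is not `0`. -/
theorem exists_tendsto_weight_mul_invSqrtCoeff_sq :
    ∃ c > 0, Tendsto (fun n : ℕ => ((n.toPNat' : ℕ) : ℝ) * invSqrtCoeff n ^ 2) atTop (𝓝 c) := by
  set a : ℕ → ℝ := fun n => ((n : ℝ) + 1) * invSqrtCoeff (n + 1) ^ 2 with ha
  have hmono : Monotone a := by
    refine monotone_nat_of_le_succ fun n => ?_
    simp only [ha]
    rw [invSqrtCoeff_succ_eq (n + 1), mul_pow, ← mul_assoc]
    gcongr
    rw [div_pow, mul_div_assoc', le_div_iff₀ (by positivity)]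
    push_cast
    nlinarith [(n.cast_nonneg : (0 : ℝ) ≤ n)]
  have hbdd : BddAbove (Set.range a) := by
    refine ⟨1, ?_⟩
    rintro _ ⟨n, rfl⟩
    have h1 := invSqrtCoeff_sq_le (n + 1)
    have h2 : 0 ≤ ((n : ℝ) + 1) * invSqrtCoeff (n + 1) ^ 2 := by positivity
    have h3 := sq_nonneg (invSqrtCoeff (n + 1))
    push_cast at h1
    simp only [ha]
    nlinarith
  have h := tendsto_atTop_ciSup hmono hbdd
  refine ⟨_, lt_of_lt_of_le ?_ (le_ciSup hbdd 0), (tendsto_add_atTop_iff_nat 1).1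
    (h.congr fun n => by simp [ha])⟩
  have := invSqrtCoeff_pos 1
  simp only [ha]
  positivity

/-! ### Comparison of the Hardy and the Dirichlet space -/

namespace HardySpace

open DiskSpace

theorem abs_le_of_tendsto {d : ℕ → ℝ} {c : ℝ} (h : Tendsto d atTop (𝓝 c)) :
    ∃ C, ∀ n, |d n| ≤ C := by
  obtain ⟨C, hC⟩ := (h.abs).bddAbove_range
  exact ⟨C, fun n => hC ⟨n, rfl⟩⟩

/-- A diagonal operator whose entries tend to `c` is a compact perturbation of `c`. -/
theorem essRep_diagonal {d : ℕ → ℝ} (hd : ∃ C, ∀ n, |d n| ≤ C) {c : ℝ}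
    (h : Tendsto d atTop (𝓝 c)) : essRep HardySpace (diagonal d hd) = (c : ℂ) • 1 := by
  have h1 : Tendsto (fun n => d n - c) atTop (𝓝 0) := by simpa using h.sub_const c
  have h2 : diagonal d hd = diagonal (fun n => d n - c) (abs_le_of_tendsto h1) + (c : ℂ) • 1 :=
    clm_ext fun f n => by
      change (d n : ℂ) * f.coeff n = ((d n - c : ℝ) : ℂ) * f.coeff n + (c : ℂ) * f.coeff n
      push_cast; ring
  rw [h2, map_add, essRep_eq_zero (isCompactOperator_diagonal _ h1), zero_add, map_smul, map_one]

theorem diagonal_mul_shift (d : ℕ → ℝ) (hd : ∃ C, ∀ n, |d n| ≤ C)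
    (hd' : ∃ C, ∀ n, |d (n + 1)| ≤ C) :
    diagonal d hd * shift = shift * diagonal (fun n => d (n + 1)) hd' := by
  refine clm_ext fun f n => ?_
  rw [mul_apply_eq_comp, mul_apply_eq_comp]
  cases n <;> simp

/-- The weighted shift which `halfOp` intertwines with the shift. -/
def halfShift : HardySpace →L[ℂ] HardySpace :=
  shift * diagonal (fun n => invSqrtCoeff n / invSqrtCoeff (n + 1)) ⟨_, invSqrtCoeff_div_le 1⟩

theorem halfOp_mul_halfShift : halfOp * halfShift = shift * halfOp := by
  refine clm_ext fun f n => ?_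
  simp only [halfOp, halfShift, mul_apply_eq_comp]
  cases n with
  | zero => simp
  | succ n =>
    have h : (invSqrtCoeff (n + 1) : ℂ) ≠ 0 := by exact_mod_cast (invSqrtCoeff_pos _).ne'
    simp only [coeff_diagonal, coeff_shift_succ]
    push_cast
    field_simp

theorem halfShift_pow (m : ℕ) : halfShift ^ m = shift ^ m *
    diagonal (fun n => invSqrtCoeff n / invSqrtCoeff (n + m)) ⟨_, invSqrtCoeff_div_le m⟩ := by
  induction m with
  | zero =>
    rw [pow_zero, pow_zero, one_mul]
    refine clm_ext fun f n => ?_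
    simp [div_self (invSqrtCoeff_pos n).ne']
  | succ m ih =>
    rw [pow_succ, ih, halfShift, ← mul_assoc, mul_assoc (shift ^ m),
      diagonal_mul_shift _ _ ⟨_, fun n => invSqrtCoeff_div_le m (n + 1)⟩, ← mul_assoc, ← pow_succ,
      mul_assoc]
    congr 1
    refine clm_ext fun f n => ?_
    rw [mul_apply_eq_comp, coeff_diagonal, coeff_diagonal, coeff_diagonal, ← mul_assoc,
      ← Complex.ofReal_mul, show n + 1 + m = n + (m + 1) by omega]
    congr 2
    have h1 := (invSqrtCoeff_pos (n + 1)).ne'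
    have h2 := (invSqrtCoeff_pos (n + (m + 1))).ne'
    field_simp

theorem norm_halfShift_pow_le (m : ℕ) : ‖halfShift ^ m‖ ≤ m + 1 := by
  rw [halfShift_pow]
  refine (norm_mul_le _ _).trans ?_
  refine (mul_le_mul ?_ (norm_diagonal_le _ (invSqrtCoeff_div_le m)) (norm_nonneg _)
    zero_le_one).trans (one_mul _).le
  cases m with
  | zero => exact ContinuousLinearMap.norm_id_le
  | succ m => exact (norm_pow_le' _ m.succ_pos).trans (pow_le_one₀ (norm_nonneg _) norm_shift_le)

theorem essRep_halfShift : essRep HardySpace halfShift = essRep HardySpace shift := by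
  rw [halfShift, map_mul, essRep_diagonal _ tendsto_invSqrtCoeff_div, Complex.ofReal_one, one_smul,
    mul_one]

theorem halfOp_injective : Function.Injective halfOp := fun f g h => DiskSpace.ext fun n => by
  have h1 := congrArg (fun f => DiskSpace.coeff f n) h
  have h2 : (invSqrtCoeff n : ℂ) ≠ 0 := by exact_mod_cast (invSqrtCoeff_pos _).ne'
  exact mul_left_cancel₀ h2 h1

theorem halfOp_mul_constProj : halfOp * constProj = constProj := by
  refine clm_ext fun f n => ?_
  rw [mul_apply_eq_comp, halfOp, coeff_diagonal, coeff_constProj]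
  split_ifs with h
  · simp [h, invSqrtCoeff_zero]
  · simp

/-- The unitary between the Hardy and the Dirichlet space which matches the normalized monomials. -/
def toDirichlet : HardySpace ≃ₗᵢ[ℂ] DirichletSpace :=
  (toL2Isometry _).trans (toL2Isometry _).symm

theorem coeff_toDirichlet (f : HardySpace) (n : ℕ) :
    (toDirichlet f).coeff n = (Real.sqrt (n.toPNat' : ℕ) : ℂ)⁻¹ * f.coeff n := by
  change (Real.sqrt (n.toPNat' : ℕ) : ℂ)⁻¹ * ((Real.sqrt ((1 : ℕ+) : ℕ) : ℂ) * f.coeff n) = _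
  simp

theorem sqrt_weight_ne_zero (n : ℕ) : (Real.sqrt (n.toPNat' : ℕ) : ℂ) ≠ 0 :=
  Complex.ofReal_ne_zero.2 (Real.sqrt_pos.2 (Nat.cast_pos.2 n.toPNat'.pos)).ne'

theorem coeff_toDirichlet_symm (f : DirichletSpace) (n : ℕ) :
    (toDirichlet.symm f).coeff n = (Real.sqrt (n.toPNat' : ℕ) : ℂ) * f.coeff n := by
  have h := coeff_toDirichlet (toDirichlet.symm f) n
  have h1 : (Real.sqrt (n.toPNat' : ℕ) : ℂ) ≠ 0 := sqrt_weight_ne_zero n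
  rw [LinearIsometryEquiv.apply_symm_apply] at h
  rw [h, mul_inv_cancel_left₀ h1]

end HardySpace

/-! ### The operators attached to an automorphism of the disk -/

namespace DiskAut

open DiskSpace

/-- A matrix in `SU(1,1)` which represents the automorphism. -/
def mat (γ : DiskAut) : SU11 where
  α := γ.2.choose
  β := γ.2.choose_spec.choose
  det := γ.2.choose_spec.choose_spec.1

theorem coe_apply (γ : DiskAut) (z : ClosedDisk) :
    ((γ : ClosedDisk ≃ₜ ClosedDisk) z : ℂ) = (mat γ).act z :=
  γ.2.choose_spec.choose_spec.2 z

theorem coe_apply_origin (γ : DiskAut) :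
    ((γ : ClosedDisk ≃ₜ ClosedDisk) diskOrigin : ℂ) = (mat γ).act 0 := coe_apply γ diskOrigin

/-- The unitary operator `f ↦ f ∘ γ - f(γ(0)) + f(0)` on the Dirichlet space. -/
def reduced (γ : DiskAut) : DirichletSpace →L[ℂ] DirichletSpace :=
  (mat γ).exists_dirichletUnitary.choose

theorem reduced_mem (γ : DiskAut) : (reduced γ) ∈ unitary (DirichletSpace →L[ℂ] DirichletSpace) :=
  (mat γ).exists_dirichletUnitary.choose_spec.1

theorem eval_reduced (γ : DiskAut) (f : DirichletSpace) {z : ℂ} (hz : ‖z‖ < 1) :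
    (reduced γ f).eval z = f.eval ((mat γ).act z) - f.eval ((mat γ).act 0) + f.eval 0 :=
  (mat γ).exists_dirichletUnitary.choose_spec.2 f z hz

theorem isReducedComposition_reduced (γ : DiskAut) : IsReducedComposition γ (reduced γ) := by
  intro f z hz
  rw [(eval_reduced γ) f hz, coe_apply, coe_apply_origin]

theorem _root_.DiskSpace.IsReducedComposition.unique {w : ℕ → ℕ+} {γ : DiskAut}
    {u u' : DiskSpace w →L[ℂ] DiskSpace w} (h : IsReducedComposition γ u)
    (h' : IsReducedComposition γ u') : u = u' :=
  ContinuousLinearMap.ext fun f => eval_injective fun z hz => by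
    rw [h f ⟨z, mem_closedBall_zero_iff.2 hz.le⟩ hz, h' f ⟨z, mem_closedBall_zero_iff.2 hz.le⟩ hz]

theorem _root_.DiskSpace.IsComposition.unique {w : ℕ → ℕ+} {γ : DiskAut}
    {C C' : DiskSpace w →L[ℂ] DiskSpace w} (h : IsComposition γ C) (h' : IsComposition γ C') :
    C = C' :=
  ContinuousLinearMap.ext fun f => eval_injective fun z hz => by
    rw [h f ⟨z, mem_closedBall_zero_iff.2 hz.le⟩ hz, h' f ⟨z, mem_closedBall_zero_iff.2 hz.le⟩ hz]

theorem isComposition_compOp (γ : DiskAut) : IsComposition γ (mat γ).compOp := by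
  intro f z hz
  rw [(mat γ).eval_compOp f hz, coe_apply]

theorem mat_act_mul (γ η : DiskAut) {z : ℂ} (hz : ‖z‖ < 1) :
    (mat (γ * η)).act z = (mat γ).act ((mat η).act z) := by
  have h := (coe_apply (γ * η)) ⟨z, mem_closedBall_zero_iff.2 hz.le⟩
  rw [← h, ← (coe_apply η) ⟨z, mem_closedBall_zero_iff.2 hz.le⟩, ← (coe_apply γ)]
  rfl

theorem mat_act_one (z : ℂ) (hz : ‖z‖ < 1) : (mat (1 : DiskAut)).act z = z :=
  (coe_apply (1 : DiskAut) ⟨z, mem_closedBall_zero_iff.2 hz.le⟩).symm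

theorem reduced_one : reduced 1 = 1 :=
  ContinuousLinearMap.ext fun f => eval_injective fun z hz => by
    rw [eval_reduced _ _ hz, mat_act_one _ hz, mat_act_one 0 (by simp)]
    simp

theorem reduced_mul (γ η : DiskAut) : reduced (γ * η) = reduced η * reduced γ :=
  ContinuousLinearMap.ext fun f => eval_injective fun z hz => by
    have h0 : ‖(0 : ℂ)‖ < 1 := by simp
    rw [mul_apply_eq_comp, eval_reduced _ _ hz, eval_reduced _ _ hz,
      eval_reduced _ _ ((mat η).norm_act_lt_one hz), eval_reduced _ _ ((mat η).norm_act_lt_one h0),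
      eval_reduced _ _ h0, mat_act_mul _ _ hz, mat_act_mul _ _ h0]
    ring

/-- The reduced composition operator, transported to the Hardy space. -/
def transplant (γ : DiskAut) : HardySpace →L[ℂ] HardySpace :=
  HardySpace.toDirichlet.conjStarAlgEquiv.symm (reduced γ)

theorem transplant_mem (γ : DiskAut) : (transplant γ) ∈ unitary (HardySpace →L[ℂ] HardySpace) :=
  Unitary.map_mem HardySpace.toDirichlet.conjStarAlgEquiv.symm (reduced_mem γ)

theorem transplant_one : transplant 1 = 1 := by rw [transplant, reduced_one, map_one]

theorem transplant_mul (γ η : DiskAut) : transplant (γ * η) = transplant η * transplant γ := by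
  rw [transplant, reduced_mul, map_mul]; rfl

end DiskAut

namespace HardySpace

open DiskSpace

/-- The diagonal operator which maps the monomials, the orthonormal basis of the Hardy space, to the
normalized monomials of the Dirichlet space: `toDirichlet`, followed by the inclusion of the Dirichlet
space into the Hardy space. -/
def weightOp : HardySpace →L[ℂ] HardySpace :=
  diagonal (fun n => (Real.sqrt (n.toPNat' : ℕ))⁻¹) ⟨1, fun n => by
    rw [abs_of_nonneg (by positivity)]
    refine inv_le_one_of_one_le₀ (Real.one_le_sqrt.2 ?_)
    exact_mod_cast n.toPNat'.pos⟩

theorem eval_toDirichlet (f : HardySpace) (z : ℂ) : (toDirichlet f).eval z = (weightOp f).eval z :=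
  tsum_congr fun n => by rw [coeff_toDirichlet, weightOp, coeff_diagonal, Complex.ofReal_inv]

/-- The entries of `weightOp` and `halfOp` are asymptotically proportional, so that their quotient is a
compact perturbation of a nonzero scalar. -/
theorem exists_weightOp_eq : ∃ (D : HardySpace →L[ℂ] HardySpace) (c : ℂ), c ≠ 0 ∧
    weightOp = halfOp * D ∧ essRep HardySpace D = c • 1 := by
  obtain ⟨c, hc, h⟩ := exists_tendsto_weight_mul_invSqrtCoeff_sq
  have h1 := (((Real.continuous_sqrt.tendsto c).comp h).inv₀ (Real.sqrt_pos.2 hc).ne')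
  have h2 : Tendsto (fun n : ℕ => (Real.sqrt (n.toPNat' : ℕ))⁻¹ * (invSqrtCoeff n)⁻¹) atTop
      (𝓝 (Real.sqrt c)⁻¹) := by
    refine h1.congr fun n => ?_
    rw [Function.comp_apply, Real.sqrt_mul (Nat.cast_nonneg _),
      Real.sqrt_sq (invSqrtCoeff_pos n).le, mul_inv]
  refine ⟨diagonal _ (abs_le_of_tendsto h2), ((Real.sqrt c)⁻¹ : ℝ),
    Complex.ofReal_ne_zero.2 (inv_pos.2 (Real.sqrt_pos.2 hc)).ne', clm_ext fun f n => ?_,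
    essRep_diagonal _ h2⟩
  have h3 : (invSqrtCoeff n : ℂ) ≠ 0 := by exact_mod_cast (invSqrtCoeff_pos _).ne'
  rw [weightOp, halfOp, mul_apply_eq_comp, coeff_diagonal, coeff_diagonal, coeff_diagonal]
  push_cast
  field_simp

end HardySpace

open HardySpace DiskSpace in
/-- Up to the factor `weightOp`, the transplanted operator is the composition operator modulo
functions with values in the constants. -/
theorem DiskAut.constProj_mul_weightOp_mul_transplant_sub (γ : DiskAut) :
    constProj * (weightOp * (DiskAut.transplant γ) - (DiskAut.mat γ).compOp * weightOp) =
      weightOp * (DiskAut.transplant γ) - (DiskAut.mat γ).compOp * weightOp := by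
  refine clm_ext fun f n => ?_
  rw [mul_apply_eq_comp, coeff_constProj]
  split_ifs with h
  · rw [h]
  set k : ℂ := (toDirichlet f).eval 0 - (toDirichlet f).eval ((DiskAut.mat γ).act 0) with hk
  have h1 : weightOp (DiskAut.transplant γ f) =
      (DiskAut.mat γ).compOp (weightOp f) + k • basis (fun _ => 1) 0 := by
    refine eval_injective fun z hz => ?_
    have hb : (basis (fun _ => 1) 0 : HardySpace).eval z = 1 := by
      rw [eval, tsum_eq_single 0 fun n hn => by simp [coeff_basis, hn.symm]]
      simp [coeff_basis]
    have hX : toDirichlet (DiskAut.transplant γ f) = DiskAut.reduced γ (toDirichlet f) :=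
      LinearIsometryEquiv.apply_symm_apply _ _
    rw [eval_add _ _ hz, eval_smul, hb, ← eval_toDirichlet, hX, (DiskAut.eval_reduced γ) _ hz,
      (DiskAut.mat γ).eval_compOp _ hz, eval_toDirichlet f ((DiskAut.mat γ).act z), hk]
    ring
  change 0 = (weightOp (DiskAut.transplant γ f) - (DiskAut.mat γ).compOp (weightOp f)).coeff n
  rw [h1, add_sub_cancel_left, coeff_smul, coeff_basis, if_neg (Ne.symm h), mul_zero]

namespace SU11

open HardySpace DiskSpace

variable (g : SU11)

/-- The counterpart of `rootInvOp` which `halfOp` intertwines with it. -/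
def halfRootInvOp : HardySpace →L[ℂ] HardySpace := g.rootConst • invSqrt (g.ratio • halfShift)

theorem summable_ratio_smul_halfShift : Summable fun n => ‖(g.ratio • halfShift) ^ n‖ := by
  have := DirichletSpace.summable_weight_mul_geometric (norm_nonneg _) g.norm_ratio_lt_one
  refine this.of_nonneg_of_le (fun n => norm_nonneg _) fun n => ?_
  rw [smul_pow, norm_smul, norm_pow, mul_comm]
  exact mul_le_mul_of_nonneg_right (norm_halfShift_pow_le n) (by positivity)

theorem halfOp_mul_halfRootInvOp : halfOp * g.halfRootInvOp = g.rootInvOp * halfOp := by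
  have h1 := (hasSum_invSqrt g.summable_ratio_smul_halfShift).mul_left halfOp
  have h2 := (hasSum_invSqrt g.summable_ratio_smul_shift).mul_right halfOp
  have h3 : ∀ n : ℕ, halfOp * (g.ratio • halfShift) ^ n = (g.ratio • shift) ^ n * halfOp := by
    intro n
    have : SemiconjBy halfOp (g.ratio • halfShift) (g.ratio • shift) := by
      rw [SemiconjBy, mul_smul_comm, smul_mul_assoc, halfOp_mul_halfShift]
    exact this.pow_right n
  rw [halfRootInvOp, rootInvOp, mul_smul_comm, smul_mul_assoc]
  congr 1
  refine h1.unique ?_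
  refine (congrArg (HasSum · (invSqrt (g.ratio • shift) * halfOp)) (funext fun n => ?_)).mp h2
  rw [mul_smul_comm, smul_mul_assoc, h3]

theorem essRep_halfRootInvOp :
    essRep HardySpace g.halfRootInvOp = essRep HardySpace g.rootInvOp := by
  have hc := StarAlgHom.continuous_of_cstarAlgebra (essRep HardySpace)
  rw [halfRootInvOp, rootInvOp, map_smul, map_smul,
    map_invSqrt (essRep HardySpace) hc g.summable_ratio_smul_halfShift,
    map_invSqrt (essRep HardySpace) hc g.summable_ratio_smul_shift, map_smul, map_smul,
    essRep_halfShift]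

theorem commute_rootInvOp_denOp : Commute g.rootInvOp g.denOp := by
  have h : Commute g.denOp (g.ratio • shift) := by
    refine Commute.smul_right ?_ _
    exact ((Commute.refl _).smul_left _).add_left ((Commute.one_left _).smul_left _)
  exact ((h.invSqrt_right g.summable_ratio_smul_shift).smul_right _).symm

end SU11

open HardySpace DiskSpace in
/-- Modulo compact operators, the transplanted unitary is `E⁻¹ E* V`, where `E` is multiplication by
the inverse square root of the denominator and `V` the unitary `hardyUnitary`. -/
theorem DiskAut.essRep_rootInvOp_mul_transplant (γ : DiskAut) :
    essRep HardySpace (DiskAut.mat γ).rootInvOp * essRep HardySpace (DiskAut.transplant γ) =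
      star (essRep HardySpace (DiskAut.mat γ).rootInvOp) *
        essRep HardySpace (DiskAut.mat γ).hardyUnitary := by
  obtain ⟨D, c, hc, hD, hDc⟩ := exists_weightOp_eq
  set E := (DiskAut.mat γ).rootInvOp with hE
  set E' := (DiskAut.mat γ).halfRootInvOp with hE'
  set V := (DiskAut.mat γ).hardyUnitary with hV
  set X := DiskAut.transplant γ with hX
  set R := halfOp with hR
  set J := (DiskAut.mat γ).denOp with hJ
  have hVV : star V * V = 1 := (Unitary.mem_iff.1 (DiskAut.mat γ).hardyUnitary_mem).1
  have hRE : R * E' = E * R := (DiskAut.mat γ).halfOp_mul_halfRootInvOp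
  have hEJE : E * J * E = 1 := by
    rw [(DiskAut.mat γ).commute_rootInvOp_denOp.eq, mul_assoc]
    exact (DiskAut.mat γ).denOp_mul_rootInvOp_sq
  -- The composition operator `J V` is turned by `E` and `R` into `E* V`.
  have hVR : E * J * V * R = R * star E * V := by
    have h1 : V * R = E * R * star E * V := by
      have h0 : V * R * star V = E * R * star E := (DiskAut.mat γ).hardyUnitary_mul_halfOp
      rw [← h0, mul_assoc, hVV, mul_one]
    calc E * J * V * R = E * J * (V * R) := mul_assoc _ _ _
      _ = (E * J * E) * (R * star E * V) := by rw [h1]; simp only [mul_assoc]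
      _ = R * star E * V := by rw [hEJE, one_mul]
  have hp := (DiskAut.constProj_mul_weightOp_mul_transplant_sub γ)
  rw [hD] at hp
  have hkey : R * (E' * D * X - star E * V * D) =
      R * (E' * constProj * (R * D * X - (DiskAut.mat γ).compOp * (R * D))) := by
    calc R * (E' * D * X - star E * V * D) = R * E' * D * X - R * star E * V * D := by
          simp only [mul_sub, mul_assoc]
      _ = E * (R * D * X - (DiskAut.mat γ).compOp * (R * D)) := by
          rw [hRE, ← hVR, SU11.compOp]; simp only [mul_sub, mul_assoc]; rfl
      _ = E * (R * constProj * (R * D * X - (DiskAut.mat γ).compOp * (R * D))) := by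
          rw [halfOp_mul_constProj, hp]
      _ = R * (E' * constProj * (R * D * X - (DiskAut.mat γ).compOp * (R * D))) := by
          simp only [← mul_assoc, hRE]
  -- `R` is injective, so the factor `R` on the left can be cancelled before compact operators are
  -- neglected; it is itself compact.
  have hinj : E' * D * X - star E * V * D =
      E' * constProj * (R * D * X - (DiskAut.mat γ).compOp * (R * D)) :=
    ContinuousLinearMap.ext fun f => halfOp_injective (congrArg (fun T => T f) hkey)
  have h := congrArg (essRep HardySpace) hinj
  rw [map_mul, map_mul, essRep_eq_zero isCompactOperator_constProj, mul_zero, zero_mul, map_sub,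
    sub_eq_zero, map_mul, map_mul, map_mul, map_mul, map_star, hDc,
    (DiskAut.mat γ).essRep_halfRootInvOp, mul_smul_comm, mul_smul_comm, mul_one, mul_one,
    smul_mul_assoc] at h
  exact smul_right_injective _ hc h

/-! ### Multiplication by `z` on the Dirichlet space -/

namespace DirichletSpace

open HardySpace DiskSpace

theorem tendsto_sqrt_weight : Tendsto
    (fun n : ℕ => Real.sqrt ((n + 1) / (n.toPNat' : ℕ))) atTop (𝓝 1) := by
  have h : Tendsto (fun n : ℕ => Real.sqrt (1 + (n : ℝ)⁻¹)) atTop (𝓝 (Real.sqrt (1 + 0))) :=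
    (Real.continuous_sqrt.tendsto _).comp
      (tendsto_const_nhds.add tendsto_inv_atTop_nhds_zero_nat)
  rw [add_zero, Real.sqrt_one] at h
  refine h.congr' ?_
  filter_upwards [eventually_gt_atTop 0] with n hn
  rw [Nat.toPNat'_coe, if_pos hn]
  have : (n : ℝ) ≠ 0 := by positivity
  congr 1
  field_simp

/-- Multiplication by `z` on the Dirichlet space, transported to the Hardy space. -/
def transplantedShift : HardySpace →L[ℂ] HardySpace :=
  shift * diagonal _ (abs_le_of_tendsto tendsto_sqrt_weight)

theorem essRep_transplantedShift :
    essRep HardySpace transplantedShift = essRep HardySpace shift := by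
  rw [transplantedShift, map_mul, essRep_diagonal _ tendsto_sqrt_weight, Complex.ofReal_one,
    one_smul, mul_one]

theorem isMulZ_conj_transplantedShift :
    IsMulZ (toDirichlet.conjStarAlgEquiv transplantedShift) := by
  intro f z hz
  set M := toDirichlet.conjStarAlgEquiv transplantedShift with hM
  have h0 : (M f).coeff 0 = 0 := by
    rw [hM, LinearIsometryEquiv.conjStarAlgEquiv_apply_apply, coeff_toDirichlet]
    simp [transplantedShift]
  have h1 : ∀ n, (M f).coeff (n + 1) = f.coeff n := fun n => by
    rw [hM, LinearIsometryEquiv.conjStarAlgEquiv_apply_apply, coeff_toDirichlet,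
      transplantedShift, mul_apply_eq_comp, coeff_shift_succ, coeff_diagonal,
      coeff_toDirichlet_symm, weight_succ, Real.sqrt_div' _ (Nat.cast_nonneg _)]
    have h2 := sqrt_weight_ne_zero n
    have h3 : (Real.sqrt ((n + 1 : ℕ) : ℝ) : ℂ) ≠ 0 :=
      Complex.ofReal_ne_zero.2 (Real.sqrt_pos.2 (Nat.cast_pos.2 n.succ_pos)).ne'
    push_cast at h3 ⊢
    field_simp
  have h := (hasSum_nat_add_iff' 1).2 ((M f).hasSum_eval hz)
  simp only [h1, Finset.range_one, Finset.sum_singleton, h0, zero_mul, sub_zero] at h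
  refine h.unique ?_
  simpa [pow_succ', mul_left_comm] using (f.hasSum_eval hz).mul_left z

end DirichletSpace

/-! ### Homomorphisms on the crossed product -/

section CrossedProduct

variable {Γ : Subgroup DiskAut}

set_option maxHeartbeats 1000000 in
set_option synthInstance.maxHeartbeats 400000 in
instance : CStarAlgebra (RepProduct Γ) :=
  { (lp.inftyNormedRing : NormedRing (RepProduct Γ)), (inferInstance : CStarRing (RepProduct Γ)),
    (inferInstance : CompleteSpace (RepProduct Γ)), (lp.inftyStarRing : StarRing (RepProduct Γ)),
    (lp.inftyNormedAlgebra : NormedAlgebra ℂ (RepProduct Γ)) with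
    star_smul := fun c x => by
      ext i : 2
      simp only [lp.coeFn_smul, lp.coeFn_star, Pi.smul_apply, Pi.star_apply, star_smul] }

instance : CStarAlgebra (crossedProduct Γ) :=
  have : IsClosed (crossedProduct Γ : Set (RepProduct Γ)) :=
    StarSubalgebra.isClosed_topologicalClosure _
  inferInstance

/-- The component of the universal covariant representation at a given covariant representation. -/
def RepProduct.proj (i : CovariantRep Γ) : RepProduct Γ →⋆ₐ[ℂ] (i.H →L[ℂ] i.H) where
  toFun a := a.1 i
  map_one' := rfl
  map_mul' _ _ := rfl
  map_zero' := rfl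
  map_add' _ _ := rfl
  commutes' _ := rfl
  map_star' _ := rfl

/-- `univFun` as a homomorphism. -/
def univFunHom (Γ : Subgroup DiskAut) : C(Circle, ℂ) →⋆ₐ[ℂ] RepProduct Γ where
  toFun := univFun Γ
  map_one' := Subtype.ext (funext fun i => map_one i.rep)
  map_mul' a b := Subtype.ext (funext fun i => map_mul i.rep a b)
  map_zero' := Subtype.ext (funext fun i => map_zero i.rep)
  map_add' a b := Subtype.ext (funext fun i => map_add i.rep a b)
  commutes' r := Subtype.ext (funext fun i => AlgHomClass.commutes i.rep r)
  map_star' a := Subtype.ext (funext fun i => map_star i.rep a)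

/-- `crossedProduct.ofFun` as a homomorphism. -/
def crossedProduct.ofFunHom (Γ : Subgroup DiskAut) : C(Circle, ℂ) →⋆ₐ[ℂ] crossedProduct Γ :=
  (univFunHom Γ).codRestrict _ fun f => (crossedProduct.ofFun Γ f).2

/-- Homomorphisms on the crossed product are determined by the generators. -/
theorem crossedProduct.hom_ext {B : Type*} [CStarAlgebra B] {φ ψ : crossedProduct Γ →⋆ₐ[ℂ] B}
    (hz : φ (ofFun Γ circleZ) = ψ (ofFun Γ circleZ))
    (hγ : ∀ γ, φ (ofGroup Γ γ) = ψ (ofGroup Γ γ)) : φ = ψ := by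
  have hf : φ.comp (ofFunHom Γ) = ψ.comp (ofFunHom Γ) := starAlgHom_circle_ext hz
  refine StarAlgHom.ext_topologicalClosure (StarAlgHom.continuous_of_cstarAlgebra φ)
    (StarAlgHom.continuous_of_cstarAlgebra ψ) ?_
  refine StarAlgHom.ext_adjoin fun x hx => ?_
  rcases hx with ⟨f, hf'⟩ | ⟨γ, hγ'⟩
  · have hx : StarSubalgebra.inclusion (StarSubalgebra.le_topologicalClosure _) x =
        ofFun Γ f := Subtype.ext hf'.symm
    exact (congrArg φ hx).trans ((DFunLike.congr_fun hf f).trans (congrArg ψ hx).symm)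
  · have hx : StarSubalgebra.inclusion (StarSubalgebra.le_topologicalClosure _) x =
        ofGroup Γ γ := Subtype.ext hγ'.symm
    exact (congrArg φ hx).trans ((hγ γ).trans (congrArg ψ hx).symm)

/-- A covariant pair with values in a product of operator algebras defines a homomorphism on the
crossed product, whose range lies in every closed subalgebra which contains the pair. -/
theorem crossedProduct.exists_hom {ι : Type*} {K : ι → Type} [∀ i, NormedAddCommGroup (K i)]
    [∀ i, InnerProductSpace ℂ (K i)] [∀ i, CompleteSpace (K i)] [∀ i, Nontrivial (K i)]
    (ρ : C(Circle, ℂ) →⋆ₐ[ℂ] OpProduct K) (u : Γ →* unitary (OpProduct K))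
    (h : ∀ (γ : Γ) (f : C(Circle, ℂ)), (u γ : OpProduct K) * ρ f * star (u γ : OpProduct K) =
      ρ (f.comp (DiskAut.boundary (γ : DiskAut)⁻¹))) :
    ∃ φ : crossedProduct Γ →⋆ₐ[ℂ] OpProduct K, (∀ f, φ (ofFun Γ f) = ρ f) ∧
      (∀ γ, φ (ofGroup Γ γ) = u γ) ∧
      ∀ S : StarSubalgebra ℂ (OpProduct K), IsClosed (S : Set (OpProduct K)) → (∀ f, ρ f ∈ S) →
        (∀ γ, (u γ : OpProduct K) ∈ S) → ∀ a, φ a ∈ S := by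
  let v (i : ι) : Γ →* unitary (K i →L[ℂ] K i) :=
    { toFun := fun γ => ⟨OpProduct.proj i (u γ), Unitary.map_mem (OpProduct.proj i) (u γ).2⟩
      map_one' := Subtype.ext (by simp only [map_one, OneMemClass.coe_one])
      map_mul' := fun γ η => Subtype.ext (by simp only [map_mul, Submonoid.coe_mul]) }
  have hv : ∀ i (γ : Γ) (f : C(Circle, ℂ)),
      (v i γ : K i →L[ℂ] K i) * OpProduct.proj i (ρ f) * star (v i γ : K i →L[ℂ] K i) =
        OpProduct.proj i (ρ (f.comp (DiskAut.boundary (γ : DiskAut)⁻¹))) := fun i γ f => by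
    rw [← h γ f, map_mul, map_mul, map_star]
    rfl
  let r : ι → CovariantRep Γ := fun i =>
    { H := K i
      rep := (OpProduct.proj i).comp ρ
      u := v i
      covariant := hv i }
  let φ : RepProduct Γ →⋆ₐ[ℂ] OpProduct K := OpProduct.ofFamily fun i => RepProduct.proj (r i)
  have hf : ∀ f, φ (univFun Γ f) = ρ f := fun f => OpProduct.ext fun i => rfl
  have hg : ∀ γ, φ (univGroup Γ γ) = u γ := fun γ => OpProduct.ext fun i => rfl
  refine ⟨φ.comp (crossedProduct Γ).subtype, hf, hg, fun S hS h1 h2 a => ?_⟩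
  have hle : crossedProduct Γ ≤ S.comap φ := by
    refine StarSubalgebra.topologicalClosure_minimal (StarAlgebra.adjoin_le ?_)
      (hS.preimage (StarAlgHom.continuous_of_cstarAlgebra φ))
    rintro _ (⟨f, rfl⟩ | ⟨γ, rfl⟩)
    · have : φ (univFun Γ f) ∈ S := by rw [hf]; exact h1 f
      exact this
    · have : φ (univGroup Γ γ) ∈ S := by rw [hg]; exact h2 γ
      exact this
  exact hle a.2

end CrossedProduct

/-- A homomorphism into `CalkinRep H` with values in the image of the Calkin algebra lifts to the
Calkin algebra, which `calkinRep` embeds. -/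
theorem HilbertBasis.exists_lift_calkinRep {H : Type*} [NormedAddCommGroup H]
    [InnerProductSpace ℂ H] [CompleteSpace H] (b : HilbertBasis ℕ ℂ H) {A : Type*} [Semiring A]
    [Algebra ℂ A] [Star A] (φ : A →⋆ₐ[ℂ] CalkinRep H) (h : ∀ a, φ a ∈ Set.range (essRep H)) :
    ∃ τ : A →⋆ₐ[ℂ] Calkin H, ∀ a, calkinRep H (τ a) = φ a := by
  choose t ht using h
  have hinj := b.calkinRep_injective
  refine ⟨{ toFun := fun a => calkinMk (t a), map_one' := hinj ?_, map_mul' := fun x y => hinj ?_,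
            map_zero' := hinj ?_, map_add' := fun x y => hinj ?_, commutes' := fun r => hinj ?_,
            map_star' := fun x => hinj ?_ }, ht⟩
  · rw [calkinRep_mk, ht, map_one, map_one]
  · rw [map_mul, calkinRep_mk, calkinRep_mk, calkinRep_mk, ht, ht, ht, map_mul]
  · rw [calkinRep_mk, ht, map_zero, map_zero]
  · rw [map_add, calkinRep_mk, calkinRep_mk, calkinRep_mk, ht, ht, ht, map_add]
  · rw [calkinRep_mk, ht, AlgHomClass.commutes, AlgHomClass.commutes]
  · rw [map_star, calkinRep_mk, calkinRep_mk, ht, ht, map_star]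

/-! ### The covariant pair on the Hardy space, modulo compact operators -/

namespace SU11

variable (g : SU11)

/-- The denominator `conj β z + conj α` on the circle. -/
def denFun : C(Circle, ℂ) := conj g.β • circleZ + conj g.α • 1

/-- The inverse square root of the denominator on the circle. -/
def rootFun : C(Circle, ℂ) := g.rootConst • invSqrt (g.ratio • circleZ)

theorem summable_ratio_smul_circleZ : Summable fun n => ‖(g.ratio • circleZ) ^ n‖ := by
  refine summable_norm_pow_of_norm_lt_one ?_
  rw [norm_smul]
  refine (mul_le_of_le_one_right (norm_nonneg _) ?_).trans_lt g.norm_ratio_lt_one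
  exact (ContinuousMap.norm_le _ zero_le_one).2 fun ζ => ζ.norm_coe.le

theorem denFun_mul_rootFun_sq : g.denFun * (g.rootFun * g.rootFun) = 1 :=
  g.den_smul_mul_invSqrt g.summable_ratio_smul_circleZ

end SU11

namespace HardySpace

open DiskSpace

theorem essRep_shift_mem : essRep HardySpace shift ∈ unitary (CalkinRep HardySpace) := by
  constructor
  · rw [← map_star, ← map_mul, star_shift_mul_shift, map_one]
  · rw [← map_star, ← map_mul, shift_mul_star_shift, map_sub, map_one,
      essRep_eq_zero isCompactOperator_constProj, sub_zero]

/-- The homomorphism which maps a continuous function to the class of its Toeplitz operator, obtained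
as the functional calculus of the class of the shift, which is unitary. -/
def circleRep : C(Circle, ℂ) →⋆ₐ[ℂ] CalkinRep HardySpace :=
  (exists_circleHom essRep_shift_mem).choose

theorem circleRep_circleZ : circleRep circleZ = essRep HardySpace shift :=
  (exists_circleHom essRep_shift_mem).choose_spec

theorem circleRep_denFun (g : SU11) : circleRep g.denFun = essRep HardySpace g.denOp := by
  rw [SU11.denFun, SU11.denOp, map_add, map_add, map_smul, map_smul, map_smul, map_smul, map_one,
    map_one, circleRep_circleZ]

theorem circleRep_rootFun (g : SU11) : circleRep g.rootFun = essRep HardySpace g.rootInvOp := by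
  rw [SU11.rootFun, SU11.rootInvOp, map_smul, map_smul,
    map_invSqrt _ (StarAlgHom.continuous_of_cstarAlgebra _) g.summable_ratio_smul_circleZ,
    map_invSqrt _ (StarAlgHom.continuous_of_cstarAlgebra _) g.summable_ratio_smul_shift,
    map_smul, map_smul, circleRep_circleZ]

end HardySpace

namespace DiskAut

open HardySpace DiskSpace

variable (γ : DiskAut)

theorem denFun_mul_boundary : (mat γ).denFun * circleZ.comp (boundary γ) =
    (mat γ).α • circleZ + (mat γ).β • 1 := by
  ext ζ
  have h1 : ((boundary γ ζ : Circle) : ℂ) = (mat γ).act ζ :=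
    coe_apply γ ⟨ζ, mem_closedBall_zero_iff.2 ζ.norm_coe.le⟩
  have h2 := (mat γ).den_ne_zero ζ.norm_coe.le
  change (conj (mat γ).β * (ζ : ℂ) + conj (mat γ).α * 1) * ((boundary γ ζ : Circle) : ℂ) =
    (mat γ).α * ζ + (mat γ).β * 1
  rw [h1, SU11.act, mul_one, mul_one]
  exact mul_div_cancel₀ _ h2

theorem circleRep_rootFun_mul : circleRep (mat γ).rootFun * essRep HardySpace (transplant γ) =
    circleRep (star (mat γ).rootFun) * essRep HardySpace (mat γ).hardyUnitary := by
  rw [map_star, circleRep_rootFun, essRep_rootInvOp_mul_transplant]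

theorem isUnit_circleRep_rootFun : IsUnit (circleRep (mat γ).rootFun) := by
  refine IsUnit.map circleRep (IsUnit.of_mul_eq_one ((mat γ).denFun * (mat γ).rootFun) ?_)
  rw [← (mat γ).denFun_mul_rootFun_sq]; ring

theorem isUnit_circleRep_denFun : IsUnit (circleRep (mat γ).denFun) :=
  IsUnit.map circleRep (IsUnit.of_mul_eq_one _ (mat γ).denFun_mul_rootFun_sq)

theorem essRep_transplant_mem :
    essRep HardySpace (transplant γ) ∈ unitary (CalkinRep HardySpace) :=
  Unitary.map_mem (essRep HardySpace) (transplant_mem γ)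

theorem essRep_transplant_mul_shift :
    essRep HardySpace (transplant γ) * circleRep circleZ =
      circleRep (circleZ.comp (boundary γ)) * essRep HardySpace (transplant γ) := by
  set T := essRep HardySpace (transplant γ) with hT
  set v := essRep HardySpace (mat γ).hardyUnitary with hv
  set a := (mat γ).rootFun with ha
  set d := (mat γ).denFun with hd
  have h1 : circleRep a * T = circleRep (star a) * v := circleRep_rootFun_mul γ
  have h2 : circleRep d * v * circleRep circleZ =
      circleRep (d * circleZ.comp (boundary γ)) * v := by
    have := congrArg (essRep HardySpace) (mat γ).compOp_mul_shift
    rw [SU11.compOp, map_mul, map_mul, map_mul, map_add, map_smul, map_smul, map_one] at this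
    rw [hd, denFun_mul_boundary, map_add, map_smul, map_smul, map_one, circleRep_denFun,
      circleRep_circleZ]
    exact this
  refine (isUnit_circleRep_denFun γ).mul_left_cancel
    ((isUnit_circleRep_rootFun γ).mul_left_cancel ?_)
  calc circleRep a * (circleRep d * (T * circleRep circleZ))
      = circleRep d * (circleRep a * T) * circleRep circleZ := by
        simp only [← mul_assoc, ← map_mul, mul_comm a d]
    _ = circleRep (star a) * (circleRep d * v * circleRep circleZ) := by
        rw [h1]; simp only [← mul_assoc, ← map_mul, mul_comm (star a) d]
    _ = circleRep (d * circleZ.comp (boundary γ)) * (circleRep a * T) := by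
        rw [h2, h1, ← mul_assoc, ← mul_assoc, ← map_mul, ← map_mul, mul_comm (star a)]
    _ = circleRep a * (circleRep d * (circleRep (circleZ.comp (boundary γ)) * T)) := by
        simp only [← mul_assoc, ← map_mul]
        congr 2
        ring

/-- The covariance relation; it suffices to check it on the generator `z` of `C(∂𝔻)`. -/
theorem essRep_transplant_mul_circleRep (f : C(Circle, ℂ)) :
    essRep HardySpace (transplant γ) * circleRep f * star (essRep HardySpace (transplant γ)) =
      circleRep (f.comp (boundary γ)) := by
  have h : ((Unitary.conjStarAlgAut ℂ _ ⟨_, essRep_transplant_mem γ⟩ :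
      CalkinRep HardySpace ≃⋆ₐ[ℂ] CalkinRep HardySpace) :
        CalkinRep HardySpace →⋆ₐ[ℂ] CalkinRep HardySpace).comp circleRep =
      circleRep.comp (ContinuousMap.compStarAlgHom' ℂ ℂ (boundary γ)) := by
    refine starAlgHom_circle_ext ?_
    change essRep HardySpace (transplant γ) * circleRep circleZ *
      star (essRep HardySpace (transplant γ)) = circleRep (circleZ.comp (boundary γ))
    rw [essRep_transplant_mul_shift, mul_assoc, (essRep_transplant_mem γ).2, mul_one]
  exact DFunLike.congr_fun h f

/-- Modulo compact operators, a composition operator is the transplanted unitary times the class of a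
continuous function; the function is `|J|`, where `J` is the denominator. -/
theorem essRep_compOp : essRep HardySpace (mat γ).compOp =
    circleRep ((mat γ).denFun * star ((mat γ).denFun * (mat γ).rootFun) * (mat γ).rootFun) *
      essRep HardySpace (transplant γ) := by
  have h := (mat γ).denFun_mul_rootFun_sq
  rw [map_mul, mul_assoc, circleRep_rootFun_mul, ← mul_assoc, ← map_mul, SU11.compOp, map_mul,
    ← circleRep_denFun]
  congr 2
  rw [mul_assoc, ← star_mul', mul_assoc, h, star_one, mul_one]

/-! ### Polar decompositions -/

theorem isUnit_compOp : IsUnit (mat γ).compOp := by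
  refine IsUnit.mul ?_ (Unitary.toUnits ⟨_, (mat γ).hardyUnitary_mem⟩).isUnit
  refine isUnit_iff_exists.2 ⟨_, (mat γ).denOp_mul_rootInvOp_sq, ?_⟩
  rw [← (mat γ).denOp_mul_rootInvOp_sq]
  exact ((mat γ).commute_rootInvOp_denOp.mul_left (mat γ).commute_rootInvOp_denOp).eq

end DiskAut

section Polar

variable {H : Type*} [NormedAddCommGroup H] [InnerProductSpace ℂ H] [CompleteSpace H]

/-- The positive part `(C C*)^{1/2}` of the polar decomposition. -/
def polarSqrt (C : H →L[ℂ] H) : H →L[ℂ] H := CFC.sqrt (C * star C)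

theorem polarSqrt_mul_self (C : H →L[ℂ] H) : polarSqrt C * polarSqrt C = C * star C :=
  CFC.sqrt_mul_sqrt_self _ (mul_star_self_nonneg C)

theorem exists_polarSqrt_eq (C : H →L[ℂ] H) : ∃ y, polarSqrt C = star y * y := by
  refine ⟨CFC.sqrt (polarSqrt C), ?_⟩
  rw [(CFC.sqrt_nonneg (polarSqrt C)).isSelfAdjoint.star_eq]
  exact (CFC.sqrt_mul_sqrt_self (polarSqrt C) (CFC.sqrt_nonneg _)).symm

theorem isUnit_polarSqrt {C : H →L[ℂ] H} (hC : IsUnit C) : IsUnit (polarSqrt C) := by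
  have h : IsUnit (polarSqrt C * polarSqrt C) := by
    rw [polarSqrt_mul_self]; exact hC.mul hC.star
  exact ((Commute.refl _).isUnit_mul_iff.1 h).1

theorem exists_isPolarUnitary {C : H →L[ℂ] H} (hC : IsUnit C) : ∃ U, IsPolarUnitary C U := by
  obtain ⟨P, hP⟩ := isUnit_polarSqrt hC
  have hPP := polarSqrt_mul_self C
  have hs : star (polarSqrt C) = polarSqrt C :=
    (CFC.sqrt_nonneg (C * star C)).isSelfAdjoint
  rw [← hP] at hPP hs
  set P' : H →L[ℂ] H := ((P⁻¹ : (H →L[ℂ] H)ˣ) : H →L[ℂ] H) with hP'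
  have h1 : P' * (P : H →L[ℂ] H) = 1 := P.inv_mul
  have h2 : (P : H →L[ℂ] H) * P' = 1 := P.mul_inv
  have hs' : (P : H →L[ℂ] H) * star P' = 1 := by
    have := congrArg star h1
    rwa [star_mul, star_one, hs] at this
  have hUU : (P' * C) * star (P' * C) = 1 := by
    calc (P' * C) * star (P' * C) = P' * (C * star C) * star P' := by
          rw [star_mul]; simp only [mul_assoc]
      _ = (P' * P) * (P * star P') := by rw [← hPP]; simp only [mul_assoc]
      _ = 1 := by rw [h1, hs', one_mul]
  have hU : IsUnit (P' * C) := (P⁻¹).isUnit.mul hC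
  refine ⟨P' * C, ?_, ?_⟩
  · refine Unitary.mem_iff.2 ⟨?_, hUU⟩
    refine hU.mul_left_cancel ?_
    rw [← mul_assoc, hUU, one_mul, mul_one]
  · change C = polarSqrt C * (P' * C)
    rw [← hP, ← mul_assoc, h2, one_mul]

theorem IsPolarUnitary.unique {C U U' : H →L[ℂ] H} (hC : IsUnit C) (h : IsPolarUnitary C U)
    (h' : IsPolarUnitary C U') : U = U' :=
  (isUnit_polarSqrt hC).mul_left_cancel (h.2.symm.trans h'.2)

end Polar

open HardySpace DiskSpace in
/-- Modulo compact operators, the unitary part of a composition operator on the Hardy space is the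
transplanted reduced composition operator of the Dirichlet space. -/
theorem DiskAut.essRep_of_isPolarUnitary (γ : DiskAut) {U : HardySpace →L[ℂ] HardySpace}
    (hU : IsPolarUnitary (mat γ).compOp U) :
    essRep HardySpace U = essRep HardySpace (transplant γ) := by
  set C := (mat γ).compOp with hC
  set a := (mat γ).rootFun with ha
  set d := (mat γ).denFun with hd
  set P := polarSqrt C with hP
  set v := essRep HardySpace (mat γ).hardyUnitary with hv
  have had : d * (a * a) = 1 := (mat γ).denFun_mul_rootFun_sq
  have hCv : essRep HardySpace C = circleRep d * v := by
    rw [hC, SU11.compOp, map_mul, circleRep_denFun]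
  have hvv : v * star v = 1 := by
    rw [← map_star, ← map_mul, (mat γ).hardyUnitary_mem.2, map_one]
  -- `|J| = |J a|²` for the inverse square root `a` of the denominator `J`.
  have hPq : essRep HardySpace P = circleRep (star (d * a) * (d * a)) := by
    obtain ⟨y, hy⟩ := exists_polarSqrt_eq C
    refine eq_of_sq_eq_sq_of_eq_star_mul_self (x := essRep HardySpace y)
      (y := circleRep (d * a)) ?_ ?_ ?_
    · rw [← map_star, ← map_mul, ← hy]
    · rw [map_mul, map_star]
    · rw [← map_mul, hP, polarSqrt_mul_self, map_mul, map_star, hCv, star_mul, ← map_star circleRep,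
        mul_assoc, ← mul_assoc v, hvv, one_mul, ← map_mul, ← map_mul]
      congr 1
      have h2 : d * a * (d * a) = d := by linear_combination d * had
      calc d * star d = (d * a * (d * a)) * star (d * a * (d * a)) := by rw [h2]
        _ = _ := by rw [star_mul' (d * a)]; ring
  have h1 : circleRep d * v = circleRep (star (d * a) * (d * a)) * essRep HardySpace U := by
    rw [← hCv, ← hPq, ← map_mul]
    exact congrArg _ hU.2
  refine (isUnit_circleRep_rootFun γ).mul_left_cancel ?_
  rw [circleRep_rootFun_mul]
  have h3 : star a * star (d * a) = 1 := by
    rw [← star_mul', ← star_one (C(Circle, ℂ)), ← had]; congr 1; ring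
  have h4 : a * (star a * (star (d * a) * (d * a))) = 1 := by
    linear_combination (a * (d * a)) * h3 + had
  calc circleRep a * essRep HardySpace U
      = circleRep (a * a * star a) * (circleRep d * v) := by
        rw [h1, ← mul_assoc, ← map_mul]
        congr 2
        linear_combination -a * h4
    _ = circleRep (star a) * v := by
        rw [← mul_assoc, ← map_mul]
        congr 2
        linear_combination star a * had

/-! ### The algebra generated by the composition operators -/

section CompositionAlgebra

open HardySpace DiskSpace InnerProductSpace

variable {Γ : Subgroup DiskAut}

theorem isClosed_compositionAlgebra :
    IsClosed (compositionAlgebra Γ : Set (HardySpace →L[ℂ] HardySpace)) :=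
  StarSubalgebra.isClosed_topologicalClosure _

theorem compOp_mem_compositionAlgebra {γ : DiskAut} (hγ : γ ∈ Γ) :
    (DiskAut.mat γ).compOp ∈ compositionAlgebra Γ :=
  StarSubalgebra.le_topologicalClosure _
    (StarAlgebra.subset_adjoin ℂ _ ⟨γ, hγ, DiskAut.isComposition_compOp γ⟩)

theorem mul_combination {A : Type*} [Ring A] [Algebra ℂ A] (a a' b b' : ℂ) (s t : A) :
    (b' • s + a' • 1) * (b • t + a • 1) =
      (a * a') • 1 + (b * b') • (s * t) + (a * b') • s + (b * a') • t := by
  rw [add_mul, mul_add, mul_add, smul_mul_smul_comm, smul_mul_smul_comm, smul_mul_smul_comm,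
    smul_mul_smul_comm, mul_one, one_mul, one_mul, mul_comm b', mul_comm b', mul_comm a',
    mul_comm a']
  abel

theorem smul_combination_sub {M : Type*} [AddCommGroup M] [Module ℂ M] {r a b c d b' c' d' : ℂ}
    (o q s t : M) (ha : r * a = 1) (hb : r * b = b') (hc : r * c = c') (hd : r * d = d') :
    r • (a • o + b • q + c • s + d • t) - o = b' • q + c' • s + d' • t := by
  rw [smul_add, smul_add, smul_add, smul_smul, smul_smul, smul_smul, smul_smul, ha, hb, hc, hd,
    one_smul]
  abel

/-- The unitary part cancels in `C C*`, which leaves a combination of the identity, the shift, its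
adjoint and the projection onto the constants. -/
theorem SU11.compOp_mul_star_compOp (g : SU11) : g.compOp * star g.compOp =
    (g.α * conj g.α) • 1 + (g.β * conj g.β) • (1 - constProj) + (g.α * conj g.β) • shift +
      (g.β * conj g.α) • star shift := by
  have h : g.compOp * star g.compOp = g.denOp * star g.denOp := by
    rw [compOp, star_mul, mul_assoc, ← mul_assoc g.hardyUnitary, g.hardyUnitary_mem.2, one_mul]
  have hs : star g.denOp = g.β • star shift + g.α • 1 := by
    rw [denOp, star_add, star_smul, star_smul, star_one]
    simp
  rw [h, hs, denOp, ← shift_mul_star_shift]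
  exact mul_combination g.α (conj g.α) g.β (conj g.β) shift (star shift)

/-- The combination of the shift, its adjoint and the projection onto the constants which
`γ ∈ Γ` contributes to `𝒞_Γ`; here `w = γ(0)`. -/
theorem orbit_combination_mem (γ : Γ) {w : ℂ}
    (hw : w = (((γ : DiskAut) : ClosedDisk ≃ₜ ClosedDisk) diskOrigin : ℂ)) :
    (w * conj w) • (1 - constProj) + (-conj w) • shift + (-w) • star shift ∈
      compositionAlgebra Γ := by
  set g := DiskAut.mat ((γ⁻¹ : Γ) : DiskAut) with hg
  have h0 : g.α * w + g.β = 0 := by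
    have h1 := DiskAut.coe_apply ((γ⁻¹ : Γ) : DiskAut)
      (((γ : DiskAut) : ClosedDisk ≃ₜ ClosedDisk) diskOrigin)
    have h2 : (((γ⁻¹ : Γ) : DiskAut) : ClosedDisk ≃ₜ ClosedDisk)
        (((γ : DiskAut) : ClosedDisk ≃ₜ ClosedDisk) diskOrigin) = diskOrigin :=
      ((γ : DiskAut) : ClosedDisk ≃ₜ ClosedDisk).symm_apply_apply diskOrigin
    rw [h2, ← hw] at h1
    have h3 : ‖w‖ ≤ 1 := by
      rw [hw]; exact mem_closedBall_zero_iff.1 (Subtype.property _)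
    have h4 : (0 : ℂ) = (g.α * w + g.β) / g.den w := h1
    rcases div_eq_zero_iff.1 h4.symm with h | h
    · exact h
    · exact absurd h (g.den_ne_zero h3)
  have hβ : g.β = -(g.α * w) := by linear_combination h0
  have hα := g.α_ne_zero
  have hα' : conj g.α ≠ 0 := (map_ne_zero _).2 hα
  have hC : g.compOp ∈ compositionAlgebra Γ := compOp_mem_compositionAlgebra (γ⁻¹ : Γ).2
  have hmem := sub_mem ((compositionAlgebra Γ).smul_mem (mul_mem hC (star_mem hC))
    (g.α * conj g.α)⁻¹) (one_mem (compositionAlgebra Γ))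
  have e1 : (g.α * conj g.α)⁻¹ * (g.α * conj g.α) = 1 := inv_mul_cancel₀ (mul_ne_zero hα hα')
  have e2 : (g.α * conj g.α)⁻¹ * (g.β * conj g.β) = w * conj w := by
    rw [hβ, map_neg, map_mul]; field_simp
  have e3 : (g.α * conj g.α)⁻¹ * (g.α * conj g.β) = -conj w := by
    rw [hβ, map_neg, map_mul]; field_simp
  have e4 : (g.α * conj g.α)⁻¹ * (g.β * conj g.α) = -w := by
    rw [hβ]; field_simp
  rw [g.compOp_mul_star_compOp] at hmem
  have key := smul_combination_sub (1 : HardySpace →L[ℂ] HardySpace) (1 - constProj) shift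
    (star shift) e1 e2 e3 e4
  rw [← key]
  exact hmem

/-- A quadratic polynomial in `ζ` and `conj ζ` of this shape which vanishes on the orbit of `0`
vanishes on the limit set, hence identically. -/
theorem eq_zero_of_orbit_relation (hne : IsNonElementary Γ) {x y z : ℂ}
    (h : ∀ γ : Γ, ∀ w : ℂ, w = (((γ : DiskAut) : ClosedDisk ≃ₜ ClosedDisk) diskOrigin : ℂ) →
      w * conj w * x + -conj w * y + -w * z = 0) : x = 0 ∧ y = 0 ∧ z = 0 := by
  have hcl : IsClosed {w : ℂ | w * conj w * x + -conj w * y + -w * z = 0} := by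
    refine isClosed_eq ?_ continuous_const
    have : Continuous fun w : ℂ => conj w := Complex.continuous_conj
    fun_prop
  have hlim : ∀ ζ ∈ limitSet Γ, x * ζ - y - z * ζ ^ 2 = 0 := fun ζ hζ => by
    have h1 : ζ ∈ closure (Set.range fun γ : Γ =>
        (((γ : DiskAut) : ClosedDisk ≃ₜ ClosedDisk) diskOrigin : ℂ)) :=
      mem_closure_iff_clusterPt.2 hζ.2.clusterPt
    have h2 : ζ * conj ζ * x + -conj ζ * y + -ζ * z = 0 :=
      closure_minimal (by rintro _ ⟨γ, rfl⟩; exact h γ _ rfl) hcl h1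
    have h3 : ζ * conj ζ = 1 := by
      rw [Complex.mul_conj, Complex.normSq_eq_norm_sq, hζ.1]; simp
    linear_combination ζ * h2 - (x * ζ - y) * h3
  let p : Polynomial ℂ := Polynomial.C x * Polynomial.X - Polynomial.C y -
    Polynomial.C z * Polynomial.X ^ 2
  have hp : p = 0 := Polynomial.eq_zero_of_infinite_isRoot p (hne.mono fun ζ hζ => by
    simpa [p, Polynomial.IsRoot] using hlim ζ hζ)
  have hc : ∀ n, p.coeff n = 0 := fun n => by rw [hp, Polynomial.coeff_zero]
  have h0 := hc 0
  have h1 := hc 1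
  have h2 := hc 2
  simp [p, Polynomial.coeff_X, Polynomial.coeff_C] at h0 h1 h2
  exact ⟨h1, h0, h2⟩

/-- The coefficients `(w conj w, -conj w, -w)` of the combinations in `orbit_combination_mem` span
`ℂ³`: a functional which annihilates them all is a relation as in `eq_zero_of_orbit_relation`. -/
theorem shift_combination_mem (hne : IsNonElementary Γ) (c : ℂ × ℂ × ℂ) :
    c.1 • (1 - constProj) + c.2.1 • shift + c.2.2 • star shift ∈ compositionAlgebra Γ := by
  let L : ℂ × ℂ × ℂ →ₗ[ℂ] (HardySpace →L[ℂ] HardySpace) :=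
    (LinearMap.fst ℂ ℂ (ℂ × ℂ)).smulRight (1 - constProj) +
      ((LinearMap.fst ℂ ℂ ℂ).comp (LinearMap.snd ℂ ℂ (ℂ × ℂ))).smulRight shift +
      ((LinearMap.snd ℂ ℂ ℂ).comp (LinearMap.snd ℂ ℂ (ℂ × ℂ))).smulRight (star shift)
  let W : Submodule ℂ (ℂ × ℂ × ℂ) :=
    (Subalgebra.toSubmodule (compositionAlgebra Γ).toSubalgebra).comap L
  have hW : W = ⊤ := by
    by_contra hcon
    obtain ⟨f, hf0, hf⟩ := Submodule.exists_le_ker_of_lt_top W (lt_top_iff_ne_top.2 hcon)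
    have hfc : ∀ a b c : ℂ, f (a, b, c) = a * f (1, 0, 0) + b * f (0, 1, 0) + c * f (0, 0, 1) := by
      intro a b c
      rw [← smul_eq_mul, ← smul_eq_mul, ← smul_eq_mul, ← map_smul, ← map_smul, ← map_smul,
        ← map_add, ← map_add]
      simp
    obtain ⟨h1, h2, h3⟩ := eq_zero_of_orbit_relation hne (x := f (1, 0, 0)) (y := f (0, 1, 0))
      (z := f (0, 0, 1)) fun γ w hw => by
        rw [← hfc]
        exact hf (x := (w * conj w, -conj w, -w)) (orbit_combination_mem γ hw)
    refine hf0 (LinearMap.ext fun c => ?_)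
    obtain ⟨a, b, c⟩ := c
    rw [hfc, h1, h2, h3]
    simp
  have : c ∈ W := hW ▸ Submodule.mem_top
  exact this

theorem shift_mem_compositionAlgebra (hne : IsNonElementary Γ) :
    shift ∈ compositionAlgebra Γ := by
  refine (congrArg (· ∈ compositionAlgebra Γ) ?_).mp (shift_combination_mem hne (0, 1, 0))
  exact ContinuousLinearMap.ext fun f => DiskSpace.ext fun n => by simp

theorem constProj_mem_compositionAlgebra (hne : IsNonElementary Γ) :
    constProj ∈ compositionAlgebra Γ := by
  have h : 1 - constProj ∈ compositionAlgebra Γ := by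
    refine (congrArg (· ∈ compositionAlgebra Γ) ?_).mp (shift_combination_mem hne (1, 0, 0))
    exact ContinuousLinearMap.ext fun f => DiskSpace.ext fun n => by simp
  simpa using sub_mem (one_mem _) h

/-- The matrix units of the Hardy space, in terms of the shift. -/
theorem HardySpace.rankOne_basis (i j : ℕ) :
    rankOne ℂ (basis (fun _ => 1) i : HardySpace) (basis (fun _ => 1) j : HardySpace) =
      shift ^ i * constProj * star (shift ^ j) := by
  have h : ∀ i, (shift ^ i) (basis (fun _ => 1) 0) = basis (fun _ => 1) i := fun i => by
    induction i with
    | zero => rfl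
    | succ i ih => rw [pow_succ', mul_apply_eq_comp, ih, shift_basis]
  ext1 f
  rw [mul_apply_eq_comp, mul_apply_eq_comp, constProj, rankOne_apply, rankOne_apply, map_smul, h,
    ContinuousLinearMap.star_eq_adjoint, ContinuousLinearMap.adjoint_inner_right, h]

theorem isCompactOperator_mem_compositionAlgebra (hne : IsNonElementary Γ)
    {T : HardySpace →L[ℂ] HardySpace} (hT : IsCompactOperator T) : T ∈ compositionAlgebra Γ := by
  set b : HilbertBasis ℕ ℂ HardySpace := basis fun _ => 1 with hb
  have h1 : ∀ i j, rankOne ℂ (b i) (b j) ∈ compositionAlgebra Γ := fun i j => by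
    have hS := shift_mem_compositionAlgebra hne
    rw [hb, rankOne_basis]
    exact mul_mem (mul_mem (pow_mem hS i) (constProj_mem_compositionAlgebra hne))
      (star_mem (pow_mem hS j))
  have h2 : ∀ x j, rankOne ℂ x (b j) ∈ compositionAlgebra Γ := fun x j => by
    have hc : Continuous fun x : HardySpace => rankOne ℂ x (b j) := by fun_prop
    refine isClosed_compositionAlgebra.mem_of_tendsto ((hc.tendsto x).comp (b.tendsto_truncation x))
      (Eventually.of_forall fun n => ?_)
    change rankOne ℂ (b.truncation n x) (b j) ∈ compositionAlgebra Γ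
    rw [HilbertBasis.truncation_apply, map_sum]
    simp only [map_smul, sum_apply, smul_apply]
    exact sum_mem fun k _ => SMulMemClass.smul_mem _ (h1 k j)
  have h3 : Tendsto (fun n => T * b.truncation n) atTop (𝓝 T) := by
    have := (tendsto_const_nhds (x := T)).sub (b.tendsto_mul_one_sub_truncation hT)
    simpa [mul_sub] using this
  refine isClosed_compositionAlgebra.mem_of_tendsto h3 (Eventually.of_forall fun n => ?_)
  have h4 : T * b.truncation n = ∑ k ∈ Finset.range n, rankOne ℂ (T (b k)) (b k) := by
    rw [HilbertBasis.truncation, Finset.mul_sum]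
    refine Finset.sum_congr rfl fun k _ => ?_
    ext1 f
    rw [mul_apply_eq_comp, rankOne_apply, rankOne_apply, map_smul]
  rw [h4]
  exact sum_mem fun k _ => h2 _ _

/-- The image of `𝒞_Γ` under `essRep` is closed, as the range of a homomorphism of C⋆-algebras. -/
theorem isClosed_map_compositionAlgebra :
    IsClosed ((compositionAlgebra Γ).map (essRep HardySpace) : Set (CalkinRep HardySpace)) := by
  have : IsClosed (compositionAlgebra Γ : Set (HardySpace →L[ℂ] HardySpace)) :=
    isClosed_compositionAlgebra
  have h := StarAlgHom.isClosed_range ((essRep HardySpace).comp (compositionAlgebra Γ).subtype)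
  refine (congrArg IsClosed ?_).mp h
  ext x
  constructor
  · rintro ⟨T, rfl⟩
    exact ⟨T, T.2, rfl⟩
  · rintro ⟨T, hT, rfl⟩
    exact ⟨⟨T, hT⟩, rfl⟩

theorem circleRep_mem_map_compositionAlgebra (hne : IsNonElementary Γ) (f : C(Circle, ℂ)) :
    circleRep f ∈ (compositionAlgebra Γ).map (essRep HardySpace) := by
  have h1 : (StarAlgebra.adjoin ℂ {circleZ}).topologicalClosure ≤
      ((compositionAlgebra Γ).map (essRep HardySpace)).comap circleRep := by
    refine StarSubalgebra.topologicalClosure_minimal (StarAlgebra.adjoin_le ?_)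
      (isClosed_map_compositionAlgebra.preimage (StarAlgHom.continuous_of_cstarAlgebra circleRep))
    exact Set.singleton_subset_iff.2
      ⟨shift, shift_mem_compositionAlgebra hne, circleRep_circleZ.symm⟩
  rw [starAdjoin_circleZ_dense] at h1
  exact h1 (show f ∈ ⊤ from trivial)

theorem essRep_transplant_mem_map_compositionAlgebra (hne : IsNonElementary Γ) {γ : DiskAut}
    (hγ : γ ∈ Γ) : essRep HardySpace (DiskAut.transplant γ) ∈
      (compositionAlgebra Γ).map (essRep HardySpace) := by
  have h := DiskAut.essRep_compOp γ
  set a := (DiskAut.mat γ).rootFun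
  set d := (DiskAut.mat γ).denFun
  have had : d * (a * a) = 1 := (DiskAut.mat γ).denFun_mul_rootFun_sq
  have hk : a * star a * (d * star (d * a) * a) = 1 := by
    have h1 : star a * star (d * a) = 1 := by
      rw [← star_mul', ← star_one (C(Circle, ℂ)), ← had]; congr 1; ring
    linear_combination (a * a * d) * h1 + had
  have hT : essRep HardySpace (DiskAut.transplant γ) =
      circleRep (a * star a) * essRep HardySpace (DiskAut.mat γ).compOp := by
    rw [h, ← mul_assoc, ← map_mul, hk, map_one, one_mul]
  rw [hT]
  exact mul_mem (circleRep_mem_map_compositionAlgebra hne _)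
    ⟨_, compOp_mem_compositionAlgebra hγ, rfl⟩

end CompositionAlgebra

/-! ### The two extensions and their equivalence -/

section Main

open HardySpace DiskSpace

variable {Γ : Subgroup DiskAut}

theorem crossedProduct.calkin_hom_ext {H : Type*} [NormedAddCommGroup H] [InnerProductSpace ℂ H]
    [CompleteSpace H] (b : HilbertBasis ℕ ℂ H) {φ ψ : crossedProduct Γ →⋆ₐ[ℂ] Calkin H}
    (hz : φ (ofFun Γ circleZ) = ψ (ofFun Γ circleZ))
    (hγ : ∀ γ : Γ, φ (ofGroup Γ γ⁻¹) = ψ (ofGroup Γ γ⁻¹)) : φ = ψ := by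
  have h : (calkinRep H).comp φ = (calkinRep H).comp ψ :=
    crossedProduct.hom_ext (congrArg (calkinRep H) hz) fun γ => by
      have := congrArg (calkinRep H) (hγ γ⁻¹)
      rwa [inv_inv] at this
  exact StarAlgHom.ext fun a => b.calkinRep_injective (DFunLike.congr_fun h a)

/-- The unitary representation of `Γ` by the transplanted operators, modulo compact operators. -/
def transplantHom (Γ : Subgroup DiskAut) : Γ →* unitary (CalkinRep HardySpace) where
  toFun γ := ⟨essRep HardySpace (DiskAut.transplant (γ : DiskAut)⁻¹),
    DiskAut.essRep_transplant_mem _⟩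
  map_one' := Subtype.ext (by
    change essRep HardySpace (DiskAut.transplant (1 : DiskAut)⁻¹) = 1
    rw [inv_one, DiskAut.transplant_one, map_one])
  map_mul' γ η := Subtype.ext (by
    change essRep HardySpace (DiskAut.transplant ((γ : DiskAut) * η)⁻¹) =
      essRep HardySpace (DiskAut.transplant (γ : DiskAut)⁻¹) *
        essRep HardySpace (DiskAut.transplant (η : DiskAut)⁻¹)
    rw [mul_inv_rev, DiskAut.transplant_mul, map_mul])

theorem coe_transplantHom_inv (γ : Γ) : (transplantHom Γ γ⁻¹ : CalkinRep HardySpace) =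
    essRep HardySpace (DiskAut.transplant γ) :=
  congrArg (fun γ => essRep HardySpace (DiskAut.transplant γ)) (inv_inv (γ : DiskAut))

/-- The homomorphism on the crossed product which the covariant pair defines, with values in the
image of `𝒞_Γ`. -/
theorem exists_crossedProduct_hom (hne : IsNonElementary Γ) :
    ∃ φ : crossedProduct Γ →⋆ₐ[ℂ] CalkinRep HardySpace,
      (∀ f, φ (crossedProduct.ofFun Γ f) = circleRep f) ∧
      (∀ γ : Γ, φ (crossedProduct.ofGroup Γ γ⁻¹) = essRep HardySpace (DiskAut.transplant γ)) ∧
      ∀ a, φ a ∈ (compositionAlgebra Γ).map (essRep HardySpace) := by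
  obtain ⟨φ, hφf, hφγ, hφS⟩ := crossedProduct.exists_hom circleRep (transplantHom Γ)
    fun γ f => DiskAut.essRep_transplant_mul_circleRep _ f
  exact ⟨φ, hφf, fun γ => (hφγ γ⁻¹).trans (coe_transplantHom_inv γ),
    hφS _ isClosed_map_compositionAlgebra (circleRep_mem_map_compositionAlgebra hne)
      fun γ => essRep_transplant_mem_map_compositionAlgebra hne (inv_mem γ.2)⟩

theorem essRep_mem_range_of_mem_compositionAlgebra
    {φ : crossedProduct Γ →⋆ₐ[ℂ] CalkinRep HardySpace}
    (hf : ∀ f, φ (crossedProduct.ofFun Γ f) = circleRep f)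
    (hγ : ∀ γ : Γ, φ (crossedProduct.ofGroup Γ γ⁻¹) = essRep HardySpace (DiskAut.transplant γ))
    {T : HardySpace →L[ℂ] HardySpace} (hT : T ∈ compositionAlgebra Γ) :
    essRep HardySpace T ∈ Set.range φ := by
  have hle : compositionAlgebra Γ ≤ (StarAlgHom.range φ).comap (essRep HardySpace) := by
    refine StarSubalgebra.topologicalClosure_minimal (StarAlgebra.adjoin_le ?_)
      ((StarAlgHom.isClosed_range φ).preimage
        (StarAlgHom.continuous_of_cstarAlgebra (essRep HardySpace)))
    rintro C ⟨γ, hγ', hC⟩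
    have h1 : essRep HardySpace C ∈ StarAlgHom.range φ := by
      rw [hC.unique (DiskAut.isComposition_compOp γ), DiskAut.essRep_compOp, ← hf,
        ← hγ ⟨γ, hγ'⟩]
      exact mul_mem ⟨_, rfl⟩ ⟨_, rfl⟩
    exact h1
  exact hle hT

/-- A homomorphism into `CalkinRep` whose range is the image of an algebra `S` of operators lifts to the
Calkin algebra; if `S` contains the compact operators, it is the full inverse image of the range. -/
theorem exists_lift_of_range_eq {A : Type*} [Semiring A] [Algebra ℂ A] [Star A]
    (φ : A →⋆ₐ[ℂ] CalkinRep HardySpace)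
    {S : StarSubalgebra ℂ (HardySpace →L[ℂ] HardySpace)}
    (hφ : ∀ a, φ a ∈ S.map (essRep HardySpace))
    (hS : ∀ T ∈ S, essRep HardySpace T ∈ Set.range φ)
    (hK : ∀ T : HardySpace →L[ℂ] HardySpace, IsCompactOperator T → T ∈ S) :
    ∃ τ : A →⋆ₐ[ℂ] Calkin HardySpace,
      (∀ a T, φ a = essRep HardySpace T → τ a = calkinMk T) ∧
      ∀ T : HardySpace →L[ℂ] HardySpace, T ∈ S ↔ calkinMk T ∈ Set.range τ := by
  let b : HilbertBasis ℕ ℂ HardySpace := basis fun _ => 1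
  have hinj : Function.Injective (calkinRep HardySpace) := b.calkinRep_injective
  obtain ⟨τ, hτ⟩ := b.exists_lift_calkinRep φ fun a => by
    obtain ⟨T, -, hT⟩ := hφ a
    exact ⟨T, hT⟩
  refine ⟨τ, fun a T h => hinj ((hτ a).trans h), fun T => ⟨fun hT => ?_, ?_⟩⟩
  · obtain ⟨a, ha⟩ := hS T hT
    exact ⟨a, hinj ((hτ a).trans ha)⟩
  · rintro ⟨a, ha⟩
    obtain ⟨T', hT', h⟩ := hφ a
    have h1 : calkinMk T = calkinMk T' :=
      hinj ((congrArg _ ha).symm.trans ((hτ a).trans h.symm))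
    have h2 := add_mem (hK _ (calkinMk_eq_iff.1 h1)) hT'
    rwa [sub_add_cancel] at h2

/-- The Busby map exists, and `𝒞_Γ` is the inverse image of its range. -/
theorem exists_busbyMap (hne : IsNonElementary Γ) :
    ∃ τ : crossedProduct Γ →⋆ₐ[ℂ] Calkin HardySpace,
      τ (crossedProduct.ofFun Γ circleZ) = calkinMk shift ∧
      (∀ γ : Γ, τ (crossedProduct.ofGroup Γ γ⁻¹) = calkinMk (DiskAut.transplant γ)) ∧
      ∀ T : HardySpace →L[ℂ] HardySpace,
        T ∈ compositionAlgebra Γ ↔ calkinMk T ∈ Set.range τ := by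
  obtain ⟨φ, hf, hγ, hran⟩ := exists_crossedProduct_hom hne
  obtain ⟨τ, hτ, hτ'⟩ := exists_lift_of_range_eq φ hran
    (fun T => essRep_mem_range_of_mem_compositionAlgebra hf hγ)
    fun T => isCompactOperator_mem_compositionAlgebra hne
  exact ⟨τ, hτ _ _ ((hf _).trans circleRep_circleZ), fun γ => hτ _ _ (hγ γ), hτ'⟩

theorem IsBusbyMap.apply_ofFun {τ : crossedProduct Γ →⋆ₐ[ℂ] Calkin HardySpace}
    (h : IsBusbyMap Γ τ) : τ (crossedProduct.ofFun Γ circleZ) = calkinMk shift := by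
  obtain ⟨S, hS, h1⟩ := h.2.1
  rw [h1, hS.unique isMulZ_shift]

theorem IsBusbyMap.apply_ofGroup {τ : crossedProduct Γ →⋆ₐ[ℂ] Calkin HardySpace}
    (h : IsBusbyMap Γ τ) (γ : Γ) :
    τ (crossedProduct.ofGroup Γ γ⁻¹) = calkinMk (DiskAut.transplant γ) := by
  obtain ⟨C, U, hC, hU, h1⟩ := h.2.2 γ
  rw [hC.unique (DiskAut.isComposition_compOp γ)] at hU
  rw [h1]
  exact (basis fun _ => 1 : HilbertBasis ℕ ℂ HardySpace).essRep_eq_iff.1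
    (DiskAut.essRep_of_isPolarUnitary γ hU)

theorem existsUnique_isBusbyMap (hne : IsNonElementary Γ) :
    ∃! τ : crossedProduct Γ →⋆ₐ[ℂ] Calkin HardySpace, IsBusbyMap Γ τ := by
  obtain ⟨τ, hz, hγ, hran⟩ := exists_busbyMap hne
  refine ⟨τ, ⟨hran, ⟨shift, isMulZ_shift, hz⟩, fun γ => ?_⟩, fun τ' h => ?_⟩
  · obtain ⟨U, hU⟩ := exists_isPolarUnitary (DiskAut.isUnit_compOp (γ : DiskAut))
    refine ⟨_, U, DiskAut.isComposition_compOp _, hU, (hγ γ).trans ?_⟩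
    exact (basis fun _ => 1 : HilbertBasis ℕ ℂ HardySpace).essRep_eq_iff.1
      (DiskAut.essRep_of_isPolarUnitary _ hU).symm
  · exact crossedProduct.calkin_hom_ext (basis fun _ => 1) (h.apply_ofFun.trans hz.symm)
      fun γ => (h.apply_ofGroup γ).trans (hγ γ).symm

/-- Conjugation by a unitary between Hilbert spaces, on the Calkin algebras. -/
def Calkin.conj {H K : Type*} [NormedAddCommGroup H] [InnerProductSpace ℂ H] [CompleteSpace H]
    [NormedAddCommGroup K] [InnerProductSpace ℂ K] [CompleteSpace K] (e : H ≃ₗᵢ[ℂ] K) :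
    Calkin H →⋆ₐ[ℂ] Calkin K :=
  Calkin.lift (calkinMk.comp (StarAlgHomClass.toStarAlgHom e.conjStarAlgEquiv)) fun T hT => by
    rw [← map_zero (calkinMk (H := K))]
    refine calkinMk_eq_iff.2 ?_
    rw [sub_zero]
    exact (hT.comp_clm (e.symm : K →L[ℂ] H)).clm_comp (e : H →L[ℂ] K)

theorem Calkin.conj_mk {H K : Type*} [NormedAddCommGroup H] [InnerProductSpace ℂ H]
    [CompleteSpace H] [NormedAddCommGroup K] [InnerProductSpace ℂ K] [CompleteSpace K]
    (e : H ≃ₗᵢ[ℂ] K) (T : H →L[ℂ] H) :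
    Calkin.conj e (calkinMk T) = calkinMk (e.conjStarAlgEquiv T) := rfl

theorem IsToeplitzDirichletMap.apply_ofFun {σ : crossedProduct Γ →⋆ₐ[ℂ] Calkin DirichletSpace}
    (h : IsToeplitzDirichletMap Γ σ) : σ (crossedProduct.ofFun Γ circleZ) =
      calkinMk (toDirichlet.conjStarAlgEquiv DirichletSpace.transplantedShift) := by
  obtain ⟨M, hM, h1⟩ := h.1
  rw [h1, hM.unique DirichletSpace.isMulZ_conj_transplantedShift]

theorem IsToeplitzDirichletMap.apply_ofGroup
    {σ : crossedProduct Γ →⋆ₐ[ℂ] Calkin DirichletSpace} (h : IsToeplitzDirichletMap Γ σ) (γ : Γ) :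
    σ (crossedProduct.ofGroup Γ γ⁻¹) = calkinMk (DiskAut.reduced γ) := by
  obtain ⟨u, hu, -, h1⟩ := h.2 γ
  rw [h1, hu.unique (DiskAut.isReducedComposition_reduced _)]

theorem IsToeplitzDirichletMap.unique {σ σ' : crossedProduct Γ →⋆ₐ[ℂ] Calkin DirichletSpace}
    (h : IsToeplitzDirichletMap Γ σ) (h' : IsToeplitzDirichletMap Γ σ') : σ = σ' :=
  crossedProduct.calkin_hom_ext (basis _) (h.apply_ofFun.trans h'.apply_ofFun.symm)
    fun γ => (h.apply_ofGroup γ).trans (h'.apply_ofGroup γ).symm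

/-- Conjugation by the unitary `toDirichlet` turns the Busby map into the Toeplitz extension on the
Dirichlet space. -/
theorem IsBusbyMap.isToeplitzDirichletMap {τ : crossedProduct Γ →⋆ₐ[ℂ] Calkin HardySpace}
    (h : IsBusbyMap Γ τ) : IsToeplitzDirichletMap Γ ((Calkin.conj toDirichlet).comp τ) := by
  refine ⟨⟨_, DirichletSpace.isMulZ_conj_transplantedShift, ?_⟩, fun γ =>
    ⟨_, DiskAut.isReducedComposition_reduced _, DiskAut.reduced_mem _, ?_⟩⟩
  · rw [StarAlgHom.comp_apply, h.apply_ofFun, ← Calkin.conj_mk]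
    congr 1
    exact (basis fun _ => 1 : HilbertBasis ℕ ℂ HardySpace).essRep_eq_iff.1
      DirichletSpace.essRep_transplantedShift.symm
  · rw [StarAlgHom.comp_apply, h.apply_ofGroup, Calkin.conj_mk]
    congr 1
    exact StarAlgEquiv.apply_symm_apply _ _

theorem unitarilyEquivalent_conj {H K : Type*} [NormedAddCommGroup H] [InnerProductSpace ℂ H]
    [CompleteSpace H] [NormedAddCommGroup K] [InnerProductSpace ℂ K] [CompleteSpace K]
    {A : Type*} [Semiring A] [Algebra ℂ A] [Star A] (e : H ≃ₗᵢ[ℂ] K) (τ : A →⋆ₐ[ℂ] Calkin H) :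
    UnitarilyEquivalent τ ((Calkin.conj e).comp τ) := by
  have hadj : ContinuousLinearMap.adjoint (e : H →L[ℂ] K) = (e.symm : K →L[ℂ] H) :=
    e.adjoint_eq_symm
  refine ⟨(e : H →L[ℂ] K), ?_, ?_, fun a T hT => ?_⟩
  · rw [hadj, ← map_one (calkinMk (H := H))]
    congr 1
    ext1 x
    exact e.symm_apply_apply x
  · rw [hadj, ← map_one (calkinMk (H := K))]
    congr 1
    ext1 x
    exact e.apply_symm_apply x
  · rw [hadj, StarAlgHom.comp_apply, ← hT]
    rfl

end Main

theorem theorem4p4 (Γ : Subgroup DiskAut) (hΓ : IsFuchsian Γ) (hne : IsNonElementary Γ) :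
    (∃! τ : crossedProduct Γ →⋆ₐ[ℂ] Calkin HardySpace, IsBusbyMap Γ τ) ∧
    (∃! σ : crossedProduct Γ →⋆ₐ[ℂ] Calkin DirichletSpace, IsToeplitzDirichletMap Γ σ) ∧
    ∀ (τ : crossedProduct Γ →⋆ₐ[ℂ] Calkin HardySpace)
      (σ : crossedProduct Γ →⋆ₐ[ℂ] Calkin DirichletSpace),
      IsBusbyMap Γ τ → IsToeplitzDirichletMap Γ σ → UnitarilyEquivalent τ σ := by
  refine ⟨existsUnique_isBusbyMap hne, ?_, fun τ σ hτ hσ => ?_⟩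
  · obtain ⟨τ, hτ, -⟩ := existsUnique_isBusbyMap hne
    exact ⟨_, hτ.isToeplitzDirichletMap, fun σ hσ => hσ.unique hτ.isToeplitzDirichletMap⟩
  · rw [hσ.unique hτ.isToeplitzDirichletMap]
    exact unitarilyEquivalent_conj HardySpace.toDirichlet τ

end
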